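/- **Setting.** Let $I\subseteq\mathbb R$ be an open interval and $\mathbb N=\{0,1,2,\dots\}$. A *$C^q$-curve of polynomials* of degree $n$ on $I$ ($q\in\mathbb N\cup\{\infty\}$) is a family $P(t)(z)=z^n+\sum_{j=1}^n(-1)^ja_j(t)z^{n-j}$, $t\in I$, with all $a_j\in C^q(I,\mathbb C)$. It is *$C^q$-solvable* if there are $\lambda_1,\dots,\lambda_n\in C^q(I,\mathbb C)$ with $P(t)(z)=\prod_j(z-\lambda_j(t))$ for all $t\in I$. We use $\infty+k=\infty-k=\infty$ for $k\in\mathbb N$, $\infty+\infty=\infty$, $\inf\emptyset=\infty$. For $f$ continuous near $t_0$ let $m_{t_0}(f)\in\mathbb N\cup\{\infty\}$ be the supremum of all $k\in\mathbb N$ such that $f(t)=(t-t_0)^kg(t)$ near $t_0$ with $g$ continuous. **Infinite contact.** If $\lambda_1,\dots,\lambda_n$ are the roots of $P(t)$, put $s_i=\sum_j\lambda_j^i$ and $\tilde\Delta_k(P(t))=\det(s_{i+j})_{0\le i,j<k}$. For $t\in I$ let $s$ be maximal such that the germ of $\tilde\Delta_s\circ P$ at $t$ is not $0$. $E^{(\infty)}(P)$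 is the set of $t\in I$ with $m_t(\tilde\Delta_s\circ P)=\infty$. **The trees.** To a germ at $0$ of a curve $P$ of degree $n$ with continuous coefficients we assign a finite rooted tree $T(P)=T(P,0)$, whose vertices carry a label $(d,q)\in\mathbb N\times\mathbb Q$ and correspond to polynomial germs. * If $P(0)$ has at least two distinct roots ("$P$ splits"), write $P=\prod_iP_i$ near $0$, where all roots of each $P_i(0)$ coincide and distinct $P_i(0)$ have distinct roots. The root of $T(P)$ has label $(n,0)$, and the subtrees at its successors are the $T(P_i)$. * If $n=1$, $T(P)$ is a single vertex with label $(1,0)$. * Otherwise replace $P(z)$ by $P(z+\frac1na_1)$, so that $a_1=0$ and all roots of $P(0)$ are $0$. Let $m=\min_{1\le k\le n}m_0(a_k)/k\in\mathbb Q\cup\{\infty\}$. * If $m=\infty$: the root has label $(n,0)$ and $n$ successors, which are leaves with label $(1,0)$. * If $m<\infty$ and $t^{-km}a_k(t)|_{t=0}=0$ for all $k$ with $m_0(a_k)=km$: only the root, with label $(n,0)$. * Otherwise let $m=r/N$ in lowest terms, $N>0$. If $N>1$: only the root, with label $(n,m)$. If $N=1$: the root has label $(n,r)$, and the subtrees at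 its successors are the trees $T(P_{(r),i})$ of the factors in the splitting $P_{(r)}=\prod_iP_{(r),i}$, where $P_{(r)}$ has the coefficients $t^{-kr}a_k(t)$; this polynomial splits. $T(P,t)$ is the tree of the germ at $0$ of $s\mapsto P(t+s)$. A tree is *admissible* if every leaf with $q=0$ has $d=1$; *good* if every leaf has label $(1,0)$; *bad* if it is admissible but not good. It is *fair* if it is admissible and, for every leaf $V$ with label $(d,q)\neq(1,0)$, with polynomial germ $P_V$ (normalized by $a_1=0$), and for both signs, the tree of $P_V^{\pm,N}(t):=P_V(\pm t^N)$, $N$ the denominator of $q$, is good and has height $1$. Good trees are fair. **The numbers.** For a vertex $V$ with label $(d,q)$ and successors $W$ put $\Gamma(V)=\lceil dq\rceil+\max_W\Gamma(W)$ and $$\gamma(V)=\lfloor q\rfloor+\begin{cases}\max_W\Gamma(W)-\max_W(\Gamma(W)-\gamma(W))&\text{if the subtree with root }V\text{ is good},\\ \min_W\gamma(W)&\text{otherwise,}\end{cases}$$ the terms over $W$ being omitted if $V$ is a leaf. Let $\Gamma_t(P),\gamma_t(P)$ be the values at the root of $T(P,t)$, and $$\Gamma(P)=\sup_{t\in I}\Gamma_t(P),\qquad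 \gamma(P)=\min\Big\{\inf_{T(P,t)\text{ good}}\big(\Gamma(P)-\Gamma_t(P)+\gamma_t(P)\big),\ \inf_{T(P,t)\text{ bad}}\gamma_t(P)\Big\}.$$ The number $\hat\Gamma_0(P)$ is defined as follows. If $P=\prod P_i$ splits, $\hat\Gamma_0(P)=\max_i\hat\Gamma_0(P_i)$; if $n=1$, it is $0$. Otherwise normalize $a_1=0$ and take $m$, and $m=r/N$ in lowest terms if $m<\infty$, as above. If $m=\infty$, $\hat\Gamma_0(P)=0$. If $m<\infty$ and $t^{-km}a_k(t)|_{t=0}\ne0$ for some $k$ with $m_0(a_k)=km$, then $\hat\Gamma_0(P)=nr+\hat\Gamma_0(P_{(r)})$ for $N=1$, and $\hat\Gamma_0(P)=\max_\pm\hat\Gamma_0(P^{\pm,N})$, with $P^{\pm,N}(t)=P(\pm t^N)$, for $N>1$. In the remaining (non-admissible) case $\hat\Gamma_0(P)=\lceil nm\rceil$. Let $\hat\Gamma_t(P)$ be $\hat\Gamma_0$ of $s\mapsto P(t+s)$, and $\hat\Gamma(P)=\sup_{t\in I}\hat\Gamma_t(P)$. **Theorem.** Let $p\in\mathbb N\cup\{\infty\}$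 and let $P(t)$, $t\in I$, be a $C^{p+\Gamma(P)}$-curve of polynomials with $E^{(\infty)}(P)=\emptyset$. Then: 1. If $T(P,t)$ is good for all $t\in I$, then $P$ is $C^{p+\gamma(P)}$-solvable. 2. If $T(P,t)$ is fair for all $t\in I$, then $P$ is $C^{\gamma(P)}$-solvable. 3. If $T(P,t)$ is bad for some $t\in I$ and $P$ is a $C^{1+\hat\Gamma(P)}$-curve, then $P$ is $C^{\gamma(P)}$-solvable. -/

import Mathlib

open Polynomial Filter Topology

noncomputable section

namespace RootCurve

/-! Curves of monic polynomials are functions `P : ℝ → ℂ[X]`; writing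
`P(t)(z) = zⁿ + ∑ (-1)^j a_j(t) z^(n-j)`, the function `a_j` is, up to the sign `(-1)^j`, the coefficient
of index `n - j`.  The sign plays no role in any of the notions below.  All constructions on germs are
made at the point `0 ∈ ℝ`; the germ at `t₀` is moved there by the translation `s ↦ P (t₀ + s)`. -/

/-- `P` restricted to `I` is a `C^q`-curve of monic polynomials of degree `n`. -/
def IsCurve (n : ℕ) (q : ℕ∞) (I : Set ℝ) (P : ℝ → ℂ[X]) : Prop :=
  (∀ t ∈ I, (P t).Monic ∧ (P t).natDegree = n) ∧
    ∀ k : ℕ, ContDiffOn ℝ (q : WithTop ℕ∞) (fun t => (P t).coeff k) I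

/-- `P` is `C^q`-solvable on `I`: its roots admit a `C^q`-parameterization. -/
def Solvable (n : ℕ) (q : ℕ∞) (I : Set ℝ) (P : ℝ → ℂ[X]) : Prop :=
  ∃ lam : Fin n → ℝ → ℂ,
    (∀ j, ContDiffOn ℝ (q : WithTop ℕ∞) (lam j) I) ∧
      ∀ t ∈ I, P t = ∏ j, (X - C (lam j t))

/-- `f(t) = t^k g(t)` near `0`, with `g` continuous near `0`. -/
def DivisibleBy (f : ℝ → ℂ) (k : ℕ) : Prop :=
  ∃ g : ℝ → ℂ, (∀ᶠ t in 𝓝 (0 : ℝ), ContinuousAt g t) ∧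
    ∀ᶠ t in 𝓝 (0 : ℝ), f t = (t : ℂ) ^ k * g t

/-- The multiplicity `m_0(f)` of (the germ at `0` of) a continuous function. -/
def mult (f : ℝ → ℂ) : ℕ∞ :=
  ⨆ (k : ℕ) (_ : DivisibleBy f k), (k : ℕ∞)

/-- The function `t ↦ t^{-k} f(t)`, extended to `t = 0` by its limit. -/
def divPow (f : ℝ → ℂ) (k : ℕ) : ℝ → ℂ :=
  Function.update (fun t => f t / (t : ℂ) ^ k) 0
    (limUnder (𝓝[≠] (0 : ℝ)) fun t => f t / (t : ℂ) ^ k)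

/-! ### Derived polynomials -/

/-- `P` splits at `0`, i.e. `P 0` has at least two distinct roots. -/
def Splits (P : ℝ → ℂ[X]) : Prop :=
  1 < (P 0).roots.toFinset.card

open scoped Classical in
/-- The factor of `P` belonging to the root `ρ` of `P 0`: the roots of `factor P ρ t` are those roots
of `P t` for which `ρ` is a closest root of `P 0`.  For `t` near `0` these are exactly the roots of
`P t` near `ρ`, so near `0` this is the factor provided by the splitting lemma
(`P = ∏ P_i`, the roots of each `P_i 0` coincide, distinct `P_i 0` have distinct roots). -/
def factor (P : ℝ → ℂ[X]) (ρ : ℂ) (t : ℝ) : ℂ[X] :=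
  (((P t).roots.filter fun z => ∀ σ ∈ (P 0).roots, dist z ρ ≤ dist z σ).map fun z => X - C z).prod

/-- `P̄(z) = P(z + a₁ / n)`, where `a₁ = - nextCoeff`; the roots of `P̄` have sum `0`. -/
def center (P : ℝ → ℂ[X]) (t : ℝ) : ℂ[X] :=
  (P t).comp (X - C ((P t).nextCoeff / ((P t).natDegree : ℂ)))

/-- `P_(r)`, for a curve `P` of degree `n`: the coefficient `a_k` is replaced by `t^{-kr} a_k`. -/
def divide (n r : ℕ) (P : ℝ → ℂ[X]) (t : ℝ) : ℂ[X] :=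
  X ^ n + ∑ i ∈ Finset.range n, C (divPow (fun s => (P s).coeff i) ((n - i) * r) t) * X ^ i

/-- `P^{±,N}(t) = P(± t^N)`, the sign being `ε = 1` or `ε = -1`. -/
def ramify (ε : ℝ) (N : ℕ) (P : ℝ → ℂ[X]) (t : ℝ) : ℂ[X] :=
  P (ε * t ^ N)

/-- `m(P,0) = min_k m_0(a_k) / k`, for a curve `P` of degree `n`. -/
def slope (n : ℕ) (P : ℝ → ℂ[X]) : WithTop ℚ :=
  (Finset.Icc 1 n).inf fun k =>
    WithTop.map (fun j : ℕ => (j : ℚ) / (k : ℚ)) (mult fun t => (P t).coeff (n - k))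

/-- There is a `k` with `m_0(a_k) = k m` for which `t^{-km} a_k(t)` does not vanish at `t = 0`. -/
def Strict (n : ℕ) (P : ℝ → ℂ[X]) (m : ℚ) : Prop :=
  ∃ k ∈ Finset.Icc 1 n, ∃ j : ℕ, (j : ℚ) = (k : ℚ) * m ∧
    (mult fun t => (P t).coeff (n - k)) = (j : ℕ∞) ∧
      divPow (fun t => (P t).coeff (n - k)) j 0 ≠ 0

/-! Degree bounds, which show that the recursions below terminate. -/

theorem natDegree_factor_lt {P : ℝ → ℂ[X]} (h : Splits P) (ρ : ℂ) :
    (factor P ρ 0).natDegree < (P 0).natDegree := by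
  classical
  obtain ⟨σ, hσ, hne⟩ := Finset.exists_mem_ne h ρ
  rw [Multiset.mem_toFinset] at hσ
  refine lt_of_lt_of_le ?_ (Polynomial.card_roots' (P 0))
  rw [factor, Polynomial.natDegree_multiset_prod_X_sub_C_eq_card]
  refine Multiset.card_lt_card (lt_of_le_of_ne (Multiset.filter_le _ _) fun heq => ?_)
  have h1 := Multiset.filter_eq_self.1 heq σ hσ σ hσ
  rw [dist_self] at h1
  exact hne (dist_le_zero.1 h1)

theorem natDegree_divide (n r : ℕ) (P : ℝ → ℂ[X]) (t : ℝ) : (divide n r P t).natDegree ≤ n := by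
  unfold divide
  refine (natDegree_add_le _ _).trans (max_le (natDegree_X_pow_le n) ?_)
  refine natDegree_sum_le_of_forall_le _ _ fun i hi => ?_
  exact (natDegree_C_mul_X_pow_le _ _).trans (Finset.mem_range.1 hi).le

theorem natDegree_factor_divide_lt {n r : ℕ} {P : ℝ → ℂ[X]} (h : Splits (divide n r P)) (ρ : ℂ) :
    (factor (divide n r P) ρ 0).natDegree < n :=
  (natDegree_factor_lt h ρ).trans_le (natDegree_divide n r P 0)

/-! ### Labeled rooted trees -/

/-- Finite rooted trees.  Each vertex carries its label `(d, q)`, the curve of polynomials it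
corresponds to, and the family (indexed by a finite type) of the subtrees at its successors. -/
inductive Tree : Type 1
  | node (d : ℕ) (q : ℚ) (P : ℝ → ℂ[X]) (ι : Type) [Fintype ι] (child : ι → Tree) : Tree

namespace Tree

/-- The tree consisting only of its root. -/
def leaf (d : ℕ) (q : ℚ) (P : ℝ → ℂ[X]) : Tree :=
  node d q P Empty Empty.elim

/-- Every leaf has label `(1, 0)`. -/
def Good : Tree → Prop
  | node d q _ ι child => (IsEmpty ι → d = 1 ∧ q = 0) ∧ ∀ i, Good (child i)

/-- Every leaf with label `(d, 0)` has `d = 1`. -/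
def Admissible : Tree → Prop
  | node d q _ ι child => (IsEmpty ι → q = 0 → d = 1) ∧ ∀ i, Admissible (child i)

/-- Admissible, but not good. -/
def Bad (T : Tree) : Prop :=
  T.Admissible ∧ ¬ T.Good

/-- The maximal number of edges in a path from the root to a vertex. -/
def height : Tree → ℕ
  | node _ _ _ _ child => Finset.univ.sup fun i => height (child i) + 1

/-- `Γ(V) = ⌈d(V) q(V)⌉ + max_W Γ(W)`, at the root `V`; the maximum over the successors `W` of `V` is
absent if `V` is a leaf. -/
def Gamma : Tree → ℕ
  | node d q _ _ child => ⌈(d : ℚ) * q⌉₊ + Finset.univ.sup fun i => Gamma (child i)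

open scoped Classical in
/-- At the root `V`, `γ(V) = ⌊q(V)⌋ + (max_W Γ(W) - max_W (Γ(W) - γ(W)))` if the tree with root `V` is
good, and `γ(V) = ⌊q(V)⌋ + min_W γ(W)` otherwise; `W` runs through the successors of `V`, and the second
summand is absent if `V` is a leaf (empty maxima and minima are `0` here).
As `γ(W) ≤ Γ(W)`, no subtraction is truncated. -/
def gamma : Tree → ℕ
  | node d q P ι child => ⌊q⌋₊ +
      if Good (node d q P ι child) then
        (Finset.univ.sup fun i => Gamma (child i)) -
          Finset.univ.sup fun i => Gamma (child i) - gamma (child i)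
      else ⨅ i, gamma (child i)

end Tree

/-! ### The tree of a curve of polynomials -/

open scoped Classical in
/-- The rooted tree `T(P,0)` of the germ at `0` of a curve of polynomials of degree `n`.

* If `P` splits, the root has label `(n, 0)`, and the subtrees at its successors are the trees of the
  factors of `P`.
* A polynomial of degree `1` gives a leaf with label `(1, 0)`.
* Otherwise `P` is replaced by `Q = P̄`; let `m = m(Q,0)`.
  If `m = ∞`, the root has label `(n, 0)` and `n` successors, which are leaves with label `(1, 0)`.
  If `m < ∞`, and `t^{-km} a_k` vanishes at `0` for all `k` with `m_0(a_k) = k m`, there is only the root,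
  with label `(n, 0)`.  Otherwise, if `m` is not an integer, there is only the root, with label `(n, m)`.
  Otherwise the root has label `(n, m)`, and the subtrees at its successors are the trees of the factors
  of `Q_(m)`.  (Then `Q_(m)` splits, so that the last alternative in the code does not occur.) -/
def germTree (P : ℝ → ℂ[X]) : Tree :=
  let n := (P 0).natDegree
  if _hs : Splits P then
    Tree.node n 0 P {ρ : ℂ // ρ ∈ (P 0).roots.toFinset} fun ρ => germTree (factor P ρ)
  else if n ≤ 1 then Tree.leaf n 0 P
  else
    let Q := center P
    if slope n Q = ⊤ then
      Tree.node n 0 Q (Fin n) fun _ => Tree.leaf 1 0 fun _ => X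
    else
      let m : ℚ := (slope n Q).untopD 0
      let R := divide n m.num.toNat Q
      if ¬ Strict n Q m then Tree.leaf n 0 Q
      else if m.den ≠ 1 then Tree.leaf n m Q
      else if _hR : Splits R then
        Tree.node n m Q {ρ : ℂ // ρ ∈ (R 0).roots.toFinset} fun ρ => germTree (factor R ρ)
      else Tree.leaf n m Q
termination_by (P 0).natDegree
decreasing_by
  · exact natDegree_factor_lt _hs _
  · exact natDegree_factor_divide_lt _hR _

open scoped Classical in
/-- `Γ̂_0(P)`, for the germ at `0` of a curve of polynomials of degree `n`.

* If `P` splits, it is the maximum of `Γ̂_0` over the factors of `P`.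
* It is `0` in degree `1`.  Otherwise `P` is replaced by `Q = P̄`; let `m = m(Q,0)`.
* It is `0` if `m = ∞`.
* If `m = r / N < ∞`, in lowest terms, and if `t^{-km} a_k` does not vanish at `0` for some `k` with
  `m_0(a_k) = k m`, then it is `n r + Γ̂_0(Q_(r))` if `N = 1`, and `Γ̂_0(Q^{±,N})` (the maximum over both
  signs) if `N > 1`.  In the latter case the polynomials `Q^{±,N}` do not split, their first coefficient
  is `0`, and `m(Q^{±,N},0) = r`, so that `Γ̂_0(Q^{±,N}) = n r + Γ̂_0((Q^{±,N})_(r))`.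
* If `m < ∞` but there is no such `k`, it is `⌈n m⌉`.  This does not occur if all trees
  encountered on the way are admissible. -/
def germGammaHat (P : ℝ → ℂ[X]) : ℕ :=
  let n := (P 0).natDegree
  if _hs : Splits P then
    (P 0).roots.toFinset.sup fun ρ => germGammaHat (factor P ρ)
  else if n ≤ 1 then 0
  else
    let Q := center P
    if slope n Q = ⊤ then 0
    else
      let m : ℚ := (slope n Q).untopD 0
      let r := m.num.toNat
      if ¬ Strict n Q m then ⌈(n : ℚ) * m⌉₊
      else if m.den = 1 then
        n * r + if _h : Splits (divide n r Q) then
          (divide n r Q 0).roots.toFinset.sup fun ρ => germGammaHat (factor (divide n r Q) ρ) else 0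
      else
        max
          (n * r + if _h : Splits (divide n r (ramify 1 m.den Q)) then
            (divide n r (ramify 1 m.den Q) 0).roots.toFinset.sup fun ρ =>
              germGammaHat (factor (divide n r (ramify 1 m.den Q)) ρ) else 0)
          (n * r + if _h : Splits (divide n r (ramify (-1) m.den Q)) then
            (divide n r (ramify (-1) m.den Q) 0).roots.toFinset.sup fun ρ =>
              germGammaHat (factor (divide n r (ramify (-1) m.den Q)) ρ) else 0)
termination_by (P 0).natDegree
decreasing_by
  · exact natDegree_factor_lt _hs _
  · exact natDegree_factor_divide_lt _h _
  · exact natDegree_factor_divide_lt _h _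
  · exact natDegree_factor_divide_lt _h _

namespace Tree

/-- For each leaf `V` with label `(d, q) ≠ (1, 0)` of the tree and for both signs, the tree of
`P_V^{±,N}`, where `N` is the denominator of `q`, is good and has height `1`. -/
def BadLeavesFair : Tree → Prop
  | node d q P ι child =>
      (IsEmpty ι → ¬ (d = 1 ∧ q = 0) → ∀ ε : ℝ, ε = 1 ∨ ε = -1 →
        (germTree (ramify ε q.den P)).Good ∧ (germTree (ramify ε q.den P)).height = 1) ∧
      ∀ i, BadLeavesFair (child i)

/-- Fair trees: admissible trees all of whose bad leaves are as above (in particular, good trees). -/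
def Fair (T : Tree) : Prop :=
  T.Admissible ∧ T.BadLeavesFair

end Tree

/-- The tree `T(P,t)`. -/
def treeAt (P : ℝ → ℂ[X]) (t : ℝ) : Tree :=
  germTree fun s => P (t + s)

/-- `Γ(P) = sup_t Γ_t(P)`. -/
def Gamma (I : Set ℝ) (P : ℝ → ℂ[X]) : ℕ∞ :=
  ⨆ t ∈ I, ((treeAt P t).Gamma : ℕ∞)

/-- `Γ̂(P) = sup_t Γ̂_t(P)`. -/
def GammaHat (I : Set ℝ) (P : ℝ → ℂ[X]) : ℕ∞ :=
  ⨆ t ∈ I, (germGammaHat (fun s => P (t + s)) : ℕ∞)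

/-- `γ(P)` is the minimum of `inf (Γ(P) - Γ_t(P) + γ_t(P))` over all `t` with `T(P,t)` good, and of
`inf γ_t(P)` over all `t` with `T(P,t)` bad. -/
def gamma (I : Set ℝ) (P : ℝ → ℂ[X]) : ℕ∞ :=
  min
    (⨅ t ∈ {t ∈ I | (treeAt P t).Good}, (Gamma I P - (treeAt P t).Gamma + (treeAt P t).gamma))
    (⨅ t ∈ {t ∈ I | (treeAt P t).Bad}, ((treeAt P t).gamma : ℕ∞))

/-! ### Infinite order of contact -/

/-- `Δ_k` at the roots of a polynomial: the leading principal `k × k`-minor of the Bezoutiant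
`(s_{i+j})_{0 ≤ i, j < n}`, where `s_i` is the `i`-th power sum of the roots. -/
def bezoutMinor (k : ℕ) (p : ℂ[X]) : ℂ :=
  (Matrix.of fun i j : Fin k => (p.roots.map fun z => z ^ ((i : ℕ) + (j : ℕ))).sum).det

/-- `E^{(∞)}(P)`: the `t ∈ I` such that, for the maximal `s` for which the germ at `t` of `Δ_s ∘ P` is
not zero, this germ has infinite multiplicity. -/
def infiniteContact (I : Set ℝ) (P : ℝ → ℂ[X]) : Set ℝ :=
  {t ∈ I | ∃ s : ℕ, IsGreatest {k : ℕ | ¬ ∀ᶠ x in 𝓝 t, bezoutMinor k (P x) = 0} s ∧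
    mult (fun x => bezoutMinor s (P (t + x))) = ⊤}

end RootCurve

end

/-!
The roots of a curve of polynomials are found by following the tree: at a point that splits, the problem
is divided among the factors; otherwise the polynomial is centered, and its coefficients `a_k` are
divided by `t^{kr}`, where `r` is the slope.  What has to be controlled is the loss of differentiability.

The bookkeeping uses the germs `f` that are continuous and for which `t^e f` is `C^D` (`WGerm D e`, with
weight `e ≤ D`).  Equivalently, `f` is `C^(D-e)`, and `e` Euler derivatives `t d/dt` of `f^(D-e)` exist and
are continuous (`WReg.iff_eulerReg_sub`); this makes it evident that the class is closed under products,
analytic functions and `t ↦ ± t^N`.  Dividing the coefficients by `t^{kr}` raises their weight by at most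
`n r` (`HasSlope.coefReg_divide`), multiplying the roots by `t^r` lowers their weight by `r`
(`RootsIn.of_divide`), and the factors of a germ that splits depend analytically on it
(`exists_near_eq`).  Adding up, one obtains roots of weight `Γ - γ` if the tree is good
(`rootsIn_of_good`), and of weight `D - γ` otherwise (`rootsIn_of_fair`), that is, of class `C^γ`.  In the
latter case a leaf with fractional slope `m = r / N` has roots `|t|^m μ(|t|^{1/N})`, where `μ` is a root of
the ramified polynomial; this has weight `D - ⌊m⌋` if `μ` has weight `D` (`Newton.rootsIn`), which holds
if the roots `μ` are simple, that is, if the leaf is fair, and also if more than `Γ̂` derivatives are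
available (`rootsIn_of_gammaHat`).  The additional derivative moreover excludes inadmissible
trees (`admissible_of_gammaHat`).

At a vertex of infinite slope all roots must coincide.  This is where the absence of infinite contact
enters: it implies that distinct roots are at least `|t|^K` apart for some `K` (`Sep`), a property which is
clearly inherited by the factors.  To prove it, one counts the roots that stay apart.
If on both sides of the point exactly `ν` roots stay `|t|^K` apart, then `Δ_k` vanishes to infinite order
for all `k > ν`, so that the maximal `s` for which the germ of `Δ_s` is not zero is at most `ν`; as there
are at most `s` distinct roots near the point, these are the `ν` separated ones (`sep_of_counts`).  For
fair trees the count `ν` can be read off from the tree (`counts_of_fair`).  If more than `Γ̂` derivatives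
are available, a problem is that the two sides of the point are treated separately after ramification.
There the germ is approximated by its Taylor polynomial, which is a family over a complex disc; the count
on one side is a lower bound for the count along every line in this disc, in particular for the count
on the other side (`twin_of_close`, `counts_of_close`).

Local parameterizations of the roots differ by permutations near every point where the number of distinct
roots is locally constant; glued at such points, they yield a parameterization on the interval
(`solvable_of_local`).
-/

noncomputable section

namespace RootCurve

/-! ### Division by powers of the variable -/

section weighted

variable {E F G : Type} [NormedAddCommGroup E] [NormedSpace ℝ E]
  [NormedAddCommGroup F] [NormedSpace ℝ F] [NormedAddCommGroup G] [NormedSpace ℝ G]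

/-- The moments `∫₀¹ s^j φ(t s) ds` of a `C¹` function are differentiated under the integral. -/
theorem hasDerivAt_moment {δ : ℝ} {φ : ℝ → E}
    (hφ : ContDiffOn ℝ 1 φ (Set.Ioo (-δ) δ)) (j : ℕ) {t : ℝ} (ht : t ∈ Set.Ioo (-δ) δ) :
    HasDerivAt (fun t => ∫ s in (0 : ℝ)..1, s ^ j • φ (t * s))
      (∫ s in (0 : ℝ)..1, s ^ (j + 1) • deriv φ (t * s)) t := by
  obtain ⟨ρ, hρ1, hρ2⟩ := exists_between (abs_lt.2 ht)
  have hmem : ∀ {x s : ℝ}, |x| ≤ ρ → s ∈ Set.Icc (0 : ℝ) 1 → x * s ∈ Set.Icc (-ρ) ρ := by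
    intro x s hx hs
    refine abs_le.1 ?_
    rw [abs_mul, abs_of_nonneg hs.1]
    nlinarith [hs.1, hs.2, abs_nonneg x]
  have hsub : Set.Icc (-ρ) ρ ⊆ Set.Ioo (-δ) δ := fun x hx => ⟨by linarith [hx.1], by linarith [hx.2]⟩
  have hd := (contDiffOn_succ_iff_deriv_of_isOpen (n := 0) isOpen_Ioo).1 (by simpa using hφ)
  have hcd : ContinuousOn (deriv φ) (Set.Ioo (-δ) δ) := hd.2.2.continuousOn
  have hcφ : ContinuousOn φ (Set.Ioo (-δ) δ) := hφ.continuousOn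
  obtain ⟨M, hM⟩ := isCompact_Icc.exists_bound_of_continuousOn (hcd.mono hsub)
  have hcont : ∀ {ψ : ℝ → E} (hψ : ContinuousOn ψ (Set.Ioo (-δ) δ)) (k : ℕ) {x : ℝ}, |x| ≤ ρ →
      ContinuousOn (fun s => s ^ k • ψ (x * s)) (Set.Icc 0 1) := by
    intro ψ hψ k x hx
    refine (continuous_pow k).continuousOn.smul ?_
    exact hψ.comp (by fun_prop) fun s hs => hsub (hmem hx hs)
  have hnhds : Set.Ioo (-ρ) ρ ∈ 𝓝 t := isOpen_Ioo.mem_nhds (abs_lt.1 hρ1)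
  have huI : Set.uIoc (0 : ℝ) 1 ⊆ Set.Icc 0 1 := by
    rw [Set.uIoc_of_le zero_le_one]; exact Set.Ioc_subset_Icc_self
  refine (intervalIntegral.hasDerivAt_integral_of_dominated_loc_of_deriv_le
    (F := fun t s => s ^ j • φ (t * s)) (F' := fun t s => s ^ (j + 1) • deriv φ (t * s))
    (bound := fun _ => M) hnhds ?_ ?_ ?_ ?_ ?_ ?_).2
  · filter_upwards [hnhds] with x hx
    exact ((hcont hcφ j (abs_lt.2 hx).le).mono huI).aestronglyMeasurable measurableSet_uIoc
  · apply ContinuousOn.intervalIntegrable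
    rw [Set.uIcc_of_le zero_le_one]
    exact hcont hcφ j hρ1.le
  · exact ((hcont hcd (j + 1) hρ1.le).mono huI).aestronglyMeasurable measurableSet_uIoc
  · refine Eventually.of_forall fun s hs x hx => ?_
    have hs' := huI hs
    have h1 := hM _ (hmem (abs_lt.2 hx).le hs')
    rw [norm_smul, norm_pow, Real.norm_of_nonneg hs'.1]
    calc s ^ (j + 1) * ‖deriv φ (x * s)‖ ≤ 1 * ‖deriv φ (x * s)‖ := by
          gcongr; exact pow_le_one₀ hs'.1 hs'.2
      _ ≤ M := by simpa using h1
  · exact intervalIntegrable_const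
  · refine Eventually.of_forall fun s hs x hx => ?_
    have hs' := huI hs
    have hx' : x * s ∈ Set.Ioo (-δ) δ := hsub (hmem (abs_lt.2 hx).le hs')
    have h1 : HasDerivAt φ (deriv φ (x * s)) (x * s) :=
      ((hd.1 _ hx').differentiableAt (isOpen_Ioo.mem_nhds hx')).hasDerivAt
    have h2 : HasDerivAt (fun x : ℝ => x * s) s x := by simpa using (hasDerivAt_id x).mul_const s
    have h3 := (h1.scomp x h2).const_smul (s ^ j)
    convert! h3 using 1
    rw [pow_succ, smul_smul]

theorem continuousAt_moment {δ : ℝ} {φ : ℝ → E}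
    (hφ : ContinuousOn φ (Set.Ioo (-δ) δ)) (j : ℕ) {t : ℝ} (ht : t ∈ Set.Ioo (-δ) δ) :
    ContinuousAt (fun t => ∫ s in (0 : ℝ)..1, s ^ j • φ (t * s)) t := by
  obtain ⟨ρ, hρ1, hρ2⟩ := exists_between (abs_lt.2 ht)
  have hmem : ∀ {x s : ℝ}, |x| ≤ ρ → s ∈ Set.Icc (0 : ℝ) 1 → x * s ∈ Set.Icc (-ρ) ρ := by
    intro x s hx hs
    refine abs_le.1 ?_
    rw [abs_mul, abs_of_nonneg hs.1]
    nlinarith [hs.1, hs.2, abs_nonneg x]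
  have hsub : Set.Icc (-ρ) ρ ⊆ Set.Ioo (-δ) δ := fun x hx => ⟨by linarith [hx.1], by linarith [hx.2]⟩
  obtain ⟨M, hM⟩ := isCompact_Icc.exists_bound_of_continuousOn (hφ.mono hsub)
  have hnhds : Set.Ioo (-ρ) ρ ∈ 𝓝 t := isOpen_Ioo.mem_nhds (abs_lt.1 hρ1)
  have huI : Set.uIoc (0 : ℝ) 1 ⊆ Set.Icc 0 1 := by
    rw [Set.uIoc_of_le zero_le_one]; exact Set.Ioc_subset_Icc_self
  refine intervalIntegral.continuousAt_of_dominated_interval (bound := fun _ => M) ?_ ?_ ?_ ?_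
  · filter_upwards [hnhds] with x hx
    refine ContinuousOn.aestronglyMeasurable ?_ measurableSet_uIoc
    refine ((continuous_pow j).continuousOn.smul ?_)
    exact hφ.comp (by fun_prop) fun s hs => hsub (hmem (abs_lt.2 hx).le (huI hs))
  · filter_upwards [hnhds] with x hx
    refine Eventually.of_forall fun s hs => ?_
    have hs' := huI hs
    have h1 := hM _ (hmem (abs_lt.2 hx).le hs')
    rw [norm_smul, norm_pow, Real.norm_of_nonneg hs'.1]
    calc s ^ j * ‖φ (x * s)‖ ≤ 1 * ‖φ (x * s)‖ := by
          gcongr; exact pow_le_one₀ hs'.1 hs'.2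
      _ ≤ M := by simpa using h1
  · exact intervalIntegrable_const
  · refine Eventually.of_forall fun s hs => ?_
    have hx' : t * s ∈ Set.Ioo (-δ) δ := hsub (hmem hρ1.le (huI hs))
    refine ContinuousAt.const_smul ?_ _
    exact ContinuousAt.comp (f := fun x : ℝ => x * s) (hφ.continuousAt (isOpen_Ioo.mem_nhds hx'))
      (by fun_prop)

theorem contDiffOn_moment {δ : ℝ} (k : ℕ) : ∀ {φ : ℝ → E},
    ContDiffOn ℝ k φ (Set.Ioo (-δ) δ) → ∀ j : ℕ,
    ContDiffOn ℝ k (fun t => ∫ s in (0 : ℝ)..1, s ^ j • φ (t * s)) (Set.Ioo (-δ) δ) := by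
  induction k with
  | zero =>
    intro φ hφ j
    rw [Nat.cast_zero, contDiffOn_zero] at hφ ⊢
    exact fun t ht => (continuousAt_moment hφ j ht).continuousWithinAt
  | succ k ih =>
    intro φ hφ j
    have h1 : ContDiffOn ℝ 1 φ (Set.Ioo (-δ) δ) := hφ.of_le (by norm_cast; omega)
    have hd : ∀ t ∈ Set.Ioo (-δ) δ, _ := fun t ht => hasDerivAt_moment h1 j ht
    push_cast at hφ ⊢
    rw [contDiffOn_succ_iff_deriv_of_isOpen isOpen_Ioo] at hφ ⊢
    refine ⟨fun t ht => (hd t ht).differentiableAt.differentiableWithinAt, by simp, ?_⟩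
    exact (ih hφ.2.2 (j + 1)).congr fun t ht => (hd t ht).deriv

/-- Hadamard's lemma with finite differentiability: division by `t` costs one derivative. -/
theorem contDiffOn_of_smul [CompleteSpace E] {δ : ℝ} {k : ℕ} {h : ℝ → E}
    (hc : ContinuousOn h (Set.Ioo (-δ) δ))
    (hs : ContDiffOn ℝ (k + 1 : ℕ) (fun t => t • h t) (Set.Ioo (-δ) δ)) :
    ContDiffOn ℝ k h (Set.Ioo (-δ) δ) := by
  have hs' := hs
  push_cast at hs'
  rw [contDiffOn_succ_iff_deriv_of_isOpen isOpen_Ioo] at hs'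
  refine (contDiffOn_moment k hs'.2.2 0).congr fun t ht => ?_
  have h0 : (0 : ℝ) ∈ Set.Ioo (-δ) δ := ⟨by linarith [ht.1, ht.2], by linarith [ht.1, ht.2]⟩
  set g : ℝ → E := fun t => t • h t
  -- `g(t) = ∫₀¹ t g'(t s) ds`, as `g(0) = 0`
  have key : ∀ t ∈ Set.Ioo (-δ) δ, t • (∫ s in (0 : ℝ)..1, s ^ 0 • deriv g (t * s)) = t • h t := by
    intro t ht
    have hsub : Set.uIcc 0 t ⊆ Set.Ioo (-δ) δ := Set.OrdConnected.uIcc_subset inferInstance h0 ht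
    have := intervalIntegral.integral_eq_sub_of_hasDerivAt (f := g) (f' := deriv g) (a := 0) (b := t)
      (fun x hx => ((hs'.1 x (hsub hx)).differentiableAt (isOpen_Ioo.mem_nhds (hsub hx))).hasDerivAt)
      ((hs'.2.2.continuousOn.mono hsub).intervalIntegrable)
    simp only [pow_zero, one_smul]
    rw [intervalIntegral.smul_integral_comp_mul_left]
    simp [this, g]
  by_cases h : t = 0
  · -- at the origin the two continuous functions agree because they agree elsewhere
    subst h
    have hm : ContinuousAt (fun t => ∫ s in (0 : ℝ)..1, s ^ 0 • deriv g (t * s)) 0 :=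
      continuousAt_moment hs'.2.2.continuousOn 0 h0
    have hh : ContinuousAt h 0 := hc.continuousAt (isOpen_Ioo.mem_nhds h0)
    refine tendsto_nhds_unique (hh.tendsto.mono_left nhdsWithin_le_nhds)
      ((hm.tendsto.mono_left (nhdsWithin_le_nhds (s := {0}ᶜ))).congr' ?_)
    filter_upwards [self_mem_nhdsWithin, nhdsWithin_le_nhds (isOpen_Ioo.mem_nhds h0)] with x hx hx'
    exact smul_right_injective E (r := x) hx (key x hx')
  · exact smul_right_injective E h (key t ht).symm

theorem contDiffOn_of_pow_smul [CompleteSpace E] {δ : ℝ} {k : ℕ} {h : ℝ → E}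
    (hc : ContinuousOn h (Set.Ioo (-δ) δ)) (j : ℕ)
    (hs : ContDiffOn ℝ (k + j : ℕ) (fun t => t ^ j • h t) (Set.Ioo (-δ) δ)) :
    ContDiffOn ℝ k h (Set.Ioo (-δ) δ) := by
  induction j with
  | zero => simpa using hs
  | succ j ih =>
    refine ih (contDiffOn_of_smul ((continuous_pow j).continuousOn.smul hc) ?_)
    refine hs.congr fun t _ => ?_
    rw [smul_smul, pow_succ']

/-! ### Weighted regularity -/

/-- `EulerReg δ q m f`: on `(-δ, δ)` the function `f` is `C^q`, and the functions `(t d/dt)^j f^{(q)}`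
exist off `0` and extend continuously to `0` for all `j ≤ m`.  The value of `t • deriv f t` at `t = 0` is
`0` in any case; for a continuous `f` this is the only possible limit. -/
def EulerReg (δ : ℝ) : ℕ → ℕ → (ℝ → E) → Prop
  | 0, 0, f => ContinuousOn f (Set.Ioo (-δ) δ)
  | 0, m + 1, f => ContinuousOn f (Set.Ioo (-δ) δ) ∧
      (∀ t ∈ Set.Ioo (-δ) δ, t ≠ 0 → DifferentiableAt ℝ f t) ∧
        EulerReg δ 0 m fun t => t • deriv f t
  | q + 1, m, f => (∀ t ∈ Set.Ioo (-δ) δ, DifferentiableAt ℝ f t) ∧ EulerReg δ q m (deriv f)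

theorem eventuallyEq_of_eqOn_Ioo {X : Type} {f g : ℝ → X} {δ : ℝ}
    (h : Set.EqOn f g (Set.Ioo (-δ) δ)) {t : ℝ} (ht : t ∈ Set.Ioo (-δ) δ) : f =ᶠ[𝓝 t] g := by
  filter_upwards [isOpen_Ioo.mem_nhds ht] with x hx using h hx

namespace EulerReg

variable {δ : ℝ} {q m : ℕ} {f g : ℝ → E}

theorem zero_zero : EulerReg δ 0 0 f ↔ ContinuousOn f (Set.Ioo (-δ) δ) := by rw [EulerReg]

theorem zero_succ : EulerReg δ 0 (m + 1) f ↔ ContinuousOn f (Set.Ioo (-δ) δ) ∧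
      (∀ t ∈ Set.Ioo (-δ) δ, t ≠ 0 → DifferentiableAt ℝ f t) ∧
        EulerReg δ 0 m fun t => t • deriv f t := by rw [EulerReg]

theorem succ_iff : EulerReg δ (q + 1) m f ↔
    (∀ t ∈ Set.Ioo (-δ) δ, DifferentiableAt ℝ f t) ∧ EulerReg δ q m (deriv f) := by
  cases m <;> rw [EulerReg]

theorem congr (hf : EulerReg δ q m f) (h : Set.EqOn g f (Set.Ioo (-δ) δ)) : EulerReg δ q m g := by
  induction q generalizing f g with
  | zero =>
    induction m generalizing f g with
    | zero =>
      rw [zero_zero] at hf ⊢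
      exact hf.congr h
    | succ m ih =>
      rw [zero_succ] at hf ⊢
      refine ⟨hf.1.congr h, fun t ht h0 =>
        (hf.2.1 t ht h0).congr_of_eventuallyEq (eventuallyEq_of_eqOn_Ioo h ht), ih hf.2.2 fun t ht => ?_⟩
      simp only [(eventuallyEq_of_eqOn_Ioo h ht).deriv_eq]
  | succ q ih =>
    rw [succ_iff] at hf ⊢
    exact ⟨fun t ht => (hf.1 t ht).congr_of_eventuallyEq (eventuallyEq_of_eqOn_Ioo h ht),
      ih hf.2 fun t ht => (eventuallyEq_of_eqOn_Ioo h ht).deriv_eq⟩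

theorem of_succ_right (hf : EulerReg δ q (m + 1) f) : EulerReg δ q m f := by
  induction q generalizing f with
  | zero =>
    induction m generalizing f with
    | zero => exact zero_zero.2 (zero_succ.1 hf).1
    | succ m ih =>
      rw [zero_succ] at hf ⊢
      exact ⟨hf.1, hf.2.1, ih hf.2.2⟩
  | succ q ih =>
    rw [succ_iff] at hf ⊢
    exact ⟨hf.1, ih hf.2⟩

theorem continuousOn (hf : EulerReg δ q m f) : ContinuousOn f (Set.Ioo (-δ) δ) := by
  cases q with
  | zero =>
    cases m with
    | zero => exact zero_zero.1 hf
    | succ m => exact (zero_succ.1 hf).1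
  | succ q => exact fun t ht => ((succ_iff.1 hf).1 t ht).continuousAt.continuousWithinAt

theorem add (hf : EulerReg δ q m f) (hg : EulerReg δ q m g) :
    EulerReg δ q m fun t => f t + g t := by
  induction q generalizing f g with
  | zero =>
    induction m generalizing f g with
    | zero =>
      rw [zero_zero] at hf hg ⊢
      exact hf.add hg
    | succ m ih =>
      rw [zero_succ] at hf hg ⊢
      refine ⟨hf.1.add hg.1, fun t ht h0 => (hf.2.1 t ht h0).add (hg.2.1 t ht h0),
        (ih hf.2.2 hg.2.2).congr fun t ht => ?_⟩
      by_cases h0 : t = 0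
      · simp [h0]
      · simp only [← smul_add]
        rw [← deriv_add (hf.2.1 t ht h0) (hg.2.1 t ht h0)]
        rfl
  | succ q ih =>
    rw [succ_iff] at hf hg ⊢
    exact ⟨fun t ht => (hf.1 t ht).add (hg.1 t ht), (ih hf.2 hg.2).congr
      fun t ht => deriv_add (hf.1 t ht) (hg.1 t ht)⟩

theorem zero_smul_id (hf : EulerReg δ 0 m f) : EulerReg δ 0 m fun t => t • f t := by
  induction m generalizing f with
  | zero =>
    rw [zero_zero] at hf ⊢
    exact continuousOn_id.smul hf
  | succ m ih =>
    have hf' := zero_succ.1 hf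
    refine zero_succ.2 ⟨continuousOn_id.smul hf'.1,
      fun t ht h0 => differentiableAt_id.smul (hf'.2.1 t ht h0),
      ((ih hf.of_succ_right).add (ih hf'.2.2)).congr fun t ht => ?_⟩
    by_cases h0 : t = 0
    · simp [h0]
    · have h1 := ((hasDerivAt_id t).smul (hf'.2.1 t ht h0).hasDerivAt).deriv
      simp only [id, one_smul] at h1
      have h2 : deriv (fun t => t • f t) t = t • deriv f t + f t := h1
      simp only [h2, smul_add]
      abel

theorem of_succ_left (hf : EulerReg δ (q + 1) m f) : EulerReg δ q m f := by
  induction q generalizing f with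
  | zero =>
    have hf' := succ_iff.1 hf
    cases m with
    | zero => exact zero_zero.2 hf.continuousOn
    | succ m =>
      exact zero_succ.2 ⟨hf.continuousOn, fun t ht _ => hf'.1 t ht,
        zero_smul_id hf'.2.of_succ_right⟩
  | succ q ih =>
    rw [succ_iff] at hf ⊢
    exact ⟨hf.1, ih hf.2⟩

theorem bilin (B : E →L[ℝ] F →L[ℝ] G) {g : ℝ → F} (hf : EulerReg δ q m f)
    (hg : EulerReg δ q m g) : EulerReg δ q m fun t => B (f t) (g t) := by
  induction q generalizing f g with
  | zero =>
    induction m generalizing f g with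
    | zero =>
      rw [zero_zero] at hf hg ⊢
      exact (B.continuous.comp_continuousOn hf).clm_apply hg
    | succ m ih =>
      have hf' := zero_succ.1 hf
      have hg' := zero_succ.1 hg
      have hd : ∀ t ∈ Set.Ioo (-δ) δ, t ≠ 0 → HasDerivAt (fun t => B (f t) (g t))
          (B (f t) (deriv g t) + B (deriv f t) (g t)) t := fun t ht h0 =>
        B.hasDerivAt_of_bilinear
          (fun _ => (hf'.2.1 t ht h0).hasDerivAt) (fun _ => (hg'.2.1 t ht h0).hasDerivAt)
      refine zero_succ.2 ⟨(B.continuous.comp_continuousOn hf'.1).clm_apply hg'.1,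
        fun t ht h0 => (hd t ht h0).differentiableAt,
        ((ih hf.of_succ_right hg'.2.2).add (ih hf'.2.2 hg.of_succ_right)).congr fun t ht => ?_⟩
      by_cases h0 : t = 0
      · simp [h0]
      · simp only [(hd t ht h0).deriv, map_smul, smul_add, smul_apply]
  | succ q ih =>
    have hf' := succ_iff.1 hf
    have hg' := succ_iff.1 hg
    have hd : ∀ t ∈ Set.Ioo (-δ) δ, HasDerivAt (fun t => B (f t) (g t))
        (B (f t) (deriv g t) + B (deriv f t) (g t)) t := fun t ht =>
      B.hasDerivAt_of_bilinear (fun _ => (hf'.1 t ht).hasDerivAt) fun _ => (hg'.1 t ht).hasDerivAt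
    exact succ_iff.2 ⟨fun t ht => (hd t ht).differentiableAt,
      ((ih hf.of_succ_left hg'.2).add (ih hf'.2 hg.of_succ_left)).congr fun t ht => (hd t ht).deriv⟩

theorem comp_smooth {Ω : Set E} (hΩ : IsOpen Ω) {Φ : E → F} (hΦ : ContDiffOn ℝ (⊤ : ℕ∞) Φ Ω)
    (hf : EulerReg δ q m f) (hm : Set.MapsTo f (Set.Ioo (-δ) δ) Ω) :
    EulerReg δ q m fun t => Φ (f t) := by
  induction q generalizing m f F with
  | zero =>
    induction m generalizing f F with
    | zero =>
      rw [zero_zero] at hf ⊢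
      exact hΦ.continuousOn.comp hf hm
    | succ m ih =>
      have hf' := zero_succ.1 hf
      have hd : ∀ t ∈ Set.Ioo (-δ) δ, t ≠ 0 → HasDerivAt (fun t => Φ (f t))
          (fderiv ℝ Φ (f t) (deriv f t)) t := fun t ht h0 =>
        ((hΦ.differentiableOn (by simp) _ (hm ht)).differentiableAt
          (hΩ.mem_nhds (hm ht))).hasFDerivAt.comp_hasDerivAt t (hf'.2.1 t ht h0).hasDerivAt
      have hΦ' : ContDiffOn ℝ (⊤ : ℕ∞) (fderiv ℝ Φ) Ω := hΦ.fderiv_of_isOpen hΩ (by simp)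
      refine zero_succ.2 ⟨hΦ.continuousOn.comp hf'.1 hm,
        fun t ht h0 => (hd t ht h0).differentiableAt,
        (bilin (ContinuousLinearMap.id ℝ (E →L[ℝ] F)) (ih hΦ' hf.of_succ_right hm) hf'.2.2).congr
          fun t ht => ?_⟩
      by_cases h0 : t = 0
      · simp [h0]
      · simp [(hd t ht h0).deriv]
  | succ q ih =>
    have hf' := succ_iff.1 hf
    have hd : ∀ t ∈ Set.Ioo (-δ) δ, HasDerivAt (fun t => Φ (f t))
        (fderiv ℝ Φ (f t) (deriv f t)) t := fun t ht =>
      ((hΦ.differentiableOn (by simp) _ (hm ht)).differentiableAt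
        (hΩ.mem_nhds (hm ht))).hasFDerivAt.comp_hasDerivAt t (hf'.1 t ht).hasDerivAt
    have hΦ' : ContDiffOn ℝ (⊤ : ℕ∞) (fderiv ℝ Φ) Ω := hΦ.fderiv_of_isOpen hΩ (by simp)
    refine succ_iff.2 ⟨fun t ht => (hd t ht).differentiableAt,
      (bilin (ContinuousLinearMap.id ℝ (E →L[ℝ] F)) (ih hΦ' hf.of_succ_left hm) hf'.2).congr
        fun t ht => ?_⟩
    simp [(hd t ht).deriv]

end EulerReg

/-- `WReg δ D e f`: on `(-δ, δ)` the function `f` is continuous, and `t ↦ t^e f(t)` is `C^D`.  This is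
meaningful for `e ≤ D`. -/
def WReg (δ : ℝ) (D : ℕ∞) (e : ℕ) (f : ℝ → E) : Prop :=
  ContinuousOn f (Set.Ioo (-δ) δ) ∧
    ContDiffOn ℝ (D : WithTop ℕ∞) (fun t => t ^ e • f t) (Set.Ioo (-δ) δ)

theorem contDiffOn_succ_Ioo {δ : ℝ} {k : ℕ} {f : ℝ → E} :
    ContDiffOn ℝ (k + 1 : ℕ) f (Set.Ioo (-δ) δ) ↔
      (∀ t ∈ Set.Ioo (-δ) δ, DifferentiableAt ℝ f t) ∧ ContDiffOn ℝ k (deriv f) (Set.Ioo (-δ) δ) := by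
  push_cast
  rw [contDiffOn_succ_iff_deriv_of_isOpen isOpen_Ioo]
  simp only [WithTop.natCast_ne_top, IsEmpty.forall_iff, true_and]
  refine and_congr_left' ⟨fun h t ht => (h t ht).differentiableAt (isOpen_Ioo.mem_nhds ht),
    fun h t ht => (h t ht).differentiableWithinAt⟩

theorem hasDerivAt_pow_smul {f : ℝ → E} {t : ℝ} (j : ℕ) (hf : DifferentiableAt ℝ f t) :
    HasDerivAt (fun t => t ^ (j + 1) • f t)
      ((j + 1 : ℝ) • t ^ j • f t + t ^ (j + 1) • deriv f t) t := by
  have := (hasDerivAt_pow (j + 1) t).smul hf.hasDerivAt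
  convert! this using 1
  rw [add_comm, smul_smul]
  simp

/-- Off the origin, `t^(j+1) f` is differentiable as soon as `f` is; at the origin continuity of `f`
suffices. -/
theorem hasDerivAt_pow_smul_zero {f : ℝ → E} (j : ℕ) (hf : ContinuousAt f 0) :
    HasDerivAt (fun t => t ^ (j + 1) • f t) ((0 : ℝ) ^ j • f 0) 0 := by
  rw [hasDerivAt_iff_tendsto_slope]
  have h1 : Tendsto (fun t : ℝ => t ^ j • f t) (𝓝[≠] 0) (𝓝 ((0 : ℝ) ^ j • f 0)) :=
    (((continuous_pow j).continuousAt).smul hf).tendsto.mono_left nhdsWithin_le_nhds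
  refine h1.congr' ?_
  filter_upwards [self_mem_nhdsWithin] with t ht
  have ht' : t ≠ 0 := ht
  rw [slope_def_module]
  simp only [sub_zero, ne_eq, Nat.add_eq_zero_iff, one_ne_zero, and_false, not_false_eq_true,
    zero_pow, zero_smul, smul_smul]
  congr 1
  field_simp
  rw [pow_succ]

/-- One half of the equivalence between `EulerReg` and `WReg`; the leading terms of the derivatives of
`t^m f` are Euler derivatives of `f`. -/
theorem EulerReg.contDiffOn_pow_smul {δ : ℝ} {q m : ℕ} {f : ℝ → E} (hf : EulerReg δ q m f) :
    ContDiffOn ℝ (q + m : ℕ) (fun t => t ^ m • f t) (Set.Ioo (-δ) δ) := by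
  induction q generalizing m f with
  | zero =>
    induction m generalizing f with
    | zero => simpa using hf.continuousOn
    | succ m ih =>
      have hf' := zero_succ.1 hf
      have hd : ∀ t ∈ Set.Ioo (-δ) δ, HasDerivAt (fun t => t ^ (m + 1) • f t)
          ((m + 1 : ℝ) • t ^ m • f t + t ^ m • t • deriv f t) t := by
        intro t ht
        by_cases h0 : t = 0
        · subst h0
          have := hasDerivAt_pow_smul_zero m (hf'.1.continuousAt (isOpen_Ioo.mem_nhds ht))
          convert! this using 1
          rcases m with _ | m <;> simp
        · have := hasDerivAt_pow_smul m (hf'.2.1 t ht h0)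
          convert! this using 2
          rw [smul_smul, pow_succ]
      rw [show 0 + (m + 1) = (0 + m) + 1 by omega, contDiffOn_succ_Ioo]
      refine ⟨fun t ht => (hd t ht).differentiableAt, ?_⟩
      refine (((ih hf.of_succ_right).const_smul (m + 1 : ℝ)).add (ih hf'.2.2)).congr
        fun t ht => (hd t ht).deriv
  | succ q ih =>
    have hf' := succ_iff.1 hf
    induction m with
    | zero =>
      rw [add_zero, contDiffOn_succ_Ioo]
      simp only [pow_zero, one_smul]
      exact ⟨hf'.1, by simpa using ih hf'.2⟩
    | succ m ihm =>
      have hd : ∀ t ∈ Set.Ioo (-δ) δ, _ := fun t ht => hasDerivAt_pow_smul m (hf'.1 t ht)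
      rw [show q + 1 + (m + 1) = (q + (m + 1)) + 1 by omega, contDiffOn_succ_Ioo]
      refine ⟨fun t ht => (hd t ht).differentiableAt, ?_⟩
      have h1 := ihm hf.of_succ_right (succ_iff.1 hf.of_succ_right)
      rw [show q + 1 + m = q + (m + 1) by omega] at h1
      exact ((h1.const_smul (m + 1 : ℝ)).add (ih hf'.2)).congr fun t ht => (hd t ht).deriv

/-- The other half of the equivalence: the Euler derivatives of `f` are recovered from the derivatives of
`t^m f` by Hadamard's lemma. -/
theorem EulerReg.of_contDiffOn_pow_smul [CompleteSpace E] {δ : ℝ} {q m : ℕ} {f : ℝ → E}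
    (hc : ContinuousOn f (Set.Ioo (-δ) δ))
    (hs : ContDiffOn ℝ (q + m : ℕ) (fun t => t ^ m • f t) (Set.Ioo (-δ) δ)) :
    EulerReg δ q m f := by
  induction q generalizing m f with
  | zero =>
    induction m generalizing f with
    | zero => exact zero_zero.2 hc
    | succ m ih =>
      -- by Hadamard's lemma, `t f` is `C¹`, and `t^m f` is `C^m`
      have h1 : ContDiffOn ℝ (0 + 1 : ℕ) (fun t => t • f t) (Set.Ioo (-δ) δ) := by
        refine contDiffOn_of_pow_smul (continuousOn_id.smul hc) m ?_
        refine (hs.congr fun t _ => ?_).of_le (by norm_cast; omega)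
        rw [smul_smul, pow_succ]
      have hm : ContDiffOn ℝ m (fun t => t ^ m • f t) (Set.Ioo (-δ) δ) := by
        refine contDiffOn_of_smul ((continuous_pow m).continuousOn.smul hc) ?_
        refine (hs.congr fun t _ => ?_).of_le (by norm_cast; omega)
        rw [smul_smul, pow_succ']
      have h1' := contDiffOn_succ_Ioo.1 h1
      have hs' := contDiffOn_succ_Ioo.1 (hs.of_le (m := (m + 1 : ℕ)) (by norm_cast; omega))
      have hdiff : ∀ t ∈ Set.Ioo (-δ) δ, t ≠ 0 → DifferentiableAt ℝ f t := by
        intro t ht h0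
        have h2 : DifferentiableAt ℝ (fun t : ℝ => t⁻¹ • t • f t) t :=
          (differentiableAt_inv h0).smul (h1'.1 t ht)
        refine h2.congr_of_eventuallyEq ?_
        filter_upwards [isOpen_ne.mem_nhds h0] with x hx
        rw [inv_smul_smul₀ hx]
      -- two formulas for `t f'`: the first shows that it is continuous, the second that `t^m (t f')`
      -- is `C^m`
      have heq1 : ∀ t ∈ Set.Ioo (-δ) δ,
          t • deriv f t = deriv (fun t => t • f t) t - f t := by
        intro t ht
        by_cases h0 : t = 0
        · subst h0
          have := hasDerivAt_pow_smul_zero 0 (hc.continuousAt (isOpen_Ioo.mem_nhds ht))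
          simp only [zero_add, pow_one, pow_zero, one_smul] at this
          simp [this.deriv]
        · have := hasDerivAt_pow_smul 0 (hdiff t ht h0)
          simp only [zero_add, pow_one, pow_zero, one_smul, Nat.cast_zero] at this
          simp [this.deriv]
      have heq2 : ∀ t ∈ Set.Ioo (-δ) δ, t ^ m • t • deriv f t =
          deriv (fun t => t ^ (m + 1) • f t) t - (m + 1 : ℝ) • t ^ m • f t := by
        intro t ht
        by_cases h0 : t = 0
        · subst h0
          have := hasDerivAt_pow_smul_zero m (hc.continuousAt (isOpen_Ioo.mem_nhds ht))
          rw [this.deriv]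
          rcases m with _ | m <;> simp
        · have := hasDerivAt_pow_smul m (hdiff t ht h0)
          rw [this.deriv, smul_smul, ← pow_succ]
          abel
      refine zero_succ.2 ⟨hc, hdiff, ih ?_ ?_⟩
      · exact (h1'.2.continuousOn.sub hc).congr heq1
      · rw [zero_add]
        exact (hs'.2.sub (hm.const_smul (m + 1 : ℝ))).congr heq2
  | succ q ih =>
    have hf : ContDiffOn ℝ (q + 1 : ℕ) f (Set.Ioo (-δ) δ) := contDiffOn_of_pow_smul hc m hs
    have hf' := contDiffOn_succ_Ioo.1 hf
    refine succ_iff.2 ⟨hf'.1, ih hf'.2.continuousOn ?_⟩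
    rcases m with _ | m
    · simpa using hf'.2
    · rw [show q + 1 + (m + 1) = (q + (m + 1)) + 1 by omega, contDiffOn_succ_Ioo] at hs
      have hm : ContDiffOn ℝ (q + (m + 1) : ℕ) (fun t => t ^ m • f t) (Set.Ioo (-δ) δ) := by
        refine contDiffOn_of_smul ((continuous_pow m).continuousOn.smul hc) ?_
        refine (contDiffOn_succ_Ioo.2 hs).congr fun t _ => ?_
        rw [smul_smul, pow_succ']
      refine (hs.2.sub (hm.const_smul (m + 1 : ℝ))).congr fun t ht => ?_
      simp only [(hasDerivAt_pow_smul m (hf'.1 t ht)).deriv]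
      abel

namespace WReg

variable {δ : ℝ} {D : ℕ∞} {e : ℕ} {f g : ℝ → E}

theorem congr (hf : WReg δ D e f) (h : Set.EqOn g f (Set.Ioo (-δ) δ)) : WReg δ D e g :=
  ⟨hf.1.congr h, hf.2.congr fun t ht => by simp only [h ht]⟩

theorem mono_ball {δ' : ℝ} (h : δ' ≤ δ) (hf : WReg δ D e f) : WReg δ' D e f := by
  have : Set.Ioo (-δ') δ' ⊆ Set.Ioo (-δ) δ := Set.Ioo_subset_Ioo (by linarith) h
  exact ⟨hf.1.mono this, hf.2.mono this⟩

theorem mono_weight {e' : ℕ} (h : e ≤ e') (hf : WReg δ D e f) : WReg δ D e' f := by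
  obtain ⟨k, rfl⟩ := Nat.exists_eq_add_of_le h
  refine ⟨hf.1, ((contDiff_id.pow k).contDiffOn.smul hf.2).congr fun t _ => ?_⟩
  simp [smul_smul, pow_add, mul_comm]

theorem of_le {D' : ℕ∞} (h : D' ≤ D) (hf : WReg δ D e f) : WReg δ D' e f :=
  ⟨hf.1, hf.2.of_le (by exact_mod_cast h)⟩

theorem pow_smul {r e' : ℕ} (he : e ≤ e' + r) (hf : WReg δ D e f) :
    WReg δ D e' fun t => t ^ r • f t := by
  refine ⟨(continuous_pow r).continuousOn.smul hf.1, (hf.mono_weight he).2.congr fun t _ => ?_⟩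
  simp only [smul_smul, pow_add]

theorem of_pow_smul {r : ℕ} (hc : ContinuousOn f (Set.Ioo (-δ) δ))
    (hf : WReg δ D e fun t => t ^ r • f t) : WReg δ D (e + r) f :=
  ⟨hc, hf.2.congr fun t _ => by simp only [smul_smul, pow_add]⟩

theorem iff_eulerReg [CompleteSpace E] {q m : ℕ} :
    WReg δ (q + m : ℕ) m f ↔ EulerReg δ q m f :=
  ⟨fun h => .of_contDiffOn_pow_smul h.1 h.2, fun h => ⟨h.continuousOn, h.contDiffOn_pow_smul⟩⟩

theorem iff_eulerReg_sub [CompleteSpace E] {D : ℕ} (h : e ≤ D) :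
    WReg δ D e f ↔ EulerReg δ (D - e) e f := by
  rw [← iff_eulerReg, Nat.sub_add_cancel h]

theorem contDiffOn [CompleteSpace E] {q : ℕ∞} (h : q + e ≤ D) (hf : WReg δ D e f) :
    ContDiffOn ℝ (q : WithTop ℕ∞) f (Set.Ioo (-δ) δ) := by
  induction q with
  | top =>
    have hD : D = ⊤ := by simpa using h
    subst hD
    rw [contDiffOn_infty]
    intro k
    exact contDiffOn_of_pow_smul hf.1 e (hf.2.of_le (by exact_mod_cast le_top))
  | coe k =>
    exact contDiffOn_of_pow_smul hf.1 e (hf.2.of_le (by exact_mod_cast h))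

theorem forall_nat (he : (e : ℕ∞) ≤ D) :
    WReg δ D e f ↔ ∀ k : ℕ, e ≤ k → (k : ℕ∞) ≤ D → WReg δ k e f := by
  refine ⟨fun h k _ hk => h.of_le hk, fun h => ?_⟩
  induction D with
  | top =>
    refine ⟨(h e le_rfl le_top).1, ?_⟩
    show ContDiffOn ℝ ((⊤ : ℕ∞) : WithTop ℕ∞) _ _
    rw [contDiffOn_infty]
    exact fun k => (h (max e k) (le_max_left _ _) le_top).2.of_le (by norm_cast; exact le_max_right _ _)
  | coe D => exact h D (by exact_mod_cast he) le_rfl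

theorem comp_smooth [CompleteSpace E] [CompleteSpace F] (he : (e : ℕ∞) ≤ D) {Ω : Set E}
    (hΩ : IsOpen Ω) {Φ : E → F}
    (hΦ : ContDiffOn ℝ (⊤ : ℕ∞) Φ Ω) (hf : WReg δ D e f) (hm : Set.MapsTo f (Set.Ioo (-δ) δ) Ω) :
    WReg δ D e fun t => Φ (f t) := by
  rw [forall_nat he] at hf ⊢
  intro k hk hkD
  have := hf k hk hkD
  rw [iff_eulerReg_sub hk] at this ⊢
  exact this.comp_smooth hΩ hΦ hm

theorem bilin [CompleteSpace E] [CompleteSpace F] [CompleteSpace G] (he : (e : ℕ∞) ≤ D)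
    (B : E →L[ℝ] F →L[ℝ] G) {g : ℝ → F} (hf : WReg δ D e f)
    (hg : WReg δ D e g) : WReg δ D e fun t => B (f t) (g t) := by
  rw [forall_nat he] at hf hg ⊢
  intro k hk hkD
  have h1 := hf k hk hkD
  have h2 := hg k hk hkD
  rw [iff_eulerReg_sub hk] at h1 h2 ⊢
  exact h1.bilin B h2

theorem mul {f g : ℝ → ℂ} (he : (e : ℕ∞) ≤ D) (hf : WReg δ D e f) (hg : WReg δ D e g) :
    WReg δ D e fun t => f t * g t :=
  bilin he (ContinuousLinearMap.mul ℝ ℂ) hf hg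

theorem add (hf : WReg δ D e f) (hg : WReg δ D e g) : WReg δ D e fun t => f t + g t :=
  ⟨hf.1.add hg.1, (hf.2.add hg.2).congr fun t _ => by simp⟩

theorem const (c : E) : WReg δ D e fun _ => c :=
  ⟨continuousOn_const, by fun_prop⟩

theorem pow {f : ℝ → ℂ} (he : (e : ℕ∞) ≤ D) (hf : WReg δ D e f) (k : ℕ) :
    WReg δ D e fun t => f t ^ k := by
  induction k with
  | zero => simpa using const (1 : ℂ)
  | succ k ih => simpa only [pow_succ] using ih.mul he hf

theorem pi {ι : Type} [Fintype ι] {f : ℝ → ι → ℂ} :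
    WReg δ D e f ↔ ∀ i, WReg δ D e fun t => f t i := by
  unfold WReg
  rw [continuousOn_pi, contDiffOn_pi, forall_and]
  rfl

end WReg

namespace EulerReg

variable {δ : ℝ} {q m : ℕ} {f g : ℝ → E}

theorem of_contDiff {c : ℝ → ℝ} (hc : ContDiff ℝ (⊤ : ℕ∞) c) : EulerReg δ q m c :=
  of_contDiffOn_pow_smul hc.continuous.continuousOn
    (((contDiff_id.pow m).smul hc).contDiffOn.of_le (by exact_mod_cast le_top))

theorem smul {c : ℝ → ℝ} (hc : EulerReg δ q m c) (hf : EulerReg δ q m f) :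
    EulerReg δ q m fun t => c t • f t :=
  hc.bilin (ContinuousLinearMap.lsmul ℝ ℝ) hf

theorem const_smul (c : ℝ) (hf : EulerReg δ q m f) : EulerReg δ q m fun t => c • f t :=
  smul (of_contDiff contDiff_const) hf

/-- The class is not affected by `t ↦ ε t^N`, because `t d/dt (f ∘ φ) = N (t f') ∘ φ` for `φ(t) = ε t^N`. -/
theorem comp_power {δ' ε : ℝ} {N : ℕ} (hN : N ≠ 0) (hε : ε ≠ 0) (hf : EulerReg δ q m f)
    (hm : Set.MapsTo (fun s : ℝ => ε * s ^ N) (Set.Ioo (-δ') δ') (Set.Ioo (-δ) δ)) :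
    EulerReg δ' q m fun s => f (ε * s ^ N) := by
  have hφ : ∀ s : ℝ, HasDerivAt (fun s : ℝ => ε * s ^ N) (ε * (N * s ^ (N - 1))) s := fun s =>
    (hasDerivAt_pow N s).const_mul ε
  induction q generalizing m f with
  | zero =>
    induction m generalizing f with
    | zero =>
      rw [zero_zero] at hf ⊢
      exact hf.comp (by fun_prop) hm
    | succ m ih =>
      have hf' := zero_succ.1 hf
      have hd : ∀ s ∈ Set.Ioo (-δ') δ', s ≠ 0 → HasDerivAt (fun s => f (ε * s ^ N))
          ((ε * (N * s ^ (N - 1))) • deriv f (ε * s ^ N)) s := fun s hs h0 =>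
        (hf'.2.1 _ (hm hs) (mul_ne_zero hε (pow_ne_zero _ h0))).hasDerivAt.scomp s (hφ s)
      refine zero_succ.2 ⟨hf'.1.comp (by fun_prop) hm, fun s hs h0 => (hd s hs h0).differentiableAt,
        (const_smul (N : ℝ) (ih hf'.2.2)).congr fun s hs => ?_⟩
      by_cases h0 : s = 0
      · simp [h0, hN]
      · simp only [(hd s hs h0).deriv, smul_smul]
        congr 1
        obtain ⟨M, rfl⟩ := Nat.exists_eq_succ_of_ne_zero hN
        simp only [Nat.succ_eq_add_one, Nat.add_sub_cancel]
        ring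
  | succ q ih =>
    have hf' := succ_iff.1 hf
    have hd : ∀ s ∈ Set.Ioo (-δ') δ', HasDerivAt (fun s => f (ε * s ^ N))
        ((ε * (N * s ^ (N - 1))) • deriv f (ε * s ^ N)) s := fun s hs =>
      (hf'.1 _ (hm hs)).hasDerivAt.scomp s (hφ s)
    exact succ_iff.2 ⟨fun s hs => (hd s hs).differentiableAt,
      (smul (of_contDiff (by fun_prop)) (ih hf'.2)).congr fun s hs => (hd s hs).deriv⟩

end EulerReg

theorem WReg.comp_power [CompleteSpace E] {δ δ' ε : ℝ} {D : ℕ∞} {e N : ℕ} {f : ℝ → E}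
    (he : (e : ℕ∞) ≤ D) (hN : N ≠ 0) (hε : ε ≠ 0) (hf : WReg δ D e f)
    (hm : Set.MapsTo (fun s : ℝ => ε * s ^ N) (Set.Ioo (-δ') δ') (Set.Ioo (-δ) δ)) :
    WReg δ' D e fun s => f (ε * s ^ N) := by
  rw [forall_nat he] at hf ⊢
  intro k hk hkD
  have := hf k hk hkD
  rw [iff_eulerReg_sub hk] at this ⊢
  exact this.comp_power hN hε hm

/-! ### Fractional powers -/

/-- The function equal to `|t|^α μ(|t|^β)` for `t > 0`, to `|t|^α ν(|t|^β)` for `t < 0`, and to `0` at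
the origin. -/
def twoSided (α β : ℝ) (μ ν : ℝ → E) (t : ℝ) : E :=
  if 0 < t then t ^ α • μ (t ^ β) else if t < 0 then (-t) ^ α • ν ((-t) ^ β) else 0

namespace twoSided

variable {α β δ δ' : ℝ} {μ ν : ℝ → E} {t : ℝ}

theorem of_pos (ht : 0 < t) : twoSided α β μ ν t = t ^ α • μ (t ^ β) := if_pos ht

theorem of_neg (ht : t < 0) : twoSided α β μ ν t = (-t) ^ α • ν ((-t) ^ β) := by
  rw [twoSided, if_neg ht.not_gt, if_pos ht]

theorem at_zero : twoSided α β μ ν 0 = 0 := by simp [twoSided]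

theorem rpow_mem (hβ : 0 < β) (hδ : δ ^ β ≤ δ') (h0 : 0 < t) (ht : t < δ) :
    t ^ β ∈ Set.Ioo (-δ') δ' := by
  have h1 := Real.rpow_pos_of_pos h0 β
  have h2 := (Real.rpow_lt_rpow h0.le ht hβ).trans_le hδ
  exact ⟨by linarith, h2⟩

theorem hasDerivAt_half (h0 : 0 < t) (hμ : DifferentiableAt ℝ μ (t ^ β)) :
    HasDerivAt (fun t : ℝ => t ^ α • μ (t ^ β))
      (t ^ (α - 1) • (α • μ (t ^ β) + β • t ^ β • deriv μ (t ^ β))) t := by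
  have h1 := Real.hasDerivAt_rpow_const (p := β) (Or.inl h0.ne')
  have h2 := Real.hasDerivAt_rpow_const (p := α) (Or.inl h0.ne')
  have h3 := h2.smul (hμ.hasDerivAt.scomp t h1)
  convert! h3 using 1
  simp only [smul_add, smul_smul]
  rw [add_comm]
  congr 2
  · rw [Real.rpow_sub_one h0.ne', Real.rpow_sub_one h0.ne']
    field_simp
  · ring

theorem hasDerivAt (hβ : 0 < β) (hδ : δ ^ β ≤ δ') (ht : t ∈ Set.Ioo (-δ) δ) (h0 : t ≠ 0)
    (hμ : ∀ s ∈ Set.Ioo (-δ') δ', s ≠ 0 → DifferentiableAt ℝ μ s)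
    (hν : ∀ s ∈ Set.Ioo (-δ') δ', s ≠ 0 → DifferentiableAt ℝ ν s) :
    HasDerivAt (twoSided α β μ ν)
      (twoSided (α - 1) β (fun s => α • μ s + β • s • deriv μ s)
        (fun s => (-1 : ℝ) • (α • ν s + β • s • deriv ν s)) t) t := by
  rcases lt_or_gt_of_ne h0 with h | h
  · have h' : 0 < -t := by linarith
    have hm := rpow_mem hβ hδ h' (by linarith [ht.1])
    have h1 := hasDerivAt_half (α := α) (β := β) h' (hν _ hm (Real.rpow_pos_of_pos h' β).ne')
    have h2 := h1.scomp t (hasDerivAt_neg t)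
    rw [of_neg h]
    refine (h2.congr_of_eventuallyEq ?_).congr_deriv ?_
    · filter_upwards [isOpen_Iio.mem_nhds h] with x hx
      rw [of_neg hx]
      rfl
    · rw [smul_comm]
  · have hm := rpow_mem hβ hδ h ht.2
    rw [of_pos h]
    refine (hasDerivAt_half h (hμ _ hm (Real.rpow_pos_of_pos h β).ne')).congr_of_eventuallyEq ?_
    filter_upwards [isOpen_Ioi.mem_nhds h] with x hx
    rw [of_pos hx]

/-- As `μ` and `ν` are bounded near the origin, `twoSided` is `O(|t|^α)` there. -/
theorem norm_le (hβ : 0 < β) (hδ0 : 0 < δ') (hμ : ContinuousOn μ (Set.Ioo (-δ') δ'))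
    (hν : ContinuousOn ν (Set.Ioo (-δ') δ')) :
    ∃ M : ℝ, ∀ᶠ t in 𝓝 (0 : ℝ), ‖twoSided α β μ ν t‖ ≤ |t| ^ α * M := by
  have h0 : (0 : ℝ) ∈ Set.Ioo (-δ') δ' := ⟨by linarith, hδ0⟩
  have hb : ∀ {κ : ℝ → E}, ContinuousOn κ (Set.Ioo (-δ') δ') →
      ∀ᶠ t in 𝓝 (0 : ℝ), ‖κ (|t| ^ β)‖ ≤ ‖κ 0‖ + 1 := by
    intro κ hκ
    have h1 : Tendsto (fun t : ℝ => |t| ^ β) (𝓝 0) (𝓝 0) := by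
      have : Continuous fun t : ℝ => |t| ^ β := continuous_abs.rpow_const fun _ => Or.inr hβ.le
      simpa [Real.zero_rpow hβ.ne'] using this.tendsto 0
    have h2 := (((hκ.continuousAt (isOpen_Ioo.mem_nhds h0)).norm).tendsto.comp h1)
    exact (h2.eventually_lt_const (lt_add_one _)).mono fun t ht => le_of_lt ht
  refine ⟨(‖μ 0‖ + 1) + (‖ν 0‖ + 1), ?_⟩
  filter_upwards [hb hμ, hb hν] with t h1 h2
  have hp : (0 : ℝ) ≤ |t| ^ α := Real.rpow_nonneg (abs_nonneg t) α
  rcases lt_trichotomy t 0 with h | h | h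
  · rw [abs_of_neg h] at h1 h2 hp ⊢
    rw [of_neg h, norm_smul, Real.norm_of_nonneg hp]
    gcongr
    linarith [norm_nonneg (μ 0)]
  · subst h
    rw [at_zero, norm_zero]
    positivity
  · rw [abs_of_pos h] at h1 h2 hp ⊢
    rw [of_pos h, norm_smul, Real.norm_of_nonneg hp]
    gcongr
    linarith [norm_nonneg (ν 0)]

theorem continuousOn (hα : 0 < α) (hβ : 0 < β) (hδ : δ ^ β ≤ δ') (hδ0 : 0 < δ')
    (hμ : ContinuousOn μ (Set.Ioo (-δ') δ')) (hν : ContinuousOn ν (Set.Ioo (-δ') δ')) :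
    ContinuousOn (twoSided α β μ ν) (Set.Ioo (-δ) δ) := by
  intro t ht
  apply ContinuousAt.continuousWithinAt
  have key : ∀ {κ : ℝ → E} {t : ℝ}, ContinuousOn κ (Set.Ioo (-δ') δ') → 0 < t → t < δ →
      ContinuousAt (fun t : ℝ => t ^ α • κ (t ^ β)) t := by
    intro κ t hκ h0 ht
    refine (Real.continuousAt_rpow_const _ _ (Or.inl h0.ne')).smul ?_
    exact ContinuousAt.comp (f := fun t : ℝ => t ^ β)
      (hκ.continuousAt (isOpen_Ioo.mem_nhds (rpow_mem hβ hδ h0 ht)))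
      (Real.continuousAt_rpow_const _ _ (Or.inl h0.ne'))
  rcases lt_trichotomy t 0 with h | h | h
  · have h1 := ContinuousAt.comp (f := fun t : ℝ => -t) (x := t)
      (key hν (neg_pos.2 h) (by linarith [ht.1])) (by fun_prop)
    refine h1.congr ?_
    filter_upwards [isOpen_Iio.mem_nhds h] with x hx
    rw [of_neg hx]
    rfl
  · subst h
    obtain ⟨M, hM⟩ := norm_le (α := α) hβ hδ0 hμ hν
    have hc : Tendsto (fun t : ℝ => |t| ^ α * M) (𝓝 0) (𝓝 0) := by
      have : Continuous fun t : ℝ => |t| ^ α * M :=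
        (continuous_abs.rpow_const fun _ => Or.inr hα.le).mul_const M
      simpa [Real.zero_rpow hα.ne'] using this.tendsto 0
    rw [ContinuousAt, at_zero]
    exact squeeze_zero_norm' hM hc
  · refine (key hμ h ht.2).congr ?_
    filter_upwards [isOpen_Ioi.mem_nhds h] with x hx
    rw [of_pos hx]

theorem eulerReg_zero (hα : 0 < α) (hβ : 0 < β) (hδ : δ ^ β ≤ δ') (hδ0 : 0 < δ') {k : ℕ}
    (hμ : EulerReg δ' 0 k μ) (hν : EulerReg δ' 0 k ν) : EulerReg δ 0 k (twoSided α β μ ν) := by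
  induction k generalizing μ ν with
  | zero => exact EulerReg.zero_zero.2 (continuousOn hα hβ hδ hδ0 hμ.continuousOn hν.continuousOn)
  | succ k ih =>
    have hμ' := EulerReg.zero_succ.1 hμ
    have hν' := EulerReg.zero_succ.1 hν
    have hd : ∀ t ∈ Set.Ioo (-δ) δ, t ≠ 0 → _ := fun t ht h0 =>
      hasDerivAt (α := α) hβ hδ ht h0 hμ'.2.1 hν'.2.1
    refine EulerReg.zero_succ.2 ⟨continuousOn hα hβ hδ hδ0 hμ'.1 hν'.1,
      fun t ht h0 => (hd t ht h0).differentiableAt,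
      (ih ((hμ.of_succ_right.const_smul α).add (hμ'.2.2.const_smul β))
        ((hν.of_succ_right.const_smul α).add (hν'.2.2.const_smul β))).congr fun t ht => ?_⟩
    by_cases h0 : t = 0
    · simp [h0, at_zero]
    · simp only [(hd t ht h0).deriv]
      rcases lt_or_gt_of_ne h0 with h | h
      · have h' : 0 < -t := by linarith
        rw [of_neg h, of_neg h, smul_smul, smul_smul, Real.rpow_sub_one h'.ne']
        congr 1
        field_simp
      · rw [of_pos h, of_pos h, smul_smul, Real.rpow_sub_one h.ne']
        congr 1
        field_simp

/-- One derivative lowers the exponent `α` by one, and uses up one Euler derivative of `μ` and `ν`. -/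
theorem eulerReg (hβ : 0 < β) (hδ : δ ^ β ≤ δ') (hδ0 : 0 < δ') {k p : ℕ} (hp : (p : ℝ) < α)
    (hμ : EulerReg δ' 0 (p + k) μ) (hν : EulerReg δ' 0 (p + k) ν) :
    EulerReg δ p k (twoSided α β μ ν) := by
  induction p generalizing α μ ν with
  | zero => exact eulerReg_zero (by simpa using hp) hβ hδ hδ0 (by simpa using hμ) (by simpa using hν)
  | succ p ih =>
    have hα : 1 < α := by push_cast at hp; linarith [(Nat.cast_nonneg p : (0 : ℝ) ≤ p)]
    rw [show p + 1 + k = (p + k) + 1 by omega] at hμ hν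
    have hμ' := EulerReg.zero_succ.1 hμ
    have hν' := EulerReg.zero_succ.1 hν
    have hd : ∀ t ∈ Set.Ioo (-δ) δ, HasDerivAt (twoSided α β μ ν)
        (twoSided (α - 1) β (fun s => α • μ s + β • s • deriv μ s)
          (fun s => (-1 : ℝ) • (α • ν s + β • s • deriv ν s)) t) t := by
      intro t ht
      by_cases h0 : t = 0
      · subst h0
        -- the difference quotients at the origin are `O(|t|^(α-1))`
        obtain ⟨M, hM⟩ := norm_le (α := α) hβ hδ0 hμ'.1 hν'.1
        have hc : Tendsto (fun t : ℝ => |t| ^ (α - 1) * M) (𝓝[≠] 0) (𝓝 0) := by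
          have : Continuous fun t : ℝ => |t| ^ (α - 1) * M :=
            (continuous_abs.rpow_const fun _ => Or.inr (by linarith)).mul_const M
          have h2 := (this.tendsto 0).mono_left (nhdsWithin_le_nhds (s := {0}ᶜ))
          simpa [Real.zero_rpow (sub_pos.2 hα).ne'] using h2
        rw [hasDerivAt_iff_tendsto_slope, at_zero]
        refine squeeze_zero_norm' ?_ hc
        filter_upwards [nhdsWithin_le_nhds hM, self_mem_nhdsWithin] with t h1 h2
        have h2' : 0 < |t| := abs_pos.2 h2
        rw [slope_def_module, at_zero, sub_zero, sub_zero, norm_smul, norm_inv, Real.norm_eq_abs,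
          Real.rpow_sub_one h2'.ne']
        calc |t|⁻¹ * ‖twoSided α β μ ν t‖ ≤ |t|⁻¹ * (|t| ^ α * M) := by gcongr
          _ = |t| ^ α / |t| * M := by ring
      · exact hasDerivAt hβ hδ ht h0 hμ'.2.1 hν'.2.1
    refine EulerReg.succ_iff.2 ⟨fun t ht => (hd t ht).differentiableAt, (ih ?_ ?_ ?_).congr
      fun t ht => (hd t ht).deriv⟩
    · push_cast at hp
      linarith
    · exact (hμ.of_succ_right.const_smul α).add (hμ'.2.2.const_smul β)
    · exact ((hν.of_succ_right.const_smul α).add (hν'.2.2.const_smul β)).const_smul (-1)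

end twoSided

end weighted

/-! ### Splitting -/

/-- The polynomial of degree `< n` with coefficient vector `c`. -/
def lowPoly (n : ℕ) (c : Fin n → ℂ) : ℂ[X] := ∑ i, C (c i) * X ^ (i : ℕ)

/-- The monic polynomial of degree `n` whose lower coefficients are given by `c`. -/
def ofCoeffs (n : ℕ) (c : Fin n → ℂ) : ℂ[X] := X ^ n + lowPoly n c

/-- The vector of the coefficients of index `< n`. -/
def coeffs (n : ℕ) (p : ℂ[X]) : Fin n → ℂ := fun i => p.coeff i

section
variable {n : ℕ} {c : Fin n → ℂ} {p : ℂ[X]}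

theorem coeff_lowPoly (k : ℕ) : (lowPoly n c).coeff k = if h : k < n then c ⟨k, h⟩ else 0 := by
  rw [lowPoly, finsetSum_coeff]
  simp only [coeff_C_mul, coeff_X_pow, mul_ite, mul_one, mul_zero]
  split_ifs with h
  · rw [Finset.sum_eq_single ⟨k, h⟩]
    · simp
    · intro b _ hb
      rw [if_neg]
      rintro rfl
      exact hb rfl
    · simp
  · refine Finset.sum_eq_zero fun i _ => if_neg ?_
    rintro rfl
    exact h i.2

theorem degree_lowPoly_lt : (lowPoly n c).degree < n := by
  rw [degree_lt_iff_coeff_zero]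
  intro m hm
  rw [coeff_lowPoly, dif_neg (by omega)]

theorem coeff_ofCoeffs (k : ℕ) :
    (ofCoeffs n c).coeff k = if h : k < n then c ⟨k, h⟩ else if k = n then 1 else 0 := by
  rw [ofCoeffs, coeff_add, coeff_lowPoly, coeff_X_pow]
  split_ifs with h1 h2 h2
  · omega
  · simp
  · simp
  · simp

theorem monic_ofCoeffs : (ofCoeffs n c).Monic := monic_X_pow_add degree_lowPoly_lt

theorem natDegree_ofCoeffs : (ofCoeffs n c).natDegree = n := by
  have : (ofCoeffs n c).degree = n := by
    rw [ofCoeffs, degree_add_eq_left_of_degree_lt] <;> rw [degree_X_pow]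
    exact degree_lowPoly_lt
  exact natDegree_eq_of_degree_eq_some this

theorem ofCoeffs_coeffs (hp : p.Monic) (hn : p.natDegree = n) : ofCoeffs n (coeffs n p) = p := by
  ext k
  rw [coeff_ofCoeffs]
  split_ifs with h1 h2
  · rfl
  · subst h2; rw [← hn]; exact hp.coeff_natDegree.symm
  · exact (coeff_eq_zero_of_natDegree_lt (by omega)).symm

end

/-- The multiplication of monic polynomials of degrees `a` and `b`, in terms of coefficients. -/
def mulCoeffs (a b : ℕ) (x : (Fin a → ℂ) × (Fin b → ℂ)) : Fin (a + b) → ℂ :=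
  coeffs (a + b) (ofCoeffs a x.1 * ofCoeffs b x.2)

/-- The derivative of `mulCoeffs`. -/
def mulCoeffsDeriv (a b : ℕ) (x : (Fin a → ℂ) × (Fin b → ℂ)) :
    ((Fin a → ℂ) × (Fin b → ℂ)) →ₗ[ℂ] (Fin (a + b) → ℂ) where
  toFun y := coeffs (a + b) (lowPoly a y.1 * ofCoeffs b x.2 + ofCoeffs a x.1 * lowPoly b y.2)
  map_add' y z := by
    have h : ∀ (m : ℕ) (u v : Fin m → ℂ), lowPoly m (u + v) = lowPoly m u + lowPoly m v := by
      intro m u v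
      simp [lowPoly, add_mul, Finset.sum_add_distrib]
    ext i
    simp only [coeffs, Prod.fst_add, Prod.snd_add, h, Pi.add_apply, ← coeff_add]
    congr 1
    ring
  map_smul' r y := by
    have h : ∀ (m : ℕ) (u : Fin m → ℂ), lowPoly m (r • u) = C r * lowPoly m u := by
      intro m u
      simp [lowPoly, Finset.mul_sum, mul_assoc]
    ext i
    simp only [coeffs, Prod.smul_fst, Prod.smul_snd, h, Pi.smul_apply, smul_eq_mul, RingHom.id_apply,
      ← coeff_C_mul]
    congr 1
    ring

theorem hasFDerivAt_coeff_ofCoeffs (a k : ℕ) (c : Fin a → ℂ) :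
    ∃ L : (Fin a → ℂ) →L[ℂ] ℂ, (∀ y, L y = (lowPoly a y).coeff k) ∧
      HasFDerivAt (fun c => (ofCoeffs a c).coeff k) L c := by
  by_cases h : k < a
  · refine ⟨ContinuousLinearMap.proj ⟨k, h⟩, fun y => by simp [coeff_lowPoly, h], ?_⟩
    simp only [coeff_ofCoeffs, dif_pos h]
    exact (ContinuousLinearMap.proj (R := ℂ) (φ := fun _ => ℂ) (⟨k, h⟩ : Fin a)).hasFDerivAt
  · refine ⟨0, fun y => by simp [coeff_lowPoly, h], ?_⟩
    simp only [coeff_ofCoeffs, dif_neg h]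
    exact hasFDerivAt_const _ _

theorem contDiff_coeff_ofCoeffs (a k : ℕ) {m : WithTop ℕ∞} :
    ContDiff ℂ m fun c : Fin a → ℂ => (ofCoeffs a c).coeff k := by
  by_cases h : k < a
  · simp only [coeff_ofCoeffs, dif_pos h]
    exact contDiff_apply ℂ ℂ _
  · simp only [coeff_ofCoeffs, dif_neg h]
    exact contDiff_const

theorem contDiff_mulCoeffs (a b : ℕ) {m : WithTop ℕ∞} : ContDiff ℂ m (mulCoeffs a b) := by
  rw [contDiff_pi]
  intro i
  simp only [mulCoeffs, coeffs, coeff_mul]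
  exact ContDiff.sum fun x _ => ((contDiff_coeff_ofCoeffs a x.1).comp contDiff_fst).mul
    ((contDiff_coeff_ofCoeffs b x.2).comp contDiff_snd)

theorem hasFDerivAt_mulCoeffs (a b : ℕ) (x : (Fin a → ℂ) × (Fin b → ℂ)) :
    HasFDerivAt (mulCoeffs a b) (mulCoeffsDeriv a b x).toContinuousLinearMap x := by
  rw [hasFDerivAt_pi']
  intro i
  choose L hL hL' using fun k => hasFDerivAt_coeff_ofCoeffs a k x.1
  choose M hM hM' using fun k => hasFDerivAt_coeff_ofCoeffs b k x.2
  simp only [mulCoeffs, coeffs, coeff_mul]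
  refine (HasFDerivAt.fun_sum fun y _ => ((hL' y.1).comp x hasFDerivAt_fst).mul
    ((hM' y.2).comp x hasFDerivAt_snd)).congr_fderiv ?_
  have h0 : ∀ m : ℕ, lowPoly m 0 = 0 := fun m => by simp [lowPoly]
  refine ContinuousLinearMap.ext fun y => ?_
  simp only [mulCoeffsDeriv, sum_apply, add_apply, smul_apply,
    ContinuousLinearMap.comp_apply, hL, hM, smul_eq_mul, ContinuousLinearMap.proj_apply,
    LinearMap.coe_toContinuousLinearMap', LinearMap.coe_mk, AddHom.coe_mk,
    ContinuousLinearMap.coe_fst', ContinuousLinearMap.coe_snd', Function.comp_apply]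
  simp only [coeffs, coeff_add, coeff_mul, ← Finset.sum_add_distrib]
  exact Finset.sum_congr rfl fun _ _ => by ring

/-- The derivative at `(q₁, q₂)` is `(u, v) ↦ u q₂ + q₁ v`, for `u`, `v` of degree less than that of `q₁`,
`q₂`; if it vanishes and `q₁`, `q₂` are coprime, then `q₁` divides `u`, and `q₂` divides `v`. -/
theorem injective_mulCoeffsDeriv {a b : ℕ} {x : (Fin a → ℂ) × (Fin b → ℂ)}
    (h : IsCoprime (ofCoeffs a x.1) (ofCoeffs b x.2)) :
    Function.Injective (mulCoeffsDeriv a b x) := by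
  rw [← LinearMap.ker_eq_bot, LinearMap.ker_eq_bot']
  intro y hy
  have hlow : ∀ {m : ℕ} {u : Fin m → ℂ}, lowPoly m u = 0 → u = 0 := by
    intro m u hu
    ext i
    have := congrArg (fun p => coeff p i) hu
    simpa [coeff_lowPoly] using this
  have hz : lowPoly a y.1 * ofCoeffs b x.2 + ofCoeffs a x.1 * lowPoly b y.2 = 0 := by
    have hda : (ofCoeffs a x.1).degree = a := by
      rw [degree_eq_natDegree monic_ofCoeffs.ne_zero, natDegree_ofCoeffs]
    have hdb : (ofCoeffs b x.2).degree = b := by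
      rw [degree_eq_natDegree monic_ofCoeffs.ne_zero, natDegree_ofCoeffs]
    have hdeg : (lowPoly a y.1 * ofCoeffs b x.2 + ofCoeffs a x.1 * lowPoly b y.2).degree
        < ((a + b : ℕ) : WithBot ℕ) := by
      refine (degree_add_le _ _).trans_lt (max_lt ?_ ?_)
      · rw [degree_mul, hdb]
        push_cast
        exact WithBot.add_lt_add_right (by simp) degree_lowPoly_lt
      · rw [degree_mul, hda]
        push_cast
        exact WithBot.add_lt_add_left (by simp) degree_lowPoly_lt
    ext k
    by_cases hk : k < a + b
    · exact congrFun hy ⟨k, hk⟩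
    · rw [degree_lt_iff_coeff_zero] at hdeg
      rw [hdeg k (by omega), coeff_zero]
  have h1 : ofCoeffs a x.1 ∣ lowPoly a y.1 := by
    refine h.dvd_of_dvd_mul_right ⟨-lowPoly b y.2, ?_⟩
    linear_combination hz
  have h2 : ofCoeffs b x.2 ∣ lowPoly b y.2 := by
    refine h.symm.dvd_of_dvd_mul_left ⟨-lowPoly a y.1, ?_⟩
    linear_combination hz
  have h1' : lowPoly a y.1 = 0 := by
    refine eq_zero_of_dvd_of_degree_lt h1 ?_
    rw [degree_eq_natDegree monic_ofCoeffs.ne_zero, natDegree_ofCoeffs]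
    exact degree_lowPoly_lt
  have h2' : lowPoly b y.2 = 0 := by
    refine eq_zero_of_dvd_of_degree_lt h2 ?_
    rw [degree_eq_natDegree monic_ofCoeffs.ne_zero, natDegree_ofCoeffs]
    exact degree_lowPoly_lt
  exact Prod.ext (hlow h1') (hlow h2')

/-- The splitting lemma: a factorization into two coprime monic factors persists, and the coefficients of
the factors are analytic functions of the coefficients of the product.  This is the inverse function
theorem for `mulCoeffs`. -/
theorem exists_analytic_factorization {a b : ℕ} {q₁ q₂ : ℂ[X]} (h₁ : q₁.Monic) (h₂ : q₂.Monic)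
    (ha : q₁.natDegree = a) (hb : q₂.natDegree = b) (h : IsCoprime q₁ q₂) :
    ∃ (Ψ₁ : (Fin (a + b) → ℂ) → Fin a → ℂ) (Ψ₂ : (Fin (a + b) → ℂ) → Fin b → ℂ),
      AnalyticAt ℂ Ψ₁ (coeffs (a + b) (q₁ * q₂)) ∧ AnalyticAt ℂ Ψ₂ (coeffs (a + b) (q₁ * q₂)) ∧
      Ψ₁ (coeffs (a + b) (q₁ * q₂)) = coeffs a q₁ ∧ Ψ₂ (coeffs (a + b) (q₁ * q₂)) = coeffs b q₂ ∧
      ∀ᶠ c in 𝓝 (coeffs (a + b) (q₁ * q₂)),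
        ofCoeffs (a + b) c = ofCoeffs a (Ψ₁ c) * ofCoeffs b (Ψ₂ c) := by
  set x : (Fin a → ℂ) × (Fin b → ℂ) := (coeffs a q₁, coeffs b q₂) with hx
  have hx1 : ofCoeffs a x.1 = q₁ := ofCoeffs_coeffs h₁ ha
  have hx2 : ofCoeffs b x.2 = q₂ := ofCoeffs_coeffs h₂ hb
  have hval : mulCoeffs a b x = coeffs (a + b) (q₁ * q₂) := by rw [mulCoeffs, hx1, hx2]
  have hinj := injective_mulCoeffsDeriv (x := x) (by rwa [hx1, hx2])
  let Le : ((Fin a → ℂ) × (Fin b → ℂ)) ≃ₗ[ℂ] (Fin (a + b) → ℂ) :=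
    LinearEquiv.ofInjectiveOfFinrankEq (mulCoeffsDeriv a b x) hinj (by simp)
  have hder : HasFDerivAt (mulCoeffs a b)
      (Le.toContinuousLinearEquiv : ((Fin a → ℂ) × (Fin b → ℂ)) →L[ℂ] (Fin (a + b) → ℂ)) x := by
    refine (hasFDerivAt_mulCoeffs a b x).congr_fderiv ?_
    ext y <;> rfl
  have hcd : ContDiffAt ℂ ⊤ (mulCoeffs a b) x := (contDiff_mulCoeffs a b).contDiffAt
  have hinv := hcd.to_localInverse hder (by simp)
  have hright := (hcd.hasStrictFDerivAt' hder (by simp)).eventually_right_inverse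
  have himg := hcd.localInverse_apply_image hder (by simp)
  set Ψ := hcd.localInverse hder (by simp) with hΨ
  rw [hval] at hinv hright himg
  have han : AnalyticAt ℂ Ψ (coeffs (a + b) (q₁ * q₂)) := hinv.analyticAt
  refine ⟨fun c => (Ψ c).1, fun c => (Ψ c).2, ?_, ?_, ?_, ?_, ?_⟩
  · exact (analyticAt_fst).comp han
  · exact (analyticAt_snd).comp han
  · simp only [himg, hx]
  · simp only [himg, hx]
  · filter_upwards [hright] with c hc
    have hc' : coeffs (a + b) (ofCoeffs a (Ψ c).1 * ofCoeffs b (Ψ c).2) = c := hc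
    conv_lhs => rw [← hc']
    refine ofCoeffs_coeffs (monic_ofCoeffs.mul monic_ofCoeffs) ?_
    rw [monic_ofCoeffs.natDegree_mul monic_ofCoeffs, natDegree_ofCoeffs, natDegree_ofCoeffs]

theorem prod_roots {p : ℂ[X]} (hp : p.Monic) : (p.roots.map fun z => X - C z).prod = p :=
  (IsAlgClosed.splits p).eq_prod_roots_of_monic hp |>.symm

theorem card_roots_eq (p : ℂ[X]) : Multiset.card p.roots = p.natDegree :=
  (IsAlgClosed.splits p).natDegree_eq_card_roots.symm

/-- Continuity of roots: for coefficients near those of `p₀`, each root is near a root of `p₀`. -/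
theorem eventually_roots_near {n : ℕ} {p₀ : ℂ[X]} (h₀ : p₀.Monic) (hn : p₀.natDegree = n) {ε : ℝ}
    (hε : 0 < ε) : ∀ᶠ c in 𝓝 (coeffs n p₀), ∀ z ∈ (ofCoeffs n c).roots, ∃ ρ ∈ p₀.roots, dist z ρ < ε := by
  -- a uniform bound `R` for the roots
  set R : ℝ := 1 + ∑ i, (‖coeffs n p₀ i‖ + 1) with hR
  have hR1 : 1 ≤ R := by
    rw [hR]; linarith [Finset.sum_nonneg (s := Finset.univ) fun (i : Fin n) _ =>
      add_nonneg (norm_nonneg (coeffs n p₀ i)) zero_le_one]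
  have hcont : ∀ i : Fin n, Tendsto (fun c : Fin n → ℂ => c i) (𝓝 (coeffs n p₀)) (𝓝 (coeffs n p₀ i)) :=
    fun i => (continuous_apply i).tendsto _
  have hb : ∀ᶠ c in 𝓝 (coeffs n p₀), ∀ i : Fin n, ‖c i‖ ≤ ‖coeffs n p₀ i‖ + 1 := by
    rw [eventually_all]
    exact fun i => ((hcont i).norm.eventually_lt_const (lt_add_one _)).mono fun _ h => le_of_lt h
  have hs : ∀ᶠ c in 𝓝 (coeffs n p₀), ∑ i : Fin n, ‖c i - coeffs n p₀ i‖ * R ^ (i : ℕ) < ε ^ n := by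
    have : Tendsto (fun c : Fin n → ℂ => ∑ i : Fin n, ‖c i - coeffs n p₀ i‖ * R ^ (i : ℕ))
        (𝓝 (coeffs n p₀)) (𝓝 (∑ i : Fin n, ‖coeffs n p₀ i - coeffs n p₀ i‖ * R ^ (i : ℕ))) :=
      tendsto_finsetSum _ fun i _ => (((hcont i).sub_const _).norm).mul_const _
    simp only [sub_self, norm_zero, zero_mul, Finset.sum_const_zero] at this
    exact this.eventually_lt_const (pow_pos hε n)
  filter_upwards [hb, hs] with c h1 h2 z hz
  have hz0 : (ofCoeffs n c).eval z = 0 := (mem_roots'.1 hz).2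
  have hev : ∀ d : Fin n → ℂ, (ofCoeffs n d).eval z = z ^ n + ∑ i, d i * z ^ (i : ℕ) := by
    intro d
    simp [ofCoeffs, lowPoly, eval_finsetSum]
  have hzR : ‖z‖ ≤ R := by
    by_contra hcon
    push Not at hcon
    have hz1 : 1 < ‖z‖ := hR1.trans_lt hcon
    rcases n with _ | n
    · simp [hev] at hz0
    have h3 : z ^ (n + 1) = -∑ i, c i * z ^ (i : ℕ) := by
      rw [hev] at hz0; linear_combination hz0
    have h4 : ‖z‖ ^ (n + 1) ≤ (R - 1) * ‖z‖ ^ n := by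
      rw [← norm_pow, h3, norm_neg, hR, add_sub_cancel_left, Finset.sum_mul]
      refine (norm_sum_le _ _).trans (Finset.sum_le_sum fun i _ => ?_)
      rw [norm_mul, norm_pow]
      have := h1 i
      gcongr
      · exact hz1.le
      · omega
    have h5 : 0 < ‖z‖ ^ n := by positivity
    rw [pow_succ'] at h4
    nlinarith
  -- otherwise `ε^n ≤ |p₀(z)|`, but `|p₀(z)| = |p₀(z) - p(z)|` is small
  by_contra hcon
  push Not at hcon
  have hp0 : p₀.eval z = (p₀.roots.map fun ρ => z - ρ).prod := by
    conv_lhs => rw [← prod_roots h₀]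
    rw [eval_multiset_prod, Multiset.map_map]
    simp
  have h3 : ε ^ n ≤ ‖p₀.eval z‖ := by
    rw [hp0, ← hn, ← card_roots_eq p₀]
    generalize p₀.roots = s at hcon
    induction s using Multiset.induction_on with
    | empty => simp
    | cons a s ih =>
      rw [Multiset.card_cons, Multiset.map_cons, Multiset.prod_cons, norm_mul, pow_succ']
      have h4 := hcon a (Multiset.mem_cons_self _ _)
      rw [dist_eq_norm] at h4
      have h5 := ih fun ρ hρ => hcon ρ (Multiset.mem_cons_of_mem hρ)
      gcongr
  have h4 : ‖p₀.eval z‖ ≤ ∑ i : Fin n, ‖c i - coeffs n p₀ i‖ * R ^ (i : ℕ) := by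
    have h5 : p₀.eval z = -∑ i : Fin n, (c i - coeffs n p₀ i) * z ^ (i : ℕ) := by
      have h6 := hev (coeffs n p₀)
      rw [ofCoeffs_coeffs h₀ hn] at h6
      have h7 := hev c
      rw [hz0] at h7
      simp only [sub_mul, Finset.sum_sub_distrib]
      rw [h6]
      linear_combination -h7
    rw [h5, norm_neg]
    refine (norm_sum_le _ _).trans (Finset.sum_le_sum fun i _ => ?_)
    rw [norm_mul, norm_pow]
    gcongr
  linarith

open scoped Classical in
/-- The factor of `p` formed by the roots for which `ρ` is a closest root of `p₀`. -/
def near (p₀ : ℂ[X]) (ρ : ℂ) (p : ℂ[X]) : ℂ[X] :=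
  ((p.roots.filter fun z => ∀ σ ∈ p₀.roots, dist z ρ ≤ dist z σ).map fun z => X - C z).prod

theorem factor_eq_near (P : ℝ → ℂ[X]) (ρ : ℂ) (t : ℝ) : factor P ρ t = near (P 0) ρ (P t) := rfl

theorem monic_near (p₀ : ℂ[X]) (ρ : ℂ) (p : ℂ[X]) : (near p₀ ρ p).Monic :=
  monic_multiset_prod_of_monic _ _ fun z _ => monic_X_sub_C z

open scoped Classical in
theorem roots_near (p₀ : ℂ[X]) (ρ : ℂ) (p : ℂ[X]) :
    (near p₀ ρ p).roots = p.roots.filter fun z => ∀ σ ∈ p₀.roots, dist z ρ ≤ dist z σ :=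
  roots_multiset_prod_X_sub_C _

theorem roots_near_le (p₀ : ℂ[X]) (ρ : ℂ) (p : ℂ[X]) : (near p₀ ρ p).roots ≤ p.roots := by
  rw [roots_near]; exact Multiset.filter_le _ _

/-- Distinct roots are `2ε` apart, so that each point is `ε`-close to one root at most. -/
theorem exists_gap (p₀ : ℂ[X]) :
    ∃ ε > 0, ∀ σ ∈ p₀.roots, ∀ τ ∈ p₀.roots, σ ≠ τ → 2 * ε ≤ dist σ τ := by
  have h : ∀ᶠ ε in 𝓝[>] (0 : ℝ), ∀ x ∈ p₀.roots.toFinset ×ˢ p₀.roots.toFinset, x.1 ≠ x.2 →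
      2 * ε ≤ dist x.1 x.2 := by
    rw [Finset.eventually_all]
    intro x _
    by_cases hx : x.1 = x.2
    · exact Eventually.of_forall fun _ h => absurd hx h
    · have h1 : Tendsto (fun ε : ℝ => 2 * ε) (𝓝[>] 0) (𝓝 (2 * 0)) :=
        ((continuous_const.mul continuous_id).tendsto 0).mono_left nhdsWithin_le_nhds
      rw [mul_zero] at h1
      exact (h1.eventually_le_const (dist_pos.2 hx)).mono fun _ h _ => h
  obtain ⟨ε, h1, h2⟩ := (h.and self_mem_nhdsWithin).exists
  exact ⟨ε, h2, fun σ hσ τ hτ => h1 (σ, τ) (Finset.mem_product.2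
    ⟨Multiset.mem_toFinset.2 hσ, Multiset.mem_toFinset.2 hτ⟩)⟩

/-- The coefficients of the factors `near p₀ ρ p` depend analytically on those of `p`. -/
theorem exists_near_eq {n : ℕ} {p₀ : ℂ[X]} (h₀ : p₀.Monic) (hn : p₀.natDegree = n) {ρ : ℂ}
    (hρ : ρ ∈ p₀.roots) :
    ∃ Ψ : (Fin n → ℂ) → Fin (p₀.rootMultiplicity ρ) → ℂ, AnalyticAt ℂ Ψ (coeffs n p₀) ∧
      ∀ᶠ c in 𝓝 (coeffs n p₀), near p₀ ρ (ofCoeffs n c) = ofCoeffs _ (Ψ c) := by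
  -- `p₀ = (X - ρ)^a q₂`; the two factors persist, with roots near `ρ`, and near the other roots of `p₀`
  have hne : p₀ ≠ 0 := h₀.ne_zero
  obtain ⟨q₂, hq, hdvd⟩ := exists_eq_pow_rootMultiplicity_mul_and_not_dvd p₀ hne ρ
  set a := p₀.rootMultiplicity ρ with ha
  have hm1 : ((X - C ρ) ^ a).Monic := (monic_X_sub_C ρ).pow a
  have hm2 : q₂.Monic := hm1.of_mul_monic_left (hq ▸ h₀)
  have hd1 : ((X - C ρ) ^ a).natDegree = a := by
    rw [(monic_X_sub_C ρ).natDegree_pow, natDegree_X_sub_C, mul_one]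
  have hcop : IsCoprime ((X - C ρ) ^ a) q₂ :=
    IsCoprime.pow_left ((irreducible_X_sub_C ρ).coprime_iff_not_dvd.2 hdvd)
  obtain ⟨b, hb⟩ : ∃ b, b = q₂.natDegree := ⟨_, rfl⟩
  have hab : a + b = n := by
    rw [← hn]; conv_rhs => rw [hq]
    rw [hm1.natDegree_mul hm2, hd1, hb]
  subst hab
  obtain ⟨Ψ₁, Ψ₂, hA1, hA2, hv1, hv2, hev⟩ := exists_analytic_factorization hm1 hm2 hd1 hb.symm hcop
  rw [← hq] at hA1 hA2 hv1 hv2 hev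
  refine ⟨Ψ₁, hA1, ?_⟩
  obtain ⟨ε, hε, hgap⟩ := exists_gap p₀
  have hr1 : ∀ᶠ c in 𝓝 (coeffs (a + b) p₀), ∀ z ∈ (ofCoeffs a (Ψ₁ c)).roots, dist z ρ < ε := by
    have := hA1.continuousAt.tendsto
    rw [hv1] at this
    filter_upwards [this.eventually (eventually_roots_near hm1 hd1 hε)] with c hc z hz
    obtain ⟨σ, hσ, hd⟩ := hc z hz
    have : σ = ρ := by
      have h1 := (mem_roots'.1 hσ).2
      simp only [IsRoot.def, eval_pow, eval_sub, eval_X, eval_C] at h1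
      exact sub_eq_zero.1 (eq_zero_of_pow_eq_zero h1)
    rwa [← this]
  have hr2 : ∀ᶠ c in 𝓝 (coeffs (a + b) p₀), ∀ z ∈ (ofCoeffs b (Ψ₂ c)).roots,
      ∃ σ ∈ p₀.roots, σ ≠ ρ ∧ dist z σ < ε := by
    have := hA2.continuousAt.tendsto
    rw [hv2] at this
    filter_upwards [this.eventually (eventually_roots_near hm2 hb.symm hε)] with c hc z hz
    obtain ⟨σ, hσ, hd⟩ := hc z hz
    refine ⟨σ, ?_, ?_, hd⟩
    · rw [hq, roots_mul (hq ▸ hne)]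
      exact Multiset.mem_add.2 (Or.inr hσ)
    · rintro rfl
      exact hdvd (dvd_iff_isRoot.2 (mem_roots'.1 hσ).2)
  filter_upwards [hr1, hr2, hev] with c h1 h2 h3
  rw [near, h3, roots_mul (mul_ne_zero monic_ofCoeffs.ne_zero monic_ofCoeffs.ne_zero),
    Multiset.filter_add, Multiset.filter_eq_self.2, Multiset.filter_eq_nil.2, add_zero,
    prod_roots monic_ofCoeffs]
  · intro z hz hall
    obtain ⟨σ, hσ, hne, hd⟩ := h2 z hz
    have h4 := hall σ hσ
    have h5 := hgap σ hσ ρ hρ hne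
    have h6 := dist_triangle_left σ ρ z
    linarith
  · intro z hz σ hσ
    by_cases hne : σ = ρ
    · rw [hne]
    · have h4 := h1 z hz
      have h5 := hgap σ hσ ρ hρ hne
      have h6 := dist_triangle_left σ ρ z
      linarith

/-- Each root of `p` near `p₀` has a unique closest root of `p₀`, so that it belongs to exactly one factor. -/
theorem eventually_prod_near {n : ℕ} {p₀ : ℂ[X]} (h₀ : p₀.Monic) (hn : p₀.natDegree = n) :
    ∀ᶠ c in 𝓝 (coeffs n p₀), ∏ ρ ∈ p₀.roots.toFinset, near p₀ ρ (ofCoeffs n c) = ofCoeffs n c := by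
  classical
  obtain ⟨ε, hε, hgap⟩ := exists_gap p₀
  filter_upwards [eventually_roots_near h₀ hn hε] with c hc
  have hsum : ∑ ρ ∈ p₀.roots.toFinset, (near p₀ ρ (ofCoeffs n c)).roots = (ofCoeffs n c).roots := by
    ext z
    rw [Multiset.count_sum']
    by_cases hz : z ∈ (ofCoeffs n c).roots
    · obtain ⟨ρ, hρ, hd⟩ := hc z hz
      rw [Finset.sum_eq_single ρ]
      · rw [roots_near, Multiset.count_filter, if_pos]
        intro σ hσ
        by_cases hne : σ = ρ
        · rw [hne]
        · have h5 := hgap σ hσ ρ hρ hne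
          have h6 := dist_triangle_left σ ρ z
          linarith
      · intro σ hσ hne
        rw [roots_near, Multiset.count_filter, if_neg]
        intro hall
        have h4 := hall ρ hρ
        have h5 := hgap σ (Multiset.mem_toFinset.1 hσ) ρ hρ hne
        have h6 := dist_triangle_left σ ρ z
        linarith
      · exact fun h => absurd (Multiset.mem_toFinset.2 hρ) h
    · rw [Multiset.count_eq_zero_of_notMem hz]
      exact Finset.sum_eq_zero fun ρ _ => Multiset.count_eq_zero_of_notMem fun h =>
        hz (Multiset.mem_of_le (roots_near_le _ _ _) h)
  conv_rhs => rw [← prod_roots (monic_ofCoeffs (n := n) (c := c)), ← hsum]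
  rw [← Multiset.coe_mapAddMonoidHom, map_sum]
  rw [Finset.prod_congr rfl fun ρ _ => (prod_roots (monic_near p₀ ρ (ofCoeffs n c))).symm]
  induction p₀.roots.toFinset using Finset.induction_on with
  | empty => simp
  | insert a s ha ih => rw [Finset.prod_insert ha, Finset.sum_insert ha, Multiset.prod_add, ih]; rfl

/-! ### Germs -/

/-- The germ version of `WReg`: `f` is continuous and `t ↦ t^e f(t)` is `C^D` on some neighbourhood of `0`. -/
def WGerm {E : Type} [NormedAddCommGroup E] [NormedSpace ℝ E] (D : ℕ∞) (e : ℕ) (f : ℝ → E) : Prop :=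
  ∃ δ > 0, WReg δ D e f

theorem eventually_iff_Ioo {p : ℝ → Prop} :
    (∀ᶠ t in 𝓝 (0 : ℝ), p t) ↔ ∃ δ > 0, ∀ t ∈ Set.Ioo (-δ) δ, p t := by
  rw [Metric.eventually_nhds_iff_ball]
  simp only [Real.ball_eq_Ioo, zero_sub, zero_add]

namespace WGerm

variable {E : Type} [NormedAddCommGroup E] [NormedSpace ℝ E] {D : ℕ∞} {e : ℕ}
  {f g : ℝ → E}

theorem congr (hf : WGerm D e f) (h : g =ᶠ[𝓝 0] f) : WGerm D e g := by
  obtain ⟨δ, hδ, hf⟩ := hf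
  obtain ⟨δ', hδ', h⟩ := eventually_iff_Ioo.1 h
  refine ⟨min δ δ', lt_min hδ hδ', (hf.mono_ball (min_le_left _ _)).congr fun t ht => h t ?_⟩
  exact ⟨by linarith [ht.1, min_le_right δ δ'], ht.2.trans_le (min_le_right _ _)⟩

theorem exists_common (hf : WGerm D e f) {D' : ℕ∞} {e' : ℕ} {F : Type} [NormedAddCommGroup F]
    [NormedSpace ℝ F] {g : ℝ → F} (hg : WGerm D' e' g) :
    ∃ δ > 0, WReg δ D e f ∧ WReg δ D' e' g := by
  obtain ⟨δ, hδ, hf⟩ := hf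
  obtain ⟨δ', hδ', hg⟩ := hg
  exact ⟨min δ δ', lt_min hδ hδ', hf.mono_ball (min_le_left _ _), hg.mono_ball (min_le_right _ _)⟩

theorem mono_weight {e' : ℕ} (h : e ≤ e') (hf : WGerm D e f) : WGerm D e' f :=
  hf.imp fun _ hδ => ⟨hδ.1, hδ.2.mono_weight h⟩

theorem pow_smul {r e' : ℕ} (he : e ≤ e' + r) (hf : WGerm D e f) :
    WGerm D e' fun t => t ^ r • f t :=
  hf.imp fun _ hδ => ⟨hδ.1, hδ.2.pow_smul he⟩

theorem pow_mul {f : ℝ → ℂ} {r e' : ℕ} (he : e ≤ e' + r) (hf : WGerm D e f) :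
    WGerm D e' fun t => (t : ℂ) ^ r * f t := by
  simpa using hf.pow_smul he

theorem eventually_continuousAt (hf : WGerm D e f) : ∀ᶠ t in 𝓝 0, ContinuousAt f t := by
  obtain ⟨δ, hδ, hf⟩ := hf
  exact eventually_iff_Ioo.2 ⟨δ, hδ, fun t ht => hf.1.continuousAt (isOpen_Ioo.mem_nhds ht)⟩

theorem zero_zero_iff : WGerm 0 0 f ↔ ∀ᶠ t in 𝓝 0, ContinuousAt f t := by
  refine ⟨eventually_continuousAt, fun h => ?_⟩
  obtain ⟨δ, hδ, h⟩ := eventually_iff_Ioo.1 h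
  have hc : ContinuousOn f (Set.Ioo (-δ) δ) := fun t ht => (h t ht).continuousWithinAt
  exact ⟨δ, hδ, hc, by simpa using hc⟩

theorem zero_zero (hf : WGerm D e f) : WGerm 0 0 f := zero_zero_iff.2 hf.eventually_continuousAt

theorem continuousAt (hf : WGerm D e f) : ContinuousAt f 0 := hf.eventually_continuousAt.self_of_nhds

theorem of_pow_smul {r : ℕ} (hc : ∀ᶠ t in 𝓝 0, ContinuousAt f t)
    (hf : WGerm D e fun t => t ^ r • f t) : WGerm D (e + r) f := by
  obtain ⟨δ, hδ, h1, h2⟩ := (zero_zero_iff.2 hc).exists_common hf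
  exact ⟨δ, hδ, .of_pow_smul h1.1 h2⟩

theorem of_pow_mul {f : ℝ → ℂ} {r : ℕ} (hc : ∀ᶠ t in 𝓝 0, ContinuousAt f t)
    (hf : WGerm D e fun t => (t : ℂ) ^ r * f t) : WGerm D (e + r) f :=
  of_pow_smul hc (by simpa using hf)

theorem add (hf : WGerm D e f) (hg : WGerm D e g) : WGerm D e fun t => f t + g t := by
  obtain ⟨δ, hδ, h1, h2⟩ := hf.exists_common hg
  exact ⟨δ, hδ, h1.add h2⟩

theorem mul {f g : ℝ → ℂ} (he : (e : ℕ∞) ≤ D) (hf : WGerm D e f) (hg : WGerm D e g) :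
    WGerm D e fun t => f t * g t := by
  obtain ⟨δ, hδ, h1, h2⟩ := hf.exists_common hg
  exact ⟨δ, hδ, h1.mul he h2⟩

theorem const (c : E) : WGerm D e fun _ => c := ⟨1, one_pos, .const c⟩

theorem pow {f : ℝ → ℂ} (he : (e : ℕ∞) ≤ D) (hf : WGerm D e f) (k : ℕ) : WGerm D e fun t => f t ^ k :=
  hf.imp fun _ hδ => ⟨hδ.1, hδ.2.pow he k⟩

theorem sum {ι : Type} (s : Finset ι) {f : ι → ℝ → E} (h : ∀ i ∈ s, WGerm D e (f i)) :
    WGerm D e fun t => ∑ i ∈ s, f i t := by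
  classical
  induction s using Finset.induction_on with
  | empty => simpa using const 0
  | insert a s ha ih =>
    simp only [Finset.sum_insert ha]
    exact (h a (Finset.mem_insert_self _ _)).add (ih fun i hi => h i (Finset.mem_insert_of_mem hi))

theorem const_mul {f : ℝ → ℂ} (he : (e : ℕ∞) ≤ D) (c : ℂ) (hf : WGerm D e f) :
    WGerm D e fun t => c * f t := (const c).mul he hf

theorem neg {f : ℝ → ℂ} (he : (e : ℕ∞) ≤ D) (hf : WGerm D e f) : WGerm D e fun t => - f t := by
  simpa using hf.const_mul he (-1)

theorem pi {ι : Type} [Fintype ι] {f : ℝ → ι → ℂ} (h : ∀ i, WGerm D e fun t => f t i) :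
    WGerm D e f := by
  choose δ hδ h using h
  obtain ⟨ε, hε, hle⟩ : ∃ ε > 0, ∀ i, ε ≤ δ i := by
    have h1 : ∀ᶠ ε in 𝓝[>] (0 : ℝ), ∀ i, ε ≤ δ i := by
      rw [eventually_all]
      exact fun i => nhdsWithin_le_nhds (eventually_le_nhds (hδ i))
    obtain ⟨ε, h1, h2⟩ := (h1.and self_mem_nhdsWithin).exists
    exact ⟨ε, h2, h1⟩
  exact ⟨ε, hε, WReg.pi.2 fun i => (h i).mono_ball (hle i)⟩

theorem comp_analytic {F : Type} [NormedAddCommGroup F] [NormedSpace ℝ F] [NormedSpace ℂ F]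
    [IsScalarTower ℝ ℂ F] [CompleteSpace F] {ι : Type} [Fintype ι] (he : (e : ℕ∞) ≤ D)
    {f : ℝ → ι → ℂ} {Φ : (ι → ℂ) → F} (hΦ : AnalyticAt ℂ Φ (f 0)) (hf : ∀ i, WGerm D e fun t => f t i) :
    WGerm D e fun t => Φ (f t) := by
  obtain ⟨Ω, hΩs, hΩo, hΩ0⟩ := eventually_nhds_iff.1 hΦ.eventually_analyticAt
  have hcd : ContDiffOn ℝ (⊤ : ℕ∞) Φ Ω := by
    have : ContDiffOn ℂ (⊤ : ℕ∞) Φ Ω := fun x hx => ((hΩs x hx).contDiffAt).contDiffWithinAt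
    exact this.restrict_scalars ℝ
  obtain ⟨δ, hδ, h⟩ := pi hf
  have h0 : (0 : ℝ) ∈ Set.Ioo (-δ) δ := ⟨by linarith, hδ⟩
  have hc := (h.1.continuousAt (isOpen_Ioo.mem_nhds h0)).eventually (hΩo.mem_nhds hΩ0)
  obtain ⟨δ', hδ', h'⟩ := eventually_iff_Ioo.1 hc
  refine ⟨min δ δ', lt_min hδ hδ', (h.mono_ball (min_le_left _ _)).comp_smooth he hΩo hcd
    fun t ht => h' t ?_⟩
  exact ⟨by linarith [ht.1, min_le_right δ δ'], ht.2.trans_le (min_le_right _ _)⟩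

theorem tendsto_power (ε : ℝ) {N : ℕ} (hN : N ≠ 0) :
    Tendsto (fun s : ℝ => ε * s ^ N) (𝓝 0) (𝓝 0) := by
  have : Continuous fun s : ℝ => ε * s ^ N := by fun_prop
  simpa [hN] using this.tendsto 0

theorem comp_power [CompleteSpace E] {ε : ℝ} {N : ℕ} (he : (e : ℕ∞) ≤ D) (hN : N ≠ 0) (hε : ε ≠ 0)
    (hf : WGerm D e f) : WGerm D e fun s => f (ε * s ^ N) := by
  obtain ⟨δ, hδ, h⟩ := hf
  have h1 := (tendsto_power ε hN).eventually (isOpen_Ioo.mem_nhds (⟨by linarith, hδ⟩ : (0 : ℝ) ∈ Set.Ioo (-δ) δ))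
  obtain ⟨δ', hδ', h'⟩ := eventually_iff_Ioo.1 h1
  exact ⟨δ', hδ', h.comp_power he hN hε h'⟩

end WGerm

/-! ### Multiplicities -/

section mult
variable {f g : ℝ → ℂ} {j k : ℕ}

theorem DivisibleBy.congr (h : DivisibleBy f k) (hfg : g =ᶠ[𝓝 0] f) : DivisibleBy g k := by
  obtain ⟨u, hu, hf⟩ := h
  exact ⟨u, hu, by filter_upwards [hfg, hf] with t h1 h2 using h1.trans h2⟩

theorem DivisibleBy.mono (hjk : j ≤ k) (h : DivisibleBy f k) : DivisibleBy f j := by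
  obtain ⟨u, hu, hf⟩ := h
  refine ⟨fun t => (t : ℂ) ^ (k - j) * u t, hu.mono fun t ht => by fun_prop, hf.mono fun t ht => ?_⟩
  rw [ht, ← mul_assoc, ← pow_add, Nat.add_sub_cancel' hjk]

theorem le_mult (h : DivisibleBy f k) : (k : ℕ∞) ≤ mult f :=
  le_iSup₂ (f := fun (k : ℕ) (_ : DivisibleBy f k) => (k : ℕ∞)) k h

theorem divisibleBy_zero (hf : ∀ᶠ t in 𝓝 0, ContinuousAt f t) : DivisibleBy f 0 :=
  ⟨f, hf, Eventually.of_forall fun t => by simp⟩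

theorem divisibleBy_of_le_mult (hf : ∀ᶠ t in 𝓝 0, ContinuousAt f t) (h : (k : ℕ∞) ≤ mult f) :
    DivisibleBy f k := by
  rcases k with _ | k
  · exact divisibleBy_zero hf
  · by_contra hcon
    have : mult f ≤ k := by
      refine iSup₂_le fun i hi => ?_
      by_contra hik
      have hki : k + 1 ≤ i := by
        have : (k : ℕ∞) < i := not_le.1 hik
        exact_mod_cast this
      exact hcon (hi.mono hki)
    have h2 := h.trans this
    norm_cast at h2
    omega

theorem divPow_eventuallyEq {u : ℝ → ℂ} (hu : ContinuousAt u 0)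
    (hf : ∀ᶠ t in 𝓝 (0 : ℝ), f t = (t : ℂ) ^ k * u t) : divPow f k =ᶠ[𝓝 0] u := by
  have h1 : ∀ᶠ t in 𝓝[≠] (0 : ℝ), f t / (t : ℂ) ^ k = u t := by
    filter_upwards [nhdsWithin_le_nhds hf, self_mem_nhdsWithin] with t h1 h2
    have h2' : (t : ℂ) ≠ 0 := by exact_mod_cast h2
    rw [h1, mul_div_cancel_left₀ _ (pow_ne_zero _ h2')]
  have h2 : limUnder (𝓝[≠] (0 : ℝ)) (fun t => f t / (t : ℂ) ^ k) = u 0 := by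
    refine Tendsto.limUnder_eq ((hu.tendsto.mono_left nhdsWithin_le_nhds).congr' ?_)
    exact h1.mono fun t ht => ht.symm
  have h3 : ∀ᶠ t in 𝓝 (0 : ℝ), t ≠ 0 → f t / (t : ℂ) ^ k = u t := by
    simpa using eventually_nhdsWithin_iff.1 h1
  filter_upwards [h3] with t ht
  unfold divPow
  by_cases h0 : t = 0
  · subst h0
    rw [Function.update_self, h2]
  · rw [Function.update_of_ne h0, ht h0]

theorem DivisibleBy.divPow_spec (h : DivisibleBy f k) :
    (∀ᶠ t in 𝓝 0, ContinuousAt (divPow f k) t) ∧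
      ∀ᶠ t in 𝓝 (0 : ℝ), f t = (t : ℂ) ^ k * divPow f k t := by
  obtain ⟨u, hu, hf⟩ := h
  have := divPow_eventuallyEq hu.self_of_nhds hf
  refine ⟨?_, ?_⟩
  · filter_upwards [hu, this.eventuallyEq_nhds] with t h1 h2 using h1.congr h2.symm
  · filter_upwards [hf, this] with t h1 h2
    rw [h2, h1]

theorem divPow_congr (hfg : g =ᶠ[𝓝 0] f) : divPow g k =ᶠ[𝓝 0] divPow f k := by
  have h2 : limUnder (𝓝[≠] (0 : ℝ)) (fun t => g t / (t : ℂ) ^ k) =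
      limUnder (𝓝[≠] (0 : ℝ)) (fun t => f t / (t : ℂ) ^ k) := by
    unfold limUnder
    congr 1
    refine Filter.map_congr ?_
    filter_upwards [nhdsWithin_le_nhds hfg] with t ht
    rw [ht]
  filter_upwards [hfg] with t ht
  unfold divPow
  by_cases h0 : t = 0
  · subst h0
    rw [Function.update_self, Function.update_self, h2]
  · rw [Function.update_of_ne h0, Function.update_of_ne h0, ht]

/-- A nonvanishing cofactor determines the multiplicity. -/
theorem mult_eq_of_ne_zero {u : ℝ → ℂ} (hu : ∀ᶠ t in 𝓝 0, ContinuousAt u t)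
    (hf : ∀ᶠ t in 𝓝 (0 : ℝ), f t = (t : ℂ) ^ k * u t) (h0 : u 0 ≠ 0) : mult f = k := by
  refine le_antisymm (iSup₂_le fun i hi => ?_) (le_mult ⟨u, hu, hf⟩)
  by_contra hik
  have hki : k + 1 ≤ i := by
    have : (k : ℕ∞) < i := not_le.1 hik
    exact_mod_cast this
  obtain ⟨v, hv, hfv⟩ := hi.mono hki
  have h1 : ∀ᶠ t : ℝ in 𝓝[≠] 0, (t : ℂ) * v t = u t := by
    filter_upwards [nhdsWithin_le_nhds hf, nhdsWithin_le_nhds hfv, self_mem_nhdsWithin] with t h1 h2 h3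
    have h3' : (t : ℂ) ≠ 0 := by exact_mod_cast h3
    refine mul_left_cancel₀ (pow_ne_zero k h3') ?_
    rw [← h1, h2, pow_succ, mul_assoc]
  have h2 : Tendsto (fun t : ℝ => (t : ℂ) * v t) (𝓝[≠] 0) (𝓝 (((0 : ℝ) : ℂ) * v 0)) :=
    ((Complex.continuous_ofReal.continuousAt).mul hv.self_of_nhds).tendsto.mono_left nhdsWithin_le_nhds
  have h3 := tendsto_nhds_unique (h2.congr' h1)
    (hu.self_of_nhds.tendsto.mono_left nhdsWithin_le_nhds)
  simp at h3
  exact h0 h3.symm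

end mult

/-- All coefficients of the germ at `0` of `P` are of class `WGerm D e`. -/
def CoefReg (D : ℕ∞) (e : ℕ) (P : ℝ → ℂ[X]) : Prop :=
  ∀ k : ℕ, WGerm D e fun t => (P t).coeff k

/-- The germ at `0` of a continuous curve of monic polynomials of degree `n`. -/
structure IsGerm (n : ℕ) (P : ℝ → ℂ[X]) : Prop where
  monic : ∀ᶠ t in 𝓝 (0 : ℝ), (P t).Monic ∧ (P t).natDegree = n
  cont : CoefReg 0 0 P

namespace CoefReg
variable {D : ℕ∞} {e n : ℕ} {P Q : ℝ → ℂ[X]}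

theorem congr (h : CoefReg D e P) (hPQ : Q =ᶠ[𝓝 0] P) : CoefReg D e Q := fun k =>
  (h k).congr (hPQ.mono fun t ht => by simp only [ht])

theorem zero_zero (h : CoefReg D e P) : CoefReg 0 0 P := fun k => (h k).zero_zero

theorem of_lt (hm : ∀ᶠ t in 𝓝 (0 : ℝ), (P t).Monic ∧ (P t).natDegree = n)
    (h : ∀ k < n, WGerm D e fun t => (P t).coeff k) : CoefReg D e P := by
  intro k
  rcases lt_trichotomy k n with hk | hk | hk
  · exact h k hk
  · refine (WGerm.const (1 : ℂ)).congr (hm.mono fun t ht => ?_)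
    show (P t).coeff k = 1
    rw [hk, ← ht.2]
    exact ht.1.coeff_natDegree
  · refine (WGerm.const (0 : ℂ)).congr (hm.mono fun t ht => ?_)
    exact coeff_eq_zero_of_natDegree_lt (by omega)

end CoefReg

namespace IsGerm
variable {D : ℕ∞} {e n : ℕ} {P Q : ℝ → ℂ[X]}

theorem congr (h : IsGerm n P) (hPQ : Q =ᶠ[𝓝 0] P) : IsGerm n Q :=
  ⟨by filter_upwards [h.monic, hPQ] with t h1 h2 using h2 ▸ h1, h.cont.congr hPQ⟩

theorem monic_zero (h : IsGerm n P) : (P 0).Monic := h.monic.self_of_nhds.1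

theorem natDegree_zero (h : IsGerm n P) : (P 0).natDegree = n := h.monic.self_of_nhds.2

theorem eventually_ofCoeffs (h : IsGerm n P) :
    ∀ᶠ t in 𝓝 (0 : ℝ), ofCoeffs n (coeffs n (P t)) = P t :=
  h.monic.mono fun _ ht => ofCoeffs_coeffs ht.1 ht.2

theorem tendsto (h : IsGerm n P) : Tendsto (fun t => coeffs n (P t)) (𝓝 0) (𝓝 (coeffs n (P 0))) :=
  tendsto_pi_nhds.2 fun i => (h.cont i).continuousAt

theorem eventually (h : IsGerm n P) {p : ℂ[X] → Prop}
    (hp : ∀ᶠ c in 𝓝 (coeffs n (P 0)), p (ofCoeffs n c)) : ∀ᶠ t in 𝓝 (0 : ℝ), p (P t) := by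
  filter_upwards [h.tendsto.eventually hp, h.eventually_ofCoeffs] with t h1 h2 using h2 ▸ h1

theorem eventually_continuousAt (h : IsGerm n P) (k : ℕ) :
    ∀ᶠ t in 𝓝 0, ContinuousAt (fun t => (P t).coeff k) t := (h.cont k).eventually_continuousAt

theorem coeff_continuousAt (h : IsGerm n P) (k : ℕ) : ContinuousAt (fun t => (P t).coeff k) 0 :=
  (h.cont k).continuousAt

theorem eventually_prod_factor (h : IsGerm n P) :
    ∀ᶠ t in 𝓝 (0 : ℝ), ∏ ρ ∈ (P 0).roots.toFinset, factor P ρ t = P t :=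
  h.eventually (p := fun p => ∏ ρ ∈ (P 0).roots.toFinset, near (P 0) ρ p = p)
    (eventually_prod_near h.monic_zero h.natDegree_zero)

theorem factor_aux (h : IsGerm n P) {ρ : ℂ} (hρ : ρ ∈ (P 0).roots) :
    (∀ᶠ t in 𝓝 (0 : ℝ), (factor P ρ t).Monic ∧
      (factor P ρ t).natDegree = (P 0).rootMultiplicity ρ) ∧
    ∀ {D : ℕ∞} {e : ℕ}, (e : ℕ∞) ≤ D → CoefReg D e P → CoefReg D e (factor P ρ) := by
  obtain ⟨Ψ, hΨ, hev⟩ := exists_near_eq h.monic_zero h.natDegree_zero hρ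
  have heq : ∀ᶠ t in 𝓝 (0 : ℝ), factor P ρ t = ofCoeffs _ (Ψ (coeffs n (P t))) := by
    filter_upwards [h.tendsto.eventually hev, h.eventually_ofCoeffs] with t h1 h2
    rw [factor_eq_near, ← h1, h2]
  have hm : ∀ᶠ t in 𝓝 (0 : ℝ), (factor P ρ t).Monic ∧
      (factor P ρ t).natDegree = (P 0).rootMultiplicity ρ := by
    filter_upwards [heq] with t ht
    rw [ht]
    exact ⟨monic_ofCoeffs, natDegree_ofCoeffs⟩
  refine ⟨hm, fun {D e} he hP => .of_lt hm fun k hk => ?_⟩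
  have hΨk : AnalyticAt ℂ (fun c => Ψ c ⟨k, hk⟩) (coeffs n (P 0)) :=
    ((ContinuousLinearMap.proj (R := ℂ) (φ := fun _ => ℂ)
      (⟨k, hk⟩ : Fin ((P 0).rootMultiplicity ρ))).analyticAt _).comp hΨ
  refine (WGerm.comp_analytic he (f := fun t => coeffs n (P t)) hΨk fun i => hP i).congr ?_
  filter_upwards [heq] with t ht
  rw [ht, coeff_ofCoeffs, dif_pos hk]

theorem factor (h : IsGerm n P) {ρ : ℂ} (hρ : ρ ∈ (P 0).roots) :
    IsGerm ((P 0).rootMultiplicity ρ) (factor P ρ) :=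
  ⟨(h.factor_aux hρ).1, (h.factor_aux hρ).2 le_rfl h.cont⟩

theorem coefReg_factor (h : IsGerm n P) {ρ : ℂ} (hρ : ρ ∈ (P 0).roots) (he : (e : ℕ∞) ≤ D)
    (hP : CoefReg D e P) : CoefReg D e (RootCurve.factor P ρ) := (h.factor_aux hρ).2 he hP

theorem factor_zero_natDegree (h : IsGerm n P) {ρ : ℂ} (hρ : ρ ∈ (P 0).roots) :
    (RootCurve.factor P ρ 0).natDegree = (P 0).rootMultiplicity ρ := (h.factor hρ).natDegree_zero

end IsGerm

theorem rootMultiplicity_pos_of_mem {n : ℕ} {P : ℝ → ℂ[X]} (h : IsGerm n P) {ρ : ℂ} (hρ : ρ ∈ (P 0).roots) :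
    0 < (P 0).rootMultiplicity ρ :=
  (rootMultiplicity_pos h.monic_zero.ne_zero).2 (mem_roots'.1 hρ).2

/-! ### Centering -/

theorem coeff_comp_X_sub_C (p : ℂ[X]) (c : ℂ) (n : ℕ) (hp : p.natDegree ≤ n) (k : ℕ) :
    (p.comp (X - C c)).coeff k =
      ∑ i ∈ Finset.range (n + 1), p.coeff i * ((-c) ^ (i - k) * (i.choose k : ℂ)) := by
  rw [comp_eq_sum_left, sum_over_range' p (by simp) (n + 1) (by omega), finsetSum_coeff]
  refine Finset.sum_congr rfl fun i _ => ?_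
  rw [coeff_C_mul, sub_eq_add_neg, ← C_neg, coeff_X_add_C_pow]

theorem natDegree_comp_X_sub_C (p : ℂ[X]) (c : ℂ) : (p.comp (X - C c)).natDegree = p.natDegree := by
  rw [natDegree_comp, natDegree_X_sub_C, mul_one]

theorem monic_comp_X_sub_C {p : ℂ[X]} (hp : p.Monic) (c : ℂ) : (p.comp (X - C c)).Monic :=
  hp.comp (monic_X_sub_C c) (by rw [natDegree_X_sub_C]; exact one_ne_zero)

theorem roots_comp_X_sub_C {p : ℂ[X]} (hp : p.Monic) (c : ℂ) :
    (p.comp (X - C c)).roots = p.roots.map fun z => z + c := by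
  have h : p.comp (X - C c) = ((p.roots.map fun z => z + c).map fun z => X - C z).prod := by
    conv_lhs => rw [← prod_roots hp]
    rw [multiset_prod_comp, Multiset.map_map, Multiset.map_map]
    congr 1
    refine Multiset.map_congr rfl fun z _ => ?_
    simp only [Function.comp_apply, sub_comp, X_comp, C_comp, C_add]
    ring
  rw [h, roots_multiset_prod_X_sub_C]

/-- The translation `a₁ / n` used in centering, up to sign. -/
def shift (P : ℝ → ℂ[X]) (t : ℝ) : ℂ := (P t).nextCoeff / ((P t).natDegree : ℂ)

theorem center_eq (P : ℝ → ℂ[X]) (t : ℝ) : center P t = (P t).comp (X - C (shift P t)) := rfl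

section center
variable {D : ℕ∞} {e n : ℕ} {P : ℝ → ℂ[X]}

theorem IsGerm.shift_reg (h : IsGerm n P) (he : (e : ℕ∞) ≤ D) (hP : CoefReg D e P) :
    WGerm D e (shift P) := by
  rcases n with _ | n
  · refine (WGerm.const (0 : ℂ)).congr (h.monic.mono fun t ht => ?_)
    simp [shift, ht.2]
  · refine ((hP n).const_mul he ((n + 1 : ℕ) : ℂ)⁻¹).congr (h.monic.mono fun t ht => ?_)
    simp only [shift]
    rw [nextCoeff_of_natDegree_pos (by omega), ht.2, div_eq_inv_mul]
    simp

theorem IsGerm.coefReg_center (h : IsGerm n P) (he : (e : ℕ∞) ≤ D) (hP : CoefReg D e P) :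
    CoefReg D e (center P) := by
  intro k
  have := WGerm.sum (Finset.range (n + 1)) (f := fun i t =>
      (P t).coeff i * ((-shift P t) ^ (i - k) * (i.choose k : ℂ))) (D := D) (e := e) fun i _ =>
    (hP i).mul he ((((h.shift_reg he hP).neg he).pow he _).mul he (.const _))
  refine this.congr (h.monic.mono fun t ht => ?_)
  exact coeff_comp_X_sub_C _ _ n ht.2.le k

theorem IsGerm.center (h : IsGerm n P) : IsGerm n (center P) :=
  ⟨h.monic.mono fun _ ht => ⟨monic_comp_X_sub_C ht.1 _, (natDegree_comp_X_sub_C _ _).trans ht.2⟩,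
    h.coefReg_center le_rfl h.cont⟩

theorem IsGerm.roots_center (h : IsGerm n P) :
    ∀ᶠ t in 𝓝 (0 : ℝ), (RootCurve.center P t).roots = (P t).roots.map fun z => z + shift P t :=
  h.monic.mono fun _ ht => roots_comp_X_sub_C ht.1 _

theorem sum_roots_eq {p : ℂ[X]} (hp : p.Monic) : p.roots.sum = -p.nextCoeff := by
  have := (IsAlgClosed.splits p).nextCoeff_eq_neg_sum_roots_of_monic hp
  rw [this, neg_neg]

theorem IsGerm.center_coeff (h : IsGerm n P) (hn : 0 < n) :
    ∀ᶠ t in 𝓝 (0 : ℝ), (RootCurve.center P t).coeff (n - 1) = 0 := by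
  filter_upwards [h.monic, h.center.monic, h.roots_center] with t h1 h2 h3
  have h4 := sum_roots_eq h2.1
  rw [nextCoeff_of_natDegree_pos (by omega), h2.2, h3, Multiset.sum_map_add, Multiset.map_id',
    Multiset.map_const', Multiset.sum_replicate, card_roots_eq, h1.2, sum_roots_eq h1.1] at h4
  have hn' : (n : ℂ) ≠ 0 := by exact_mod_cast hn.ne'
  rw [shift, h1.2] at h4
  have h5 : -(P t).nextCoeff + n • ((P t).nextCoeff / (n : ℂ)) = 0 := by
    rw [nsmul_eq_mul]; field_simp; ring
  rw [h5] at h4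
  exact neg_eq_zero.1 h4.symm

theorem roots_eq_replicate_of_not_splits (h : ¬ Splits P) (z : ℂ) (hz : z ∈ (P 0).roots) :
    (P 0).roots = Multiset.replicate (P 0).natDegree z := by
  rw [Multiset.eq_replicate]
  refine ⟨card_roots_eq _, fun w hw => ?_⟩
  rw [Splits, not_lt, Finset.card_le_one] at h
  exact h w (Multiset.mem_toFinset.2 hw) z (Multiset.mem_toFinset.2 hz)

theorem IsGerm.center_zero (h : IsGerm n P) (hs : ¬ Splits P) (hn : 0 < n) :
    RootCurve.center P 0 = X ^ n := by
  have hcard : Multiset.card (P 0).roots = n := (card_roots_eq _).trans h.natDegree_zero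
  obtain ⟨z, hz⟩ := Multiset.card_pos_iff_exists_mem.1 (hcard ▸ hn)
  have hr := roots_eq_replicate_of_not_splits hs z hz
  rw [h.natDegree_zero] at hr
  have hc := h.roots_center.self_of_nhds
  have hsum := sum_roots_eq h.monic_zero
  rw [hr, Multiset.sum_replicate, nsmul_eq_mul] at hsum
  have hsh : z + shift P 0 = 0 := by
    have hn' : (n : ℂ) ≠ 0 := by exact_mod_cast hn.ne'
    rw [shift, h.natDegree_zero]
    field_simp
    linear_combination hsum
  rw [hr, Multiset.map_replicate, hsh] at hc
  rw [← prod_roots h.center.monic_zero, hc, Multiset.map_replicate, Multiset.prod_replicate]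
  simp

end center

/-! ### Slopes -/

section slope
variable {D : ℕ∞} {e n r : ℕ} {P Q S : ℝ → ℂ[X]} {m : ℚ}

theorem mult_of_slope_top (h : slope n P = ⊤) {k : ℕ} (hk : k ∈ Finset.Icc 1 n) :
    (mult fun t => (P t).coeff (n - k)) = ⊤ := by
  rw [slope, Finset.inf_eq_top_iff] at h
  have := h k hk
  revert this
  generalize (mult fun t => (P t).coeff (n - k)) = M
  intro h
  induction M with
  | top => rfl
  | coe j => exact absurd h (WithTop.coe_ne_top (a := (j : ℚ) / k))

theorem divisibleBy_of_slope_top (hP : IsGerm n P) (h : slope n P = ⊤) {i : ℕ} (hi : i < n) (j : ℕ) :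
    DivisibleBy (fun t => (P t).coeff i) j := by
  have h1 := mult_of_slope_top h (k := n - i) (Finset.mem_Icc.2 ⟨by omega, by omega⟩)
  rw [show n - (n - i) = i by omega] at h1
  exact divisibleBy_of_le_mult (hP.eventually_continuousAt i) (by rw [h1]; exact le_top)

theorem divisibleBy_of_slope (hP : IsGerm n P) (h : slope n P = (m : WithTop ℚ)) {k : ℕ}
    (hk : k ∈ Finset.Icc 1 n) :
    DivisibleBy (fun t => (P t).coeff (n - k)) ⌈(k : ℚ) * m⌉₊ := by
  have h1 : (m : WithTop ℚ) ≤ WithTop.map (fun j : ℕ => (j : ℚ) / (k : ℚ))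
      (mult fun t => (P t).coeff (n - k)) := by
    rw [← h, slope]; exact Finset.inf_le hk
  have hk0 : (0 : ℚ) < k := by
    have := (Finset.mem_Icc.1 hk).1
    exact_mod_cast this
  refine divisibleBy_of_le_mult (hP.eventually_continuousAt _) ?_
  generalize (mult fun t => (P t).coeff (n - k)) = M at h1
  induction M with
  | top => exact le_top
  | coe j =>
    have h2 : (m : WithTop ℚ) ≤ (((j : ℚ) / (k : ℚ) : ℚ) : WithTop ℚ) := h1
    rw [WithTop.coe_le_coe, le_div_iff₀ hk0] at h2
    have h3 : ⌈(k : ℚ) * m⌉₊ ≤ j := Nat.ceil_le.2 (by linarith)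
    exact_mod_cast h3

/-- The minimum defining a finite slope is attained. -/
theorem exists_mult_of_slope (hn : 0 < n) (h : slope n P = (m : WithTop ℚ)) :
    ∃ k ∈ Finset.Icc 1 n, ∃ j : ℕ, (j : ℚ) = k * m ∧
      (mult fun t => (P t).coeff (n - k)) = (j : ℕ∞) := by
  obtain ⟨k, hk, hk2⟩ := Finset.exists_mem_eq_inf (Finset.Icc 1 n) ⟨1, Finset.mem_Icc.2 ⟨le_rfl, hn⟩⟩
    (fun k => WithTop.map (fun j : ℕ => (j : ℚ) / (k : ℚ)) (mult fun t => (P t).coeff (n - k)))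
  rw [slope, hk2] at h
  refine ⟨k, hk, ?_⟩
  have hk0 : (k : ℚ) ≠ 0 := by
    have := (Finset.mem_Icc.1 hk).1
    exact_mod_cast (by omega : k ≠ 0)
  revert h
  generalize (mult fun t => (P t).coeff (n - k)) = M
  intro h
  induction M with
  | top => exact absurd (show (⊤ : WithTop ℚ) = m from h) WithTop.top_ne_coe
  | coe j =>
    have h2 : (((j : ℚ) / (k : ℚ) : ℚ) : WithTop ℚ) = (m : WithTop ℚ) := h
    rw [WithTop.coe_inj] at h2
    exact ⟨j, by rw [← h2]; field_simp, rfl⟩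

theorem slope_nonneg (hn : 0 < n) (h : slope n P = (m : WithTop ℚ)) : 0 ≤ m := by
  obtain ⟨k, hk, j, hj, -⟩ := exists_mult_of_slope hn h
  have hk0 : (0 : ℚ) < k := by
    have := (Finset.mem_Icc.1 hk).1
    exact_mod_cast this
  by_contra hm
  push Not at hm
  have : (k : ℚ) * m < 0 := mul_neg_of_pos_of_neg hk0 hm
  have h2 : (0 : ℚ) ≤ j := Nat.cast_nonneg j
  linarith

theorem slope_eq_of (h : ∀ k ∈ Finset.Icc 1 n, ∃ j : ℕ, DivisibleBy (fun t => (P t).coeff (n - k)) j ∧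
      (k : ℚ) * m ≤ j)
    (h' : ∃ k ∈ Finset.Icc 1 n, ∃ j : ℕ, (j : ℚ) = k * m ∧
      (mult fun t => (P t).coeff (n - k)) = (j : ℕ∞)) : slope n P = (m : WithTop ℚ) := by
  refine le_antisymm ?_ (Finset.le_inf fun k hk => ?_)
  · obtain ⟨k, hk, j, hj, hm⟩ := h'
    refine (Finset.inf_le hk).trans ?_
    rw [hm]
    have hk0 : (k : ℚ) ≠ 0 := by
      have := (Finset.mem_Icc.1 hk).1
      exact_mod_cast (by omega : k ≠ 0)
    show (((j : ℚ) / (k : ℚ) : ℚ) : WithTop ℚ) ≤ (m : WithTop ℚ)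
    rw [WithTop.coe_le_coe, hj, mul_div_cancel_left₀ _ hk0]
  · obtain ⟨j, hj, hjm⟩ := h k hk
    have hk0 : (0 : ℚ) < k := by
      have := (Finset.mem_Icc.1 hk).1
      exact_mod_cast this
    have h1 := le_mult hj
    generalize (mult fun t => (P t).coeff (n - k)) = M at h1
    induction M with
    | top => exact le_top
    | coe i =>
      show (m : WithTop ℚ) ≤ (((i : ℚ) / (k : ℚ) : ℚ) : WithTop ℚ)
      have h2 : j ≤ i := by exact_mod_cast h1
      have h3 : (j : ℚ) ≤ i := by exact_mod_cast h2
      rw [WithTop.coe_le_coe, le_div_iff₀ hk0]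
      linarith

/-- `S` is centered, `t^{(n-i)r}` divides its coefficient of index `i` for all `i < n`, and for some `i` the
quotient does not vanish at `0`. -/
structure HasSlope (n r : ℕ) (S : ℝ → ℂ[X]) : Prop where
  germ : IsGerm n S
  next : ∀ᶠ t in 𝓝 (0 : ℝ), (S t).coeff (n - 1) = 0
  div : ∀ i < n, DivisibleBy (fun t => (S t).coeff i) ((n - i) * r)
  strict : ∃ i < n, divPow (fun t => (S t).coeff i) ((n - i) * r) 0 ≠ 0

theorem coeff_divide (i : ℕ) (t : ℝ) : (divide n r S t).coeff i =
    if i < n then divPow (fun s => (S s).coeff i) ((n - i) * r) t else if i = n then 1 else 0 := by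
  rw [divide, coeff_add, coeff_X_pow, finsetSum_coeff]
  simp only [coeff_C_mul, coeff_X_pow, mul_ite, mul_one, mul_zero, Finset.sum_ite_eq,
    Finset.mem_range]
  split_ifs with h1 h2 <;> first | omega | simp

theorem divide_eq_ofCoeffs (t : ℝ) : divide n r S t =
    ofCoeffs n fun i => divPow (fun s => (S s).coeff i) ((n - i) * r) t := by
  ext i
  rw [coeff_divide, coeff_ofCoeffs]
  split_ifs <;> rfl

theorem monic_divide (t : ℝ) : (divide n r S t).Monic := by
  rw [divide_eq_ofCoeffs]; exact monic_ofCoeffs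

theorem natDegree_divide_eq (t : ℝ) : (divide n r S t).natDegree = n := by
  rw [divide_eq_ofCoeffs]; exact natDegree_ofCoeffs

theorem scaleRoots_multiset (s : Multiset ℂ) (c : ℂ) :
    ((s.map fun z => X - C z).prod).scaleRoots c = (s.map fun z => X - C (c * z)).prod := by
  induction s using Multiset.induction_on with
  | empty => simp
  | cons a s ih =>
    rw [Multiset.map_cons, Multiset.prod_cons, mul_scaleRoots_of_noZeroDivisors, ih,
      Multiset.map_cons, Multiset.prod_cons]
    congr 1
    ext i
    rw [coeff_scaleRoots, natDegree_X_sub_C]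
    rcases i with _ | _ | i
    · simp [mul_comm]
    · simp
    · rw [coeff_eq_zero_of_natDegree_lt (by rw [natDegree_X_sub_C]; omega),
        coeff_eq_zero_of_natDegree_lt (by rw [natDegree_X_sub_C]; omega), zero_mul]

theorem roots_of_coeff_scale {p q : ℂ[X]} (hp : p.Monic) (hq : q.Monic) (hpn : p.natDegree = n)
    (hqn : q.natDegree = n) {c : ℂ} (h : ∀ i < n, q.coeff i = c ^ (n - i) * p.coeff i) :
    q.roots = p.roots.map fun z => c * z := by
  have h1 : q = p.scaleRoots c := by
    ext i
    rw [coeff_scaleRoots, hpn]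
    rcases lt_trichotomy i n with hi | hi | hi
    · rw [h i hi, mul_comm]
    · subst hi
      have h1 := hp.coeff_natDegree
      have h2 := hq.coeff_natDegree
      rw [hpn] at h1
      rw [hqn] at h2
      simp [h1, h2]
    · rw [coeff_eq_zero_of_natDegree_lt (by omega), coeff_eq_zero_of_natDegree_lt (by omega), zero_mul]
  rw [h1]
  conv_lhs => rw [← prod_roots hp, scaleRoots_multiset]
  rw [show (p.roots.map fun z => X - C (c * z)) = (p.roots.map fun z => c * z).map fun z => X - C z by
    rw [Multiset.map_map]; rfl, roots_multiset_prod_X_sub_C]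

namespace HasSlope

theorem spec (h : HasSlope n r S) : ∀ᶠ t in 𝓝 (0 : ℝ), ∀ i < n,
    (S t).coeff i = ((t : ℂ) ^ r) ^ (n - i) * (divide n r S t).coeff i := by
  rw [show (∀ᶠ t in 𝓝 (0 : ℝ), ∀ i < n,
    (S t).coeff i = ((t : ℂ) ^ r) ^ (n - i) * (divide n r S t).coeff i) ↔
    (∀ᶠ t in 𝓝 (0 : ℝ), ∀ i ∈ Finset.range n,
    (S t).coeff i = ((t : ℂ) ^ r) ^ (n - i) * (divide n r S t).coeff i) by simp, Finset.eventually_all]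
  intro i hi
  have hi' := Finset.mem_range.1 hi
  filter_upwards [(h.div i hi').divPow_spec.2] with t ht
  rw [coeff_divide, if_pos hi', ← pow_mul, mul_comm r]
  exact ht

/-- The divisors `t^{(n-i)r}`, `i < n`, have exponent `n r` at most, so that the weight is raised by `n r`. -/
theorem coefReg_divide (h : HasSlope n r S) (hS : CoefReg D e S) :
    CoefReg D (e + n * r) (divide n r S) := by
  refine .of_lt (n := n) (Eventually.of_forall fun t => ⟨monic_divide t, natDegree_divide_eq t⟩)
    fun i hi => ?_
  have h1 := (h.div i hi).divPow_spec
  have h2 : WGerm D (e + (n - i) * r) (divPow (fun t => (S t).coeff i) ((n - i) * r)) := by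
    refine WGerm.of_pow_mul h1.1 ((hS i).congr ?_)
    filter_upwards [h1.2] with t ht
    exact ht.symm
  refine (h2.mono_weight ?_).congr (Eventually.of_forall fun t => ?_)
  · gcongr
    omega
  · simp only [coeff_divide, if_pos hi]

theorem germ_divide (h : HasSlope n r S) : IsGerm n (divide n r S) :=
  ⟨Eventually.of_forall fun t => ⟨monic_divide t, natDegree_divide_eq t⟩,
    (h.coefReg_divide h.germ.cont).zero_zero⟩

theorem roots (h : HasSlope n r S) : ∀ᶠ t in 𝓝 (0 : ℝ),
    (S t).roots = (divide n r S t).roots.map fun z => (t : ℂ) ^ r * z := by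
  filter_upwards [h.spec, h.germ.monic] with t h1 h2
  exact roots_of_coeff_scale (monic_divide t) h2.1 (natDegree_divide_eq t) h2.2 h1

theorem pos (h : HasSlope n r S) : 0 < n := by
  obtain ⟨i, hi, -⟩ := h.strict
  omega

theorem next_divide (h : HasSlope n r S) : (divide n r S 0).coeff (n - 1) = 0 := by
  have hn := h.pos
  rw [coeff_divide, if_pos (by omega)]
  exact (divPow_eventuallyEq (f := fun s => (S s).coeff (n - 1)) (u := fun _ => 0)
    continuousAt_const (h.next.mono fun t ht => by simp [ht])).self_of_nhds

/-- If all roots of `divide n r S 0` coincided, they would vanish, as their sum does; but not all lower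
coefficients vanish. -/
theorem splits_divide (h : HasSlope n r S) : Splits (divide n r S) := by
  have hn := h.pos
  by_contra hs
  set p := divide n r S 0 with hp
  have hm : p.Monic := monic_divide 0
  have hd : p.natDegree = n := natDegree_divide_eq 0
  have hcard : Multiset.card p.roots = n := (card_roots_eq _).trans hd
  obtain ⟨z, hz⟩ := Multiset.card_pos_iff_exists_mem.1 (hcard ▸ hn)
  have hr := roots_eq_replicate_of_not_splits hs z hz
  rw [← hp, hd] at hr
  have hsum := sum_roots_eq hm
  rw [hr, Multiset.sum_replicate, nsmul_eq_mul, nextCoeff_of_natDegree_pos (by omega), hd,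
    h.next_divide, neg_zero] at hsum
  have hn' : (n : ℂ) ≠ 0 := by exact_mod_cast hn.ne'
  have hz0 : z = 0 := (mul_eq_zero.1 hsum).resolve_left hn'
  have hpX : p = X ^ n := by
    rw [← prod_roots hm, hr, hz0, Multiset.map_replicate, Multiset.prod_replicate]
    simp
  obtain ⟨i, hi, hne⟩ := h.strict
  apply hne
  have : p.coeff i = 0 := by rw [hpX, coeff_X_pow, if_neg (by omega)]
  rwa [hp, coeff_divide, if_pos hi] at this

end HasSlope

/-- `Q` is a centered germ, all roots of `Q 0` are `0`, and its slope `m` is finite and attained by a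
coefficient whose quotient by `t^{km}` does not vanish at `0`.  This is the situation in which the
recursions divide by powers of the variable, possibly after ramification. -/
structure Newton (n : ℕ) (Q : ℝ → ℂ[X]) (m : ℚ) : Prop where
  germ : IsGerm n Q
  pos : 0 < n
  zero : Q 0 = X ^ n
  next : ∀ᶠ t in 𝓝 (0 : ℝ), (Q t).coeff (n - 1) = 0
  slope : slope n Q = (m : WithTop ℚ)
  strict : Strict n Q m

namespace Newton

theorem nonneg (h : Newton n Q m) : 0 ≤ m := slope_nonneg h.pos h.slope

theorem num_eq (h : Newton n Q m) : (m.num.toNat : ℚ) = m * m.den := by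
  rw [Rat.mul_den_eq_num]
  have : (0 : ℤ) ≤ m.num := Rat.num_nonneg.2 h.nonneg
  exact_mod_cast Int.toNat_of_nonneg this

theorem m_pos (h : Newton n Q m) : 0 < m := by
  refine lt_of_le_of_ne h.nonneg fun hm => ?_
  obtain ⟨k, hk, j, hj, hm', hne⟩ := h.strict
  rw [← hm, mul_zero] at hj
  have hj0 : j = 0 := by exact_mod_cast hj
  subst hj0
  apply hne
  have h1 : divPow (fun t => (Q t).coeff (n - k)) 0 0 = (Q 0).coeff (n - k) :=
    (divPow_eventuallyEq (h.germ.coeff_continuousAt _) (Eventually.of_forall fun t => by simp)).self_of_nhds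
  have hk' := Finset.mem_Icc.1 hk
  rw [h1, h.zero, coeff_X_pow, if_neg (by omega)]

theorem num_pos (h : Newton n Q m) : 0 < m.num.toNat := by
  have h1 := h.num_eq
  have h2 : (0 : ℚ) < m * m.den := mul_pos h.m_pos (by exact_mod_cast m.den_pos)
  rw [← h1] at h2
  exact_mod_cast h2

theorem isGerm_ramify {P : ℝ → ℂ[X]} (h : IsGerm n P) {ε : ℝ} {N : ℕ} (hN : N ≠ 0) (hε : ε ≠ 0) :
    IsGerm n (ramify ε N P) :=
  ⟨(WGerm.tendsto_power ε hN).eventually h.monic, fun k => (h.cont k).comp_power le_rfl hN hε⟩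

/-- With `N = m.den`, `r = m.num` and `j = ⌈(n-i) m⌉`, the coefficient of index `i` is `t^j u`; after the
substitution of `ε s^N` it is divisible by `s^{(n-i)r}`, as `(n-i) r ≤ N j`. -/
theorem ramify_div (h : Newton n Q m) {ε : ℝ} {i : ℕ} (hi : i < n) :
    ∃ u : ℝ → ℂ, (∀ᶠ t in 𝓝 0, ContinuousAt u t) ∧
      (∀ᶠ t in 𝓝 (0 : ℝ), (Q t).coeff i = (t : ℂ) ^ ⌈((n - i : ℕ) : ℚ) * m⌉₊ * u t) ∧
      (n - i) * m.num.toNat ≤ m.den * ⌈((n - i : ℕ) : ℚ) * m⌉₊ ∧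
      ∀ᶠ s in 𝓝 (0 : ℝ), (ramify ε m.den Q s).coeff i = (s : ℂ) ^ ((n - i) * m.num.toNat) *
        ((ε : ℂ) ^ ⌈((n - i : ℕ) : ℚ) * m⌉₊ *
          ((s : ℂ) ^ (m.den * ⌈((n - i : ℕ) : ℚ) * m⌉₊ - (n - i) * m.num.toNat) * u (ε * s ^ m.den))) := by
  obtain ⟨u, hu, hQ⟩ := divisibleBy_of_slope h.germ h.slope (k := n - i)
    (Finset.mem_Icc.2 ⟨by omega, by omega⟩)
  rw [show n - (n - i) = i by omega] at hQ
  have hle : (n - i) * m.num.toNat ≤ m.den * ⌈((n - i : ℕ) : ℚ) * m⌉₊ := by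
    have h1 : (((n - i) * m.num.toNat : ℕ) : ℚ) ≤ ((m.den * ⌈((n - i : ℕ) : ℚ) * m⌉₊ : ℕ) : ℚ) := by
      rw [Nat.cast_mul, Nat.cast_mul, h.num_eq]
      have h2 := Nat.le_ceil (((n - i : ℕ) : ℚ) * m)
      have h3 : (0 : ℚ) ≤ m.den := Nat.cast_nonneg _
      nlinarith
    exact_mod_cast h1
  refine ⟨u, hu, hQ, hle, ?_⟩
  filter_upwards [(WGerm.tendsto_power ε m.den_nz).eventually hQ] with s hs
  rw [ramify, hs]
  push_cast
  rw [mul_pow, ← pow_mul]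
  conv_lhs => rw [← Nat.sub_add_cancel hle, pow_add]
  ring

theorem hasSlope_ramify (h : Newton n Q m) {ε : ℝ} (hε : ε ≠ 0) :
    HasSlope n m.num.toNat (ramify ε m.den Q) where
  germ := isGerm_ramify h.germ m.den_nz hε
  next := (WGerm.tendsto_power ε m.den_nz).eventually h.next
  div i hi := by
    obtain ⟨u, hu, -, -, hS⟩ := h.ramify_div (ε := ε) hi
    refine ⟨_, ?_, hS⟩
    have hu0 := WGerm.zero_zero_iff.2 hu
    exact WGerm.eventually_continuousAt (D := 0) (e := 0)
      (((hu0.comp_power le_rfl m.den_nz hε).pow_mul (Nat.zero_le _)).const_mul le_rfl _)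
  strict := by
    obtain ⟨k, hk, j, hj, hm', hne⟩ := h.strict
    have hk' := Finset.mem_Icc.1 hk
    have hdiv : DivisibleBy (fun t => (Q t).coeff (n - k)) j :=
      divisibleBy_of_le_mult (h.germ.eventually_continuousAt _) hm'.ge
    refine ⟨n - k, by omega, ?_⟩
    have hjk : (n - (n - k)) * m.num.toNat = m.den * j := by
      have : ((k * m.num.toNat : ℕ) : ℚ) = ((m.den * j : ℕ) : ℚ) := by
        rw [Nat.cast_mul, Nat.cast_mul, h.num_eq, hj]; ring
      rw [show n - (n - k) = k by omega]
      exact_mod_cast this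
    obtain ⟨hc, hQ⟩ := hdiv.divPow_spec
    set u := divPow (fun t => (Q t).coeff (n - k)) j with hu
    have hc' := WGerm.eventually_continuousAt (D := 0) (e := 0)
      (((WGerm.zero_zero_iff.2 hc).comp_power le_rfl m.den_nz hε).const_mul le_rfl ((ε : ℂ) ^ j))
    have := divPow_eventuallyEq (f := fun s => (ramify ε m.den Q s).coeff (n - k))
      (k := (n - (n - k)) * m.num.toNat) hc'.self_of_nhds (by
      filter_upwards [(WGerm.tendsto_power ε m.den_nz).eventually hQ] with s hs
      rw [ramify, hs, hjk]
      push_cast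
      rw [mul_pow, ← pow_mul]
      ring)
    rw [this.self_of_nhds]
    refine mul_ne_zero (pow_ne_zero _ (by exact_mod_cast hε)) ?_
    simpa [m.den_nz] using hne

theorem ramify_one_one (P : ℝ → ℂ[X]) : ramify 1 1 P = P := by
  funext t; simp [ramify]

theorem hasSlope (h : Newton n Q m) (hd : m.den = 1) : HasSlope n m.num.toNat Q := by
  have := h.hasSlope_ramify one_ne_zero
  rwa [hd, ramify_one_one] at this

theorem coefReg_ramify {P : ℝ → ℂ[X]} (hP : CoefReg D e P) (he : (e : ℕ∞) ≤ D) {ε : ℝ} {N : ℕ}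
    (hN : N ≠ 0) (hε : ε ≠ 0) : CoefReg D e (ramify ε N P) :=
  fun k => (hP k).comp_power he hN hε

end Newton
end slope

/-! ### Unfolding the recursions -/

section unfold
variable {n : ℕ} {P : ℝ → ℂ[X]} {m : ℚ}

theorem germTree_of_splits (hP : IsGerm n P) (hs : Splits P) :
    germTree P = Tree.node n 0 P {ρ : ℂ // ρ ∈ (P 0).roots.toFinset} fun ρ => germTree (factor P ρ) := by
  rw [germTree, dif_pos hs, hP.natDegree_zero]

theorem germTree_of_le_one (hP : IsGerm n P) (hs : ¬ Splits P) (hn : n ≤ 1) :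
    germTree P = Tree.leaf n 0 P := by
  rw [germTree, dif_neg hs, if_pos (by rw [hP.natDegree_zero]; exact hn), hP.natDegree_zero]

theorem germTree_of_top (hP : IsGerm n P) (hs : ¬ Splits P) (hn : 2 ≤ n)
    (ht : slope n (center P) = ⊤) :
    germTree P = Tree.node n 0 (center P) (Fin n) fun _ => Tree.leaf 1 0 fun _ => X := by
  have h0 := hP.natDegree_zero
  rw [germTree, dif_neg hs, if_neg (by omega)]
  subst h0
  simp only [ht, if_true]

theorem germTree_of_not_strict (hP : IsGerm n P) (hs : ¬ Splits P) (hn : 2 ≤ n)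
    (hm : slope n (center P) = (m : WithTop ℚ)) (hst : ¬ Strict n (center P) m) :
    germTree P = Tree.leaf n 0 (center P) := by
  have h0 := hP.natDegree_zero
  rw [germTree, dif_neg hs, if_neg (by omega)]
  subst h0
  simp only [hm, WithTop.coe_ne_top, if_false, WithTop.untopD_coe, hst, not_false_eq_true, if_true]

theorem Newton.of_strict (hP : IsGerm n P) (hs : ¬ Splits P) (hn : 2 ≤ n)
    (hm : RootCurve.slope n (center P) = (m : WithTop ℚ)) (hst : Strict n (center P) m) :
    Newton n (center P) m :=
  ⟨hP.center, by omega, hP.center_zero hs (by omega), hP.center_coeff (by omega), hm, hst⟩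

theorem germTree_of_frac (hP : IsGerm n P) (hs : ¬ Splits P) (hn : 2 ≤ n)
    (hN : Newton n (center P) m) (hd : m.den ≠ 1) :
    germTree P = Tree.leaf n m (center P) := by
  have h0 := hP.natDegree_zero
  rw [germTree, dif_neg hs, if_neg (by omega)]
  subst h0
  simp only [hN.slope, WithTop.coe_ne_top, if_false, WithTop.untopD_coe, hN.strict, not_true_eq_false,
    hd, ne_eq, not_false_eq_true, if_true]

theorem germTree_of_int (hP : IsGerm n P) (hs : ¬ Splits P) (hn : 2 ≤ n)
    (hN : Newton n (center P) m) (hd : m.den = 1) :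
    germTree P = Tree.node n m (center P)
      {ρ : ℂ // ρ ∈ (divide n m.num.toNat (center P) 0).roots.toFinset}
      fun ρ => germTree (factor (divide n m.num.toNat (center P)) ρ) := by
  have h0 := hP.natDegree_zero
  have hR := (hN.hasSlope hd).splits_divide
  rw [germTree, dif_neg hs, if_neg (by omega)]
  subst h0
  simp only [hN.slope, WithTop.coe_ne_top, if_false, WithTop.untopD_coe, hN.strict, not_true_eq_false,
    hd, ne_eq, hR, dite_true]
  rw [hN.slope]
  rfl

theorem germGammaHat_of_splits (hs : Splits P) :
    germGammaHat P = (P 0).roots.toFinset.sup fun ρ => germGammaHat (factor P ρ) := by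
  rw [germGammaHat, dif_pos hs]

theorem germGammaHat_of_not_strict (hP : IsGerm n P) (hs : ¬ Splits P) (hn : 2 ≤ n)
    (hm : slope n (center P) = (m : WithTop ℚ)) (hst : ¬ Strict n (center P) m) :
    germGammaHat P = ⌈(n : ℚ) * m⌉₊ := by
  have h0 := hP.natDegree_zero
  rw [germGammaHat, dif_neg hs, if_neg (by omega)]
  subst h0
  simp only [hm, WithTop.coe_ne_top, if_false, WithTop.untopD_coe, hst, not_false_eq_true, if_true]

theorem germGammaHat_of_int (hP : IsGerm n P) (hs : ¬ Splits P) (hn : 2 ≤ n)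
    (hN : Newton n (center P) m) (hd : m.den = 1) :
    germGammaHat P = n * m.num.toNat +
      (divide n m.num.toNat (center P) 0).roots.toFinset.sup fun ρ =>
        germGammaHat (factor (divide n m.num.toNat (center P)) ρ) := by
  have h0 := hP.natDegree_zero
  have hR := (hN.hasSlope hd).splits_divide
  rw [germGammaHat, dif_neg hs, if_neg (by omega)]
  subst h0
  simp only [hN.slope, WithTop.coe_ne_top, if_false, WithTop.untopD_coe, hN.strict, not_true_eq_false,
    hd, hR, dite_true, if_true]

/-- In the ramified case both signs contribute to `germGammaHat`. -/
theorem le_germGammaHat_of_frac (hP : IsGerm n P) (hs : ¬ Splits P) (hn : 2 ≤ n)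
    (hN : Newton n (center P) m) (hd : m.den ≠ 1) {ε : ℝ} (hε : ε = 1 ∨ ε = -1) :
    n * m.num.toNat + ((divide n m.num.toNat (ramify ε m.den (center P)) 0).roots.toFinset.sup fun ρ =>
        germGammaHat (factor (divide n m.num.toNat (ramify ε m.den (center P))) ρ)) ≤
      germGammaHat P := by
  have h0 := hP.natDegree_zero
  have hR1 := (hN.hasSlope_ramify one_ne_zero).splits_divide
  have hR2 := (hN.hasSlope_ramify (neg_ne_zero.2 one_ne_zero)).splits_divide
  rw [germGammaHat, dif_neg hs, if_neg (by omega)]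
  subst h0
  simp only [hN.slope, WithTop.coe_ne_top, if_false, WithTop.untopD_coe, hN.strict, not_true_eq_false,
    hd, hR1, hR2, dite_true]
  rcases hε with rfl | rfl
  · exact le_max_left _ _
  · exact le_max_right _ _

/-- The cases distinguished by the recursions: the germ splits; the degree is at most one; the slope is
infinite; the slope is finite, but all quotients vanish at `0`; the slope is finite, with a nonvanishing
quotient. -/
theorem IsGerm.cases (hP : IsGerm n P) : Splits P ∨ ¬ Splits P ∧ (n ≤ 1 ∨ 2 ≤ n ∧
    (slope n (RootCurve.center P) = ⊤ ∨ ∃ m : ℚ, slope n (RootCurve.center P) = (m : WithTop ℚ) ∧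
      (¬ Strict n (RootCurve.center P) m ∨ Newton n (RootCurve.center P) m))) := by
  by_cases hs : Splits P
  · exact Or.inl hs
  refine Or.inr ⟨hs, ?_⟩
  by_cases hn : n ≤ 1
  · exact Or.inl hn
  push Not at hn
  refine Or.inr ⟨hn, ?_⟩
  rcases h : slope n (RootCurve.center P) with _ | m
  · exact Or.inl rfl
  refine Or.inr ⟨m, rfl, ?_⟩
  by_cases hst : Strict n (RootCurve.center P) m
  · exact Or.inr (.of_strict hP hs hn h hst)
  · exact Or.inl hst

theorem IsGerm.rootMultiplicity_lt (hP : IsGerm n P) (hs : Splits P) {ρ : ℂ} (hρ : ρ ∈ (P 0).roots) :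
    (P 0).rootMultiplicity ρ < n := by
  have := natDegree_factor_lt hs ρ
  rwa [hP.factor_zero_natDegree hρ, hP.natDegree_zero] at this

end unfold

namespace Tree

theorem good_node {d : ℕ} {q : ℚ} {P : ℝ → ℂ[X]} {ι : Type} [Fintype ι] {child : ι → Tree} :
    (node d q P ι child).Good ↔ (IsEmpty ι → d = 1 ∧ q = 0) ∧ ∀ i, (child i).Good := by rw [Good]

theorem admissible_node {d : ℕ} {q : ℚ} {P : ℝ → ℂ[X]} {ι : Type} [Fintype ι] {child : ι → Tree} :
    (node d q P ι child).Admissible ↔ (IsEmpty ι → q = 0 → d = 1) ∧ ∀ i, (child i).Admissible := by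
  rw [Admissible]

theorem good_leaf {d : ℕ} {q : ℚ} {P : ℝ → ℂ[X]} : (leaf d q P).Good ↔ d = 1 ∧ q = 0 := by
  rw [leaf, good_node]
  exact ⟨fun h => h.1 inferInstance, fun h => ⟨fun _ => h, fun i => i.elim⟩⟩

theorem admissible_leaf {d : ℕ} {q : ℚ} {P : ℝ → ℂ[X]} :
    (leaf d q P).Admissible ↔ (q = 0 → d = 1) := by
  rw [leaf, admissible_node]
  exact ⟨fun h => h.1 inferInstance, fun h => ⟨fun _ => h, fun i => i.elim⟩⟩

theorem Good.admissible {T : Tree} (h : T.Good) : T.Admissible := by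
  induction T with
  | node d q P ι child ih =>
    rw [good_node] at h
    rw [admissible_node]
    exact ⟨fun hi _ => (h.1 hi).1, fun i => ih i (h.2 i)⟩

theorem badLeavesFair_node {d : ℕ} {q : ℚ} {P : ℝ → ℂ[X]} {ι : Type} [Fintype ι] {child : ι → Tree} :
    (node d q P ι child).BadLeavesFair ↔
      (IsEmpty ι → ¬ (d = 1 ∧ q = 0) → ∀ ε : ℝ, ε = 1 ∨ ε = -1 →
        (germTree (ramify ε q.den P)).Good ∧ (germTree (ramify ε q.den P)).height = 1) ∧
      ∀ i, (child i).BadLeavesFair := by rw [BadLeavesFair]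

theorem Good.badLeavesFair {T : Tree} (h : T.Good) : T.BadLeavesFair := by
  induction T with
  | node d q P ι child ih =>
    rw [good_node] at h
    rw [badLeavesFair_node]
    exact ⟨fun hi hc => absurd (h.1 hi) hc, fun i => ih i (h.2 i)⟩

theorem Good.fair {T : Tree} (h : T.Good) : T.Fair := ⟨h.admissible, h.badLeavesFair⟩

theorem Gamma_node {d : ℕ} {q : ℚ} {P : ℝ → ℂ[X]} {ι : Type} [Fintype ι] {child : ι → Tree} :
    (node d q P ι child).Gamma = ⌈(d : ℚ) * q⌉₊ + Finset.univ.sup fun i => (child i).Gamma := by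
  rw [Gamma]

theorem gamma_node_of_good {d : ℕ} {q : ℚ} {P : ℝ → ℂ[X]} {ι : Type} [Fintype ι] {child : ι → Tree}
    (h : (node d q P ι child).Good) : (node d q P ι child).gamma = ⌊q⌋₊ +
      ((Finset.univ.sup fun i => (child i).Gamma) -
        Finset.univ.sup fun i => (child i).Gamma - (child i).gamma) := by
  rw [gamma, if_pos h]

theorem gamma_node_of_not_good {d : ℕ} {q : ℚ} {P : ℝ → ℂ[X]} {ι : Type} [Fintype ι]
    {child : ι → Tree} (h : ¬ (node d q P ι child).Good) :
    (node d q P ι child).gamma = ⌊q⌋₊ + ⨅ i, (child i).gamma := by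
  rw [gamma, if_neg h]

theorem Gamma_leaf {d : ℕ} {q : ℚ} {P : ℝ → ℂ[X]} : (leaf d q P).Gamma = ⌈(d : ℚ) * q⌉₊ := by
  rw [leaf, Gamma_node]; simp

theorem gamma_leaf {d : ℕ} {q : ℚ} {P : ℝ → ℂ[X]} : (leaf d q P).gamma = ⌊q⌋₊ := by
  by_cases h : (leaf d q P).Good
  · rw [leaf, gamma_node_of_good h]; simp
  · rw [leaf, gamma_node_of_not_good h]; simp

theorem height_node {d : ℕ} {q : ℚ} {P : ℝ → ℂ[X]} {ι : Type} [Fintype ι] {child : ι → Tree} :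
    (node d q P ι child).height = Finset.univ.sup fun i => (child i).height + 1 := by rw [height]

theorem gamma_le_Gamma_node {d : ℕ} {q : ℚ} {P : ℝ → ℂ[X]} {ι : Type} [Fintype ι] {child : ι → Tree}
    (hd : 1 ≤ d ∨ q = 0) (h : ∀ i, (child i).gamma ≤ (child i).Gamma) :
    (node d q P ι child).gamma ≤ (node d q P ι child).Gamma := by
  have h1 : ⌊q⌋₊ ≤ ⌈(d : ℚ) * q⌉₊ := by
    rcases hd with hd | rfl
    · rcases le_total q 0 with hq | hq
      · simp [Nat.floor_of_nonpos hq]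
      · refine (Nat.floor_le_ceil q).trans (Nat.ceil_le_ceil ?_)
        have : (1 : ℚ) ≤ d := by exact_mod_cast hd
        nlinarith
    · simp
  rw [Gamma_node]
  by_cases hg : (node d q P ι child).Good
  · rw [gamma_node_of_good hg]
    omega
  · rw [gamma_node_of_not_good hg]
    refine add_le_add h1 ?_
    rcases isEmpty_or_nonempty ι with hι | ⟨⟨i⟩⟩
    · simp
    · exact (ciInf_le (OrderBot.bddBelow _) i).trans ((h i).trans
        (Finset.le_sup (f := fun i => (child i).Gamma) (Finset.mem_univ i)))

end Tree

theorem gamma_le_Gamma_germTree {n : ℕ} {P : ℝ → ℂ[X]} (hP : IsGerm n P) :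
    (germTree P).gamma ≤ (germTree P).Gamma := by
  induction n using Nat.strong_induction_on generalizing P with
  | _ n ih =>
    rcases hP.cases with hs | ⟨hs, hn | ⟨hn, ht | ⟨m, hm, hst | hN⟩⟩⟩
    · rw [germTree_of_splits hP hs]
      exact Tree.gamma_le_Gamma_node (Or.inr rfl) fun ρ =>
        ih _ (hP.rootMultiplicity_lt hs (Multiset.mem_toFinset.1 ρ.2))
          (hP.factor (Multiset.mem_toFinset.1 ρ.2))
    · rw [germTree_of_le_one hP hs hn, Tree.gamma_leaf]
      simp
    · rw [germTree_of_top hP hs hn ht]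
      exact Tree.gamma_le_Gamma_node (Or.inr rfl) fun _ => by simp [Tree.gamma_leaf]
    · rw [germTree_of_not_strict hP hs hn hm hst, Tree.gamma_leaf]
      simp
    · by_cases hd : m.den = 1
      · rw [germTree_of_int hP hs hn hN hd]
        have hR := (hN.hasSlope hd)
        exact Tree.gamma_le_Gamma_node (Or.inl (by omega)) fun ρ =>
          ih _ (hR.germ_divide.rootMultiplicity_lt hR.splits_divide (Multiset.mem_toFinset.1 ρ.2))
            (hR.germ_divide.factor (Multiset.mem_toFinset.1 ρ.2))
      · rw [germTree_of_frac hP hs hn hN hd]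
        exact Tree.gamma_le_Gamma_node (Or.inl (by omega)) fun i => i.elim

/-! ### Parameterized roots -/

/-- Near `0`, the roots of `P` are parameterized by germs of class `WGerm D E`.  The index type is arbitrary,
as the roots of a product are indexed by a sum type. -/
def RootsIn (D : ℕ∞) (E : ℕ) (P : ℝ → ℂ[X]) : Prop :=
  ∃ (ι : Type) (_ : Fintype ι) (lam : ι → ℝ → ℂ), (∀ i, WGerm D E (lam i)) ∧
    ∀ᶠ t in 𝓝 (0 : ℝ), P t = ∏ i, (X - C (lam i t))

theorem prod_comp_X_sub_C {ι : Type} [Fintype ι] (v : ι → ℂ) (c : ℂ) :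
    (∏ i, (X - C (v i))).comp (X - C c) = ∏ i, (X - C (v i + c)) := by
  rw [prod_comp]
  refine Finset.prod_congr rfl fun i _ => ?_
  simp only [sub_comp, X_comp, C_comp, C_add]
  ring

theorem roots_prod_family {ι : Type} [Fintype ι] (v : ι → ℂ) :
    (∏ i, (X - C (v i))).roots = Finset.univ.val.map v := by
  rw [Finset.prod_eq_multiset_prod, show (Multiset.map (fun i => X - C (v i)) Finset.univ.val) =
    (Finset.univ.val.map v).map fun z => X - C z by rw [Multiset.map_map]; rfl,
    roots_multiset_prod_X_sub_C]

theorem prod_family_of_roots {ι : Type} [Fintype ι] {p : ℂ[X]} (hp : p.Monic) (v : ι → ℂ)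
    (h : p.roots = Finset.univ.val.map v) : p = ∏ i, (X - C (v i)) := by
  rw [← prod_roots hp, h, Finset.prod_eq_multiset_prod, Multiset.map_map]
  rfl

theorem HasSlope.prod_eq {n r : ℕ} {S : ℝ → ℂ[X]} (h : HasSlope n r S) {ι : Type} [Fintype ι]
    {lam : ι → ℝ → ℂ} (hl : ∀ᶠ t in 𝓝 (0 : ℝ), divide n r S t = ∏ i, (X - C (lam i t))) :
    ∀ᶠ t in 𝓝 (0 : ℝ), S t = ∏ i, (X - C ((t : ℂ) ^ r * lam i t)) := by
  filter_upwards [h.roots, h.germ.monic, hl] with t h1 h2 h3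
  refine prod_family_of_roots h2.1 _ ?_
  rw [h1, h3, roots_prod_family, Multiset.map_map]
  rfl

namespace RootsIn
variable {D : ℕ∞} {e E n r : ℕ} {P S : ℝ → ℂ[X]}

theorem mono_weight {E' : ℕ} (hE : E ≤ E') (h : RootsIn D E P) : RootsIn D E' P := by
  obtain ⟨ι, hι, lam, h1, h2⟩ := h
  exact ⟨ι, hι, lam, fun i => (h1 i).mono_weight hE, h2⟩

theorem of_factors (hP : IsGerm n P) (h : ∀ ρ ∈ (P 0).roots, RootsIn D E (factor P ρ)) :
    RootsIn D E P := by
  choose ι hι lam h1 h2 using fun ρ : (P 0).roots.toFinset => h ρ (Multiset.mem_toFinset.1 ρ.2)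
  refine ⟨Σ ρ, ι ρ, inferInstance, fun x => lam x.1 x.2, fun x => h1 x.1 x.2, ?_⟩
  filter_upwards [eventually_all.2 h2, hP.eventually_prod_factor] with t h3 h4
  rw [← h4, Fintype.prod_sigma, ← Finset.prod_coe_sort]
  exact Finset.prod_congr rfl fun ρ _ => h3 ρ

theorem of_center (hP : IsGerm n P) (hC : CoefReg D e P) (he : (e : ℕ∞) ≤ D) (heE : e ≤ E)
    (h : RootsIn D E (center P)) : RootsIn D E P := by
  obtain ⟨ι, hι, lam, h1, h2⟩ := h
  refine ⟨ι, hι, fun i t => lam i t + -shift P t,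
    fun i => (h1 i).add (((hP.shift_reg he hC).neg he).mono_weight heE), ?_⟩
  filter_upwards [h2] with t h3
  rw [← prod_comp_X_sub_C, ← h3, center_eq, comp_assoc]
  simp

/-- The roots of `S` are `t^r μ`, where `μ` are the roots of the quotient; this lowers the weight by `r`. -/
theorem of_divide (h : HasSlope n r S) (hR : RootsIn D E (divide n r S)) {E' : ℕ} (hE : E ≤ E' + r) :
    RootsIn D E' S := by
  obtain ⟨ι, hι, lam, h1, h2⟩ := hR
  exact ⟨ι, hι, fun i t => (t : ℂ) ^ r * lam i t, fun i => (h1 i).pow_mul hE, h.prod_eq h2⟩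

theorem of_le_one (hP : IsGerm n P) (hn : n ≤ 1) (hC : CoefReg D e P) (he : (e : ℕ∞) ≤ D) :
    RootsIn D e P := by
  refine ⟨Fin n, inferInstance, fun _ t => - (P t).coeff 0, fun _ => (hC 0).neg he, ?_⟩
  filter_upwards [hP.monic] with t ht
  interval_cases n
  · simpa using ht.1.natDegree_eq_zero.1 ht.2
  · have := ht.1.eq_X_add_C ht.2
    simpa using this

theorem of_eventually_eq (hQ : ∀ᶠ t in 𝓝 (0 : ℝ), P t = X ^ n) : RootsIn D E P := by
  refine ⟨Fin n, inferInstance, fun _ _ => 0, fun _ => .const 0, hQ.mono fun t ht => ?_⟩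
  simpa using ht

theorem exists_fin (hP : IsGerm n P) (h : RootsIn D E P) :
    ∃ lam : Fin n → ℝ → ℂ, (∀ i, WGerm D E (lam i)) ∧
      ∀ᶠ t in 𝓝 (0 : ℝ), P t = ∏ i, (X - C (lam i t)) := by
  obtain ⟨ι, hι, lam, h1, h2⟩ := h
  have hcard : Fintype.card ι = n := by
    have h3 := h2.self_of_nhds
    rw [← hP.natDegree_zero, h3, natDegree_prod_of_monic _ _ fun i _ => monic_X_sub_C _]
    simp
  let eq := (Fintype.equivFinOfCardEq hcard).symm
  refine ⟨fun i => lam (eq i), fun i => h1 _, h2.mono fun t ht => ?_⟩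
  rw [ht]
  exact (eq.prod_comp fun i => X - C (lam i t)).symm

end RootsIn

/-! ### Separation of roots -/

/-- Distinct roots of `P t` are at least `|t|^K` apart, for some `K`. -/
def Sep (P : ℝ → ℂ[X]) : Prop :=
  ∃ K : ℕ, ∀ᶠ t in 𝓝[≠] (0 : ℝ), ∀ z ∈ (P t).roots, ∀ w ∈ (P t).roots, z ≠ w → |t| ^ K ≤ dist z w

/-- A bound for the roots in terms of the coefficients. -/
theorem norm_root_le {p : ℂ[X]} {n : ℕ} (hp : p.Monic) (hn : p.natDegree = n) {ε : ℝ} (hε : 0 < ε)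
    (h : ∀ i < n, ‖p.coeff i‖ ≤ ε ^ (n - i)) {z : ℂ} (hz : z ∈ p.roots) : ‖z‖ ≤ 2 * ε := by
  by_contra hcon
  push Not at hcon
  have hz0 : p.eval z = 0 := (mem_roots'.1 hz).2
  have hzpos : 0 < ‖z‖ := by linarith
  rw [eval_eq_sum_range, hn, Finset.sum_range_succ] at hz0
  have hc : p.coeff n = 1 := by rw [← hn]; exact hp.coeff_natDegree
  rw [hc, one_mul] at hz0
  have h1 : ‖z‖ ^ n ≤ ∑ i ∈ Finset.range n, ε ^ (n - i) * ‖z‖ ^ i := by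
    rw [← norm_pow, show z ^ n = -∑ i ∈ Finset.range n, p.coeff i * z ^ i by linear_combination hz0,
      norm_neg]
    refine (norm_sum_le _ _).trans (Finset.sum_le_sum fun i hi => ?_)
    rw [norm_mul, norm_pow]
    gcongr
    exact h i (Finset.mem_range.1 hi)
  have h2 : ∀ m : ℕ, ∑ i ∈ Finset.range m, ε ^ (m - i) * ‖z‖ ^ i ≤ ‖z‖ ^ m - ε ^ m := by
    intro m
    induction m with
    | zero => simp
    | succ m ih =>
      have h3 : ∑ i ∈ Finset.range m, ε ^ (m + 1 - i) * ‖z‖ ^ i =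
          ε * ∑ i ∈ Finset.range m, ε ^ (m - i) * ‖z‖ ^ i := by
        rw [Finset.mul_sum]
        refine Finset.sum_congr rfl fun i hi => ?_
        rw [Nat.sub_add_comm (Finset.mem_range.1 hi).le, pow_succ']
        ring
      rw [Finset.sum_range_succ, h3, Nat.add_sub_cancel_left, pow_one, pow_succ, pow_succ]
      have h4 : 0 ≤ ‖z‖ ^ m := by positivity
      nlinarith
  have h3 := h2 n
  have h4 : 0 < ε ^ n := by positivity
  linarith

/-- If all coefficients vanish to infinite order, then so do the roots. -/
theorem flat_roots {n : ℕ} {Q : ℝ → ℂ[X]} (hQ : IsGerm n Q) (ht : slope n Q = ⊤) (K : ℕ) :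
    ∀ᶠ t in 𝓝[≠] (0 : ℝ), ∀ z ∈ (Q t).roots, ‖z‖ ≤ 2 * |t| ^ K := by
  have h1 : ∀ᶠ t in 𝓝 (0 : ℝ), ∀ i ∈ Finset.range n, ‖(Q t).coeff i‖ ≤ |t| ^ (K * n) := by
    rw [Finset.eventually_all]
    intro i hi
    obtain ⟨u, hu, hd⟩ := divisibleBy_of_slope_top hQ ht (Finset.mem_range.1 hi) (K * n + 1)
    have h2 : Tendsto (fun t : ℝ => ‖(t : ℂ) * u t‖) (𝓝 0) (𝓝 ‖((0 : ℝ) : ℂ) * u 0‖) :=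
      ((Complex.continuous_ofReal.continuousAt).mul hu.self_of_nhds).norm
    rw [Complex.ofReal_zero, zero_mul, norm_zero] at h2
    filter_upwards [hd, h2.eventually_le_const one_pos] with t h3 h4
    rw [h3, pow_succ, mul_assoc, norm_mul, norm_pow, Complex.norm_real, Real.norm_eq_abs]
    exact mul_le_of_le_one_right (by positivity) h4
  have h2 : ∀ᶠ t in 𝓝 (0 : ℝ), |t| ≤ 1 := by
    have : Tendsto (fun t : ℝ => |t|) (𝓝 0) (𝓝 |0|) := continuous_abs.tendsto 0
    rw [abs_zero] at this
    exact this.eventually_le_const one_pos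
  filter_upwards [nhdsWithin_le_nhds h1, nhdsWithin_le_nhds h2, nhdsWithin_le_nhds hQ.monic,
    self_mem_nhdsWithin] with t h3 h4 h5 h6 z hz
  have h7 : 0 < |t| := abs_pos.2 h6
  refine norm_root_le h5.1 h5.2 (by positivity) (fun i hi => ?_) hz
  refine (h3 i (Finset.mem_range.2 hi)).trans ?_
  rw [← pow_mul]
  exact pow_le_pow_of_le_one h7.le h4 (Nat.mul_le_mul_left _ (by omega))

theorem eventually_abs_lt {c : ℝ} (hc : 0 < c) : ∀ᶠ t in 𝓝[≠] (0 : ℝ), |t| < c := by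
  have : Tendsto (fun t : ℝ => |t|) (𝓝 0) (𝓝 |0|) := continuous_abs.tendsto 0
  rw [abs_zero] at this
  exact nhdsWithin_le_nhds (this.eventually_lt_const hc)

namespace Sep
variable {n r : ℕ} {P S : ℝ → ℂ[X]}

theorem factor (h : Sep P) (ρ : ℂ) : Sep (factor P ρ) := by
  obtain ⟨K, hK⟩ := h
  refine ⟨K, hK.mono fun t ht z hz w hw => ht z ?_ w ?_⟩
  · exact Multiset.mem_of_le (roots_near_le _ _ _) hz
  · exact Multiset.mem_of_le (roots_near_le _ _ _) hw

theorem center (hP : IsGerm n P) (h : Sep P) : Sep (center P) := by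
  obtain ⟨K, hK⟩ := h
  refine ⟨K, ?_⟩
  filter_upwards [hK, nhdsWithin_le_nhds hP.roots_center] with t h1 h2 z hz w hw hne
  rw [h2, Multiset.mem_map] at hz hw
  obtain ⟨z', hz', rfl⟩ := hz
  obtain ⟨w', hw', rfl⟩ := hw
  rw [dist_add_right]
  exact h1 z' hz' w' hw' fun h => hne (by rw [h])

theorem divide (hS : HasSlope n r S) (h : Sep S) : Sep (divide n r S) := by
  obtain ⟨K, hK⟩ := h
  refine ⟨K, ?_⟩
  filter_upwards [hK, nhdsWithin_le_nhds hS.roots, self_mem_nhdsWithin, eventually_abs_lt one_pos]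
    with t h1 h2 h3 h4 z hz w hw hne
  have h3' : (t : ℂ) ^ r ≠ 0 := pow_ne_zero _ (by exact_mod_cast h3)
  have h5 := h1 ((t : ℂ) ^ r * z) (by rw [h2]; exact Multiset.mem_map_of_mem _ hz)
    ((t : ℂ) ^ r * w) (by rw [h2]; exact Multiset.mem_map_of_mem _ hw)
    fun h => hne (mul_left_cancel₀ h3' h)
  rw [dist_eq_norm, ← mul_sub, norm_mul, norm_pow, Complex.norm_real, Real.norm_eq_abs,
    ← dist_eq_norm] at h5
  refine h5.trans (mul_le_of_le_one_left dist_nonneg ?_)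
  exact pow_le_one₀ (abs_nonneg t) h4.le

theorem tendsto_power_ne {ε : ℝ} {N : ℕ} (hN : N ≠ 0) (hε : ε ≠ 0) :
    Tendsto (fun s : ℝ => ε * s ^ N) (𝓝[≠] 0) (𝓝[≠] 0) := by
  refine tendsto_nhdsWithin_of_tendsto_nhds_of_eventually_within _
    ((WGerm.tendsto_power ε hN).mono_left nhdsWithin_le_nhds) ?_
  filter_upwards [self_mem_nhdsWithin] with s hs
  exact mul_ne_zero hε (pow_ne_zero _ hs)

theorem ramify {ε : ℝ} {N : ℕ} (hN : N ≠ 0) (hε : |ε| = 1) (h : Sep P) : Sep (ramify ε N P) := by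
  obtain ⟨K, hK⟩ := h
  have hε0 : ε ≠ 0 := by rintro rfl; simp at hε
  refine ⟨N * K, ?_⟩
  filter_upwards [(tendsto_power_ne hN hε0).eventually hK] with s hs z hz w hw hne
  have := hs z hz w hw hne
  rwa [abs_mul, hε, one_mul, abs_pow, ← pow_mul] at this

/-- A centered germ with separated roots, all of whose coefficients vanish to infinite order, is
`X ^ n`. -/
theorem eq_X_pow (hQ : IsGerm n S) (hn : 0 < n) (h0 : S 0 = X ^ n)
    (hnext : ∀ᶠ t in 𝓝 (0 : ℝ), (S t).coeff (n - 1) = 0) (ht : slope n S = ⊤) (h : Sep S) :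
    ∀ᶠ t in 𝓝 (0 : ℝ), S t = X ^ n := by
  obtain ⟨K, hK⟩ := h
  have hne : ∀ᶠ t in 𝓝[≠] (0 : ℝ), S t = X ^ n := by
    filter_upwards [hK, flat_roots hQ ht (K + 1), self_mem_nhdsWithin,
      eventually_abs_lt (show (0 : ℝ) < 1 / 4 by norm_num), nhdsWithin_le_nhds hQ.monic,
      nhdsWithin_le_nhds hnext] with t h1 h2 h3 h4 h5 h6
    have hpos : 0 < |t| ^ K := pow_pos (abs_pos.2 h3) K
    -- distinct roots would be `|t|^K` apart, but they are bounded by `2|t|^(K+1)`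
    have hall : ∀ z ∈ (S t).roots, ∀ w ∈ (S t).roots, z = w := by
      intro z hz w hw
      by_contra hzw
      have h7 := h1 z hz w hw hzw
      have h8 := dist_le_norm_add_norm z w
      have h9 := h2 z hz
      have h10 := h2 w hw
      rw [pow_succ] at h9 h10
      nlinarith
    have hcard : Multiset.card (S t).roots = n := (card_roots_eq _).trans h5.2
    obtain ⟨z, hz⟩ := Multiset.card_pos_iff_exists_mem.1 (hcard ▸ hn)
    have hr : (S t).roots = Multiset.replicate n z :=
      Multiset.eq_replicate.2 ⟨hcard, fun w hw => hall w hw z hz⟩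
    have hsum := sum_roots_eq h5.1
    rw [hr, Multiset.sum_replicate, nsmul_eq_mul, nextCoeff_of_natDegree_pos (by omega), h5.2, h6,
      neg_zero] at hsum
    have hn' : (n : ℂ) ≠ 0 := by exact_mod_cast hn.ne'
    have hz0 : z = 0 := (mul_eq_zero.1 hsum).resolve_left hn'
    rw [← prod_roots h5.1, hr, hz0, Multiset.map_replicate, Multiset.prod_replicate]
    simp
  rw [eventually_nhdsWithin_iff] at hne
  filter_upwards [hne] with t h
  by_cases h' : t = 0
  · rw [h', h0]
  · exact h h'

end Sep

/-! ### Regularity of the roots -/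

section
variable {D : ℕ∞} {e E n : ℕ} {P Q : ℝ → ℂ[X]} {m : ℚ}

theorem coe_le_of_add_le {a b : ℕ} (h : ((a + b : ℕ) : ℕ∞) ≤ D) : (a : ℕ∞) ≤ D :=
  le_trans (by exact_mod_cast Nat.le_add_right a b) h

theorem Newton.ceil_mul (h : Newton n Q m) (hd : m.den = 1) :
    ⌈(n : ℚ) * m⌉₊ = n * m.num.toNat ∧ ⌊m⌋₊ = m.num.toNat := by
  have h1 := h.num_eq
  rw [hd, Nat.cast_one, mul_one] at h1
  refine ⟨?_, ?_⟩
  · conv_lhs => rw [← h1, ← Nat.cast_mul, Nat.ceil_natCast]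
  · conv_lhs => rw [← h1]
    exact Nat.floor_natCast _

/-- The recursions for `Γ` and `γ` at a good vertex, in terms of `G = max Γ(W)` and `M = max (Γ(W) - γ(W))`. -/
theorem Tree.good_bounds {d : ℕ} {q : ℚ} {P : ℝ → ℂ[X]} {ι : Type} [Fintype ι] {child : ι → Tree}
    (h : (Tree.node d q P ι child).Good) : ∃ G M : ℕ,
      (Tree.node d q P ι child).Gamma = ⌈(d : ℚ) * q⌉₊ + G ∧
      (Tree.node d q P ι child).gamma = ⌊q⌋₊ + (G - M) ∧ M ≤ G ∧
      ∀ i, (child i).Good ∧ (child i).Gamma ≤ G ∧ (child i).Gamma - (child i).gamma ≤ M :=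
  ⟨_, _, Tree.Gamma_node, Tree.gamma_node_of_good h,
    Finset.sup_mono_fun fun _ _ => Nat.sub_le _ _, fun i => ⟨(Tree.good_node.1 h).2 i,
      Finset.le_sup (f := fun i => (child i).Gamma) (Finset.mem_univ i),
      Finset.le_sup (f := fun i => (child i).Gamma - (child i).gamma) (Finset.mem_univ i)⟩⟩

/-- If the tree is good, the roots have `Γ - γ` more weight than the coefficients.  At a vertex of slope `r`,
the weight increases by `n r` on division of the coefficients, and decreases by `r` on multiplication of
the roots, which is also the change of `Γ - γ`. -/
theorem rootsIn_of_good (hP : IsGerm n P) (hC : CoefReg D e P) (hG : (germTree P).Good) (hS : Sep P)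
    (hD : ((e + (germTree P).Gamma : ℕ) : ℕ∞) ≤ D) :
    RootsIn D (e + ((germTree P).Gamma - (germTree P).gamma)) P := by
  induction n using Nat.strong_induction_on generalizing P e with
  | _ n ih =>
  have he := coe_le_of_add_le hD
  rcases hP.cases with hs | ⟨hs, hn | ⟨hn, ht | ⟨m, hm, hst | hN⟩⟩⟩
  · obtain ⟨G, M, hΓ, hγ, hMG, hch⟩ := Tree.good_bounds (germTree_of_splits hP hs ▸ hG)
    rw [← germTree_of_splits hP hs, mul_zero, Nat.ceil_zero] at hΓ
    rw [← germTree_of_splits hP hs, Nat.floor_zero] at hγ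
    rw [hΓ] at hD
    rw [hΓ, hγ]
    refine .of_factors hP fun ρ hρ => ?_
    obtain ⟨h1, h2, h3⟩ := hch ⟨ρ, Multiset.mem_toFinset.2 hρ⟩
    refine (ih _ (hP.rootMultiplicity_lt hs hρ) (hP.factor hρ) (hP.coefReg_factor hρ he hC)
      h1 (hS.factor ρ) (le_trans ?_ hD)).mono_weight ?_
    · simp only [] at h2; norm_cast; omega
    · simp only [] at h3 ⊢; omega
  · exact (RootsIn.of_le_one hP hn hC he).mono_weight (Nat.le_add_right _ _)
  · refine .of_center hP hC he (Nat.le_add_right _ _) (.of_eventually_eq (n := n) ?_)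
    exact Sep.eq_X_pow hP.center (by omega) (hP.center_zero hs (by omega)) (hP.center_coeff (by omega)) ht
      (hS.center hP)
  · rw [germTree_of_not_strict hP hs hn hm hst, Tree.good_leaf] at hG
    omega
  · by_cases hd : m.den = 1
    · have hQ := hN.hasSlope hd
      have hT := germTree_of_int hP hs hn hN hd
      obtain ⟨G, M, hΓ, hγ, hMG, hch⟩ := Tree.good_bounds (hT ▸ hG)
      rw [← hT, (hN.ceil_mul hd).1] at hΓ
      rw [← hT, (hN.ceil_mul hd).2] at hγ
      rw [hΓ] at hD
      rw [hΓ, hγ]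
      have hrn : m.num.toNat ≤ n * m.num.toNat := Nat.le_mul_of_pos_left _ (by omega)
      have heD : ((e + n * m.num.toNat : ℕ) : ℕ∞) ≤ D := coe_le_of_add_le (b := G) (by rwa [add_assoc])
      refine .of_center hP hC he (Nat.le_add_right _ _) (.of_divide hQ (E := e + n * m.num.toNat + M)
        (.of_factors hQ.germ_divide fun ρ hρ => ?_) (by omega))
      obtain ⟨h1, h2, h3⟩ := hch ⟨ρ, Multiset.mem_toFinset.2 hρ⟩
      refine (ih _ (hQ.germ_divide.rootMultiplicity_lt hQ.splits_divide hρ) (hQ.germ_divide.factor hρ)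
        (hQ.germ_divide.coefReg_factor hρ heD (hQ.coefReg_divide (hP.coefReg_center he hC)))
        h1 (((hS.center hP).divide hQ).factor ρ) (le_trans ?_ hD)).mono_weight ?_
      · simp only [] at h2; norm_cast; omega
      · simp only [] at h3 ⊢; omega
    · rw [germTree_of_frac hP hs hn hN hd, Tree.good_leaf] at hG
      omega

end

section leaf
variable {D e n : ℕ} {P Q : ℝ → ℂ[X]} {m : ℚ}

/-- The roots of a germ with fractional slope `m = r / N` are `|t|^m μ(|t|^{1/N})`, where `μ` runs through the
roots of the quotients of the two ramified germs. -/
theorem Newton.rootsIn (h : Newton n Q m) (hd : m.den ≠ 1) (hm : ⌊m⌋₊ ≤ D)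
    (hR : ∀ ε : ℝ, ε = 1 ∨ ε = -1 →
      RootsIn D D (divide n m.num.toNat (ramify ε m.den Q))) : RootsIn D (D - ⌊m⌋₊) Q := by
  have hS1 := h.hasSlope_ramify one_ne_zero
  have hS2 := h.hasSlope_ramify (neg_ne_zero.2 one_ne_zero)
  obtain ⟨μ, hμ, hμP⟩ := (hR 1 (Or.inl rfl)).exists_fin hS1.germ_divide
  obtain ⟨ν, hν, hνP⟩ := (hR (-1) (Or.inr rfl)).exists_fin hS2.germ_divide
  have hβ : (0 : ℝ) < (m.den : ℝ)⁻¹ := by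
    have : (0 : ℝ) < m.den := by exact_mod_cast m.den_pos
    positivity
  have hα : ((⌊m⌋₊ : ℕ) : ℝ) < (m : ℝ) := by
    have h1 : ((⌊m⌋₊ : ℕ) : ℚ) ≤ m := Nat.floor_le h.nonneg
    have h2 : ((⌊m⌋₊ : ℕ) : ℚ) ≠ m := by
      intro h3
      apply hd
      rw [← h3]
      exact Rat.den_natCast _
    exact_mod_cast lt_of_le_of_ne h1 h2
  have hm0 : (0 : ℝ) < (m : ℝ) := by exact_mod_cast h.m_pos
  refine ⟨Fin n, inferInstance, fun j => twoSided (m : ℝ) (m.den : ℝ)⁻¹ (μ j) (ν j), fun j => ?_, ?_⟩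
  · obtain ⟨δ, hδ, h1, h2⟩ := (hμ j).exists_common (hν j)
    have h1' := (WReg.iff_eulerReg_sub (le_refl D)).1 h1
    have h2' := (WReg.iff_eulerReg_sub (le_refl D)).1 h2
    rw [Nat.sub_self] at h1' h2'
    refine ⟨δ ^ m.den, pow_pos hδ _, (WReg.iff_eulerReg_sub (Nat.sub_le _ _)).2 ?_⟩
    rw [Nat.sub_sub_self hm]
    refine twoSided.eulerReg hβ (Real.pow_rpow_inv_natCast hδ.le m.den_nz).le hδ hα ?_ ?_
    · rwa [Nat.add_sub_cancel' hm]
    · rwa [Nat.add_sub_cancel' hm]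
  · have htend : Tendsto (fun t : ℝ => |t| ^ (m.den : ℝ)⁻¹) (𝓝 0) (𝓝 0) := by
      have : Continuous fun t : ℝ => |t| ^ (m.den : ℝ)⁻¹ :=
        continuous_abs.rpow_const fun _ => Or.inr hβ.le
      simpa [Real.zero_rpow hβ.ne'] using this.tendsto 0
    -- `(|t|^{1/N})^r = |t|^m`
    have hpow : ∀ t : ℝ, 0 ≤ t → ((t ^ (m.den : ℝ)⁻¹) ^ m.num.toNat : ℝ) = t ^ (m : ℝ) := by
      intro t ht
      rw [← Real.rpow_mul_natCast ht]
      congr 1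
      have := h.num_eq
      have h2 : (m.num.toNat : ℝ) = (m : ℝ) * m.den := by exact_mod_cast this
      rw [h2]
      have : (m.den : ℝ) ≠ 0 := by exact_mod_cast m.den_nz
      field_simp
    filter_upwards [htend.eventually (hS1.prod_eq hμP), htend.eventually (hS2.prod_eq hνP)]
      with t h1 h2
    rcases lt_trichotomy t 0 with ht | ht | ht
    · rw [abs_of_neg ht] at h2
      have ht' : 0 ≤ -t := by linarith
      rw [ramify, Real.rpow_inv_natCast_pow ht' m.den_nz, neg_one_mul, neg_neg] at h2
      rw [h2]
      refine Finset.prod_congr rfl fun j _ => ?_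
      rw [twoSided.of_neg ht, ← Complex.ofReal_pow, hpow _ ht', Complex.real_smul]
    · subst ht
      simp only [twoSided.at_zero, map_zero, sub_zero, Finset.prod_const, Finset.card_univ,
        Fintype.card_fin, h.zero]
    · rw [abs_of_pos ht] at h1
      rw [ramify, Real.rpow_inv_natCast_pow ht.le m.den_nz, one_mul] at h1
      rw [h1]
      refine Finset.prod_congr rfl fun j _ => ?_
      rw [twoSided.of_pos ht, ← Complex.ofReal_pow, hpow _ ht.le, Complex.real_smul]

/-- Sufficient differentiability of the coefficients excludes that the slope is attained only by
coefficients whose quotient vanishes at `0`. -/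
theorem strict_of_coefReg (hn : 0 < n) (hQ : IsGerm n Q) (hC : CoefReg D e Q)
    (hm : slope n Q = (m : WithTop ℚ)) (hD : e + ⌈(n : ℚ) * m⌉₊ + 1 ≤ D) : Strict n Q m := by
  obtain ⟨k, hk, j, hj, hmult⟩ := exists_mult_of_slope hn hm
  refine ⟨k, hk, j, hj, hmult, fun h0 => ?_⟩
  have hdiv : DivisibleBy (fun t => (Q t).coeff (n - k)) j :=
    divisibleBy_of_le_mult (hQ.eventually_continuousAt _) hmult.ge
  obtain ⟨hc, hspec⟩ := hdiv.divPow_spec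
  set u := divPow (fun t => (Q t).coeff (n - k)) j with hu
  have hreg : WGerm D (e + j) u :=
    WGerm.of_pow_mul hc ((hC (n - k)).congr (hspec.mono fun t ht => ht.symm))
  have hjn : j ≤ ⌈(n : ℚ) * m⌉₊ := by
    have h1 : (j : ℚ) ≤ n * m := by
      rw [hj]
      have h2 : (k : ℚ) ≤ n := by exact_mod_cast (Finset.mem_Icc.1 hk).2
      have h3 := slope_nonneg hn hm
      nlinarith
    have h2 := h1.trans (Nat.le_ceil _)
    exact_mod_cast h2
  -- `u` is differentiable at `0`, where it vanishes, so it is divisible by `t`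
  have hdiff : DifferentiableAt ℝ u 0 := by
    obtain ⟨δ, hδ, h⟩ := hreg
    have h1 := h.contDiffOn (q := (1 : ℕ)) (by norm_cast; omega)
    exact (h1.contDiffAt (isOpen_Ioo.mem_nhds ⟨by linarith, hδ⟩)).differentiableAt (by simp)
  have hdiv' : DivisibleBy (fun t => (Q t).coeff (n - k)) (j + 1) := by
    refine ⟨dslope u 0, ?_, ?_⟩
    · filter_upwards [hc] with t ht
      by_cases ht0 : t = 0
      · rw [ht0]
        exact continuousAt_dslope_same.2 hdiff
      · exact (continuousAt_dslope_of_ne ht0).2 ht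
    · filter_upwards [hspec] with t ht
      have h3 := sub_smul_dslope u 0 t
      rw [h0, sub_zero, sub_zero, Complex.real_smul] at h3
      rw [ht, pow_succ, mul_assoc, h3]
  have h4 := le_mult hdiv'
  rw [hmult] at h4
  norm_cast at h4
  omega

end leaf

section hat
variable {D e n r : ℕ} {P Q S : ℝ → ℂ[X]} {m : ℚ}

theorem Newton.num_le (h : Newton n Q m) : ⌊m⌋₊ ≤ m.num.toNat := by
  have h1 := h.num_eq
  have h2 : (1 : ℚ) ≤ m.den := by exact_mod_cast m.den_pos
  have h3 := Nat.floor_le h.nonneg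
  have h4 : ((⌊m⌋₊ : ℕ) : ℚ) ≤ (m.num.toNat : ℕ) := by
    rw [h1]; nlinarith [h.nonneg]
  exact_mod_cast h4

theorem IsGerm.center_top (hP : IsGerm n P) (hs : ¬ Splits P) (hn : 2 ≤ n)
    (ht : slope n (RootCurve.center P) = ⊤) (hS : Sep P) :
    ∀ᶠ t in 𝓝 (0 : ℝ), RootCurve.center P t = X ^ n :=
  Sep.eq_X_pow hP.center (by omega) (hP.center_zero hs (by omega)) (hP.center_coeff (by omega)) ht
    (hS.center hP)

theorem rootsIn_divide_of_factors (hS : HasSlope n r S) (hC : CoefReg D e S) (hsep : Sep S)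
    (ih : ∀ ρ ∈ (divide n r S 0).roots, CoefReg D (e + n * r) (factor (divide n r S) ρ) →
      Sep (factor (divide n r S) ρ) →
      (e + n * r) + germGammaHat (factor (divide n r S) ρ) + 1 ≤ D →
      RootsIn D D (factor (divide n r S) ρ))
    (h : e + (n * r + (divide n r S 0).roots.toFinset.sup fun ρ =>
      germGammaHat (factor (divide n r S) ρ)) + 1 ≤ D) : RootsIn D D (divide n r S) := by
  refine .of_factors hS.germ_divide fun ρ hρ => ih ρ hρ ?_ ?_ ?_
  · exact hS.germ_divide.coefReg_factor hρ (by norm_cast; omega) (hS.coefReg_divide hC)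
  · exact (hsep.divide hS).factor ρ
  · have := Finset.le_sup (f := fun ρ => germGammaHat (factor (divide n r S) ρ))
      (Multiset.mem_toFinset.2 hρ)
    omega

/-- If the coefficients have one derivative more than `Γ̂` requires, no derivative gets lost in the
weight of the roots. -/
theorem rootsIn_of_gammaHat (hP : IsGerm n P) (hC : CoefReg D e P) (hS : Sep P)
    (hD : e + germGammaHat P + 1 ≤ D) : RootsIn D D P := by
  induction n using Nat.strong_induction_on generalizing P e with
  | _ n ih =>
  have he : (e : ℕ∞) ≤ D := by norm_cast; omega
  have heD : e ≤ D := by omega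
  rcases hP.cases with hs | ⟨hs, hn | ⟨hn, ht | ⟨m, hm, hst | hN⟩⟩⟩
  · rw [germGammaHat_of_splits hs] at hD
    refine .of_factors hP fun ρ hρ => ?_
    have h1 := Finset.le_sup (f := fun ρ => germGammaHat (factor P ρ)) (Multiset.mem_toFinset.2 hρ)
    exact ih _ (hP.rootMultiplicity_lt hs hρ) (hP.factor hρ) (hP.coefReg_factor hρ he hC)
      (hS.factor ρ) (by omega)
  · exact (RootsIn.of_le_one hP hn hC he).mono_weight heD
  · exact .of_center hP hC he heD (.of_eventually_eq (n := n) (hP.center_top hs hn ht hS))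
  · rw [germGammaHat_of_not_strict hP hs hn hm hst] at hD
    exact absurd (strict_of_coefReg (by omega) hP.center (hP.coefReg_center he hC) hm hD) hst
  · refine .of_center hP hC he heD ?_
    by_cases hd : m.den = 1
    · have hQ := hN.hasSlope hd
      rw [germGammaHat_of_int hP hs hn hN hd] at hD
      exact .of_divide hQ (rootsIn_divide_of_factors hQ (hP.coefReg_center he hC) (hS.center hP)
        (fun ρ hρ h1 h2 h3 => ih _ (hQ.germ_divide.rootMultiplicity_lt hQ.splits_divide hρ)
          (hQ.germ_divide.factor hρ) h1 h2 h3) hD) (by omega)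
    · refine (hN.rootsIn hd ?_ fun ε hε => ?_).mono_weight (Nat.sub_le _ _)
      · have h1 := le_germGammaHat_of_frac hP hs hn hN hd (Or.inl rfl)
        have h2 := hN.num_le
        have h3 : m.num.toNat ≤ n * m.num.toNat := Nat.le_mul_of_pos_left _ (by omega)
        omega
      · have hε0 : ε ≠ 0 := by rcases hε with rfl | rfl <;> norm_num
        have hε1 : |ε| = 1 := by rcases hε with rfl | rfl <;> norm_num
        have hR := hN.hasSlope_ramify hε0
        have h1 := le_germGammaHat_of_frac hP hs hn hN hd hε
        exact rootsIn_divide_of_factors hR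
          (Newton.coefReg_ramify (hP.coefReg_center he hC) he m.den_nz hε0)
          ((hS.center hP).ramify m.den_nz hε1)
          (fun ρ hρ h1 h2 h3 => ih _ (hR.germ_divide.rootMultiplicity_lt hR.splits_divide hρ)
            (hR.germ_divide.factor hρ) h1 h2 h3) (by omega)

theorem nonempty_roots (h : Splits S) : Nonempty {ρ : ℂ // ρ ∈ (S 0).roots.toFinset} := by
  obtain ⟨ρ, hρ⟩ := Finset.card_pos.1 (lt_trans one_pos h)
  exact ⟨⟨ρ, hρ⟩⟩

/-- Inadmissible leaves of positive slope are excluded by `strict_of_coefReg`. -/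
theorem admissible_of_gammaHat (hP : IsGerm n P) (hn0 : 0 < n) (hC : CoefReg D e P)
    (hD : e + germGammaHat P + 1 ≤ D) : (germTree P).Admissible := by
  induction n using Nat.strong_induction_on generalizing P e with
  | _ n ih =>
  have he : (e : ℕ∞) ≤ D := by norm_cast; omega
  rcases hP.cases with hs | ⟨hs, hn | ⟨hn, ht | ⟨m, hm, hst | hN⟩⟩⟩
  · rw [germGammaHat_of_splits hs] at hD
    rw [germTree_of_splits hP hs, Tree.admissible_node]
    refine ⟨fun h => absurd h (not_isEmpty_iff.2 (nonempty_roots hs)), fun ρ => ?_⟩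
    have hρ := Multiset.mem_toFinset.1 ρ.2
    have h1 := Finset.le_sup (f := fun ρ => germGammaHat (factor P ρ)) ρ.2
    exact ih _ (hP.rootMultiplicity_lt hs hρ) (hP.factor hρ) (rootMultiplicity_pos_of_mem hP hρ)
      (hP.coefReg_factor hρ he hC) (by omega)
  · rw [germTree_of_le_one hP hs hn, Tree.admissible_leaf]
    intro; omega
  · rw [germTree_of_top hP hs hn ht, Tree.admissible_node]
    refine ⟨fun h => (h.false ⟨0, by omega⟩).elim, fun _ => Tree.admissible_leaf.2 fun _ => rfl⟩
  · rw [germGammaHat_of_not_strict hP hs hn hm hst] at hD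
    exact absurd (strict_of_coefReg (by omega) hP.center (hP.coefReg_center he hC) hm hD) hst
  · by_cases hd : m.den = 1
    · have hQ := hN.hasSlope hd
      rw [germGammaHat_of_int hP hs hn hN hd] at hD
      rw [germTree_of_int hP hs hn hN hd, Tree.admissible_node]
      refine ⟨fun h => absurd h (not_isEmpty_iff.2 (nonempty_roots hQ.splits_divide)), fun ρ => ?_⟩
      have hρ := Multiset.mem_toFinset.1 ρ.2
      have h1 := Finset.le_sup (f := fun ρ => germGammaHat (factor (divide n m.num.toNat (center P)) ρ)) ρ.2
      exact ih _ (hQ.germ_divide.rootMultiplicity_lt hQ.splits_divide hρ) (hQ.germ_divide.factor hρ)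
        (rootMultiplicity_pos_of_mem hQ.germ_divide hρ)
        (hQ.germ_divide.coefReg_factor hρ (by norm_cast; omega) (hQ.coefReg_divide (hP.coefReg_center he hC)))
        (by omega)
    · rw [germTree_of_frac hP hs hn hN hd, Tree.admissible_leaf]
      intro h
      exact absurd h hN.m_pos.ne'

end hat

section fair
variable {D e n r : ℕ} {P Q S : ℝ → ℂ[X]} {m : ℚ}

theorem Tree.height_node_pos {d : ℕ} {q : ℚ} {P : ℝ → ℂ[X]} {ι : Type} [Fintype ι] [Nonempty ι]
    {child : ι → Tree} : 0 < (Tree.node d q P ι child).height := by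
  rw [Tree.height_node]
  exact lt_of_lt_of_le (Nat.succ_pos _) (Finset.le_sup (f := fun i => (child i).height + 1)
    (Finset.mem_univ (Classical.arbitrary ι)))

theorem eq_one_of_height_zero (hP : IsGerm n P) (hG : (germTree P).Good)
    (hh : (germTree P).height = 0) : n = 1 := by
  rcases hP.cases with hs | ⟨hs, hn | ⟨hn, ht | ⟨m, hm, hst | hN⟩⟩⟩
  · have := nonempty_roots hs
    rw [germTree_of_splits hP hs] at hh
    exact absurd hh Tree.height_node_pos.ne'
  · rw [germTree_of_le_one hP hs hn, Tree.good_leaf] at hG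
    exact hG.1
  · have : Nonempty (Fin n) := ⟨⟨0, by omega⟩⟩
    rw [germTree_of_top hP hs hn ht] at hh
    exact absurd hh Tree.height_node_pos.ne'
  · rw [germTree_of_not_strict hP hs hn hm hst, Tree.good_leaf] at hG
    exact hG.1
  · by_cases hd : m.den = 1
    · have := nonempty_roots (hN.hasSlope hd).splits_divide
      rw [germTree_of_int hP hs hn hN hd] at hh
      exact absurd hh Tree.height_node_pos.ne'
    · rw [germTree_of_frac hP hs hn hN hd, Tree.good_leaf] at hG
      exact hG.1

theorem divide_congr (h : Q =ᶠ[𝓝 0] S) : divide n r Q =ᶠ[𝓝 0] divide n r S := by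
  have h1 : ∀ i, (fun t => (Q t).coeff i) =ᶠ[𝓝 0] fun t => (S t).coeff i := fun i =>
    h.mono fun t ht => by simp only [ht]
  have h2 : ∀ᶠ t in 𝓝 (0 : ℝ), ∀ i ∈ Finset.range n,
      divPow (fun s => (Q s).coeff i) ((n - i) * r) t = divPow (fun s => (S s).coeff i) ((n - i) * r) t := by
    rw [Finset.eventually_all]
    exact fun i _ => divPow_congr (h1 i)
  filter_upwards [h2] with t ht
  rw [divide, divide]
  congr 1
  exact Finset.sum_congr rfl fun i hi => by rw [ht i hi]

theorem HasSlope.congr (h : HasSlope n r S) (hQ : Q =ᶠ[𝓝 0] S) : HasSlope n r Q where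
  germ := h.germ.congr hQ
  next := by filter_upwards [h.next, hQ] with t h1 h2 using h2 ▸ h1
  div i hi := (h.div i hi).congr (hQ.mono fun t ht => by simp only [ht])
  strict := by
    obtain ⟨i, hi, h1⟩ := h.strict
    refine ⟨i, hi, ?_⟩
    rwa [(divPow_congr (g := fun t => (Q t).coeff i) (f := fun t => (S t).coeff i)
      (hQ.mono fun t ht => by simp only [ht])).self_of_nhds]

theorem HasSlope.newton (h : HasSlope n r S) (h0 : S 0 = X ^ n) : Newton n S (r : ℚ) := by
  have hst : ∃ k ∈ Finset.Icc 1 n, ∃ j : ℕ, (j : ℚ) = (k : ℚ) * (r : ℚ) ∧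
    (mult fun t => (S t).coeff (n - k)) = (j : ℕ∞) ∧
      divPow (fun t => (S t).coeff (n - k)) j 0 ≠ 0 := by
    obtain ⟨i, hi, hne⟩ := h.strict
    refine ⟨n - i, Finset.mem_Icc.2 ⟨by omega, by omega⟩, (n - i) * r, by push_cast; ring, ?_⟩
    rw [show n - (n - i) = i by omega]
    have h1 := (h.div i hi).divPow_spec
    exact ⟨mult_eq_of_ne_zero h1.1 h1.2 hne, hne⟩
  refine ⟨h.germ, h.pos, h0, h.next, slope_eq_of (fun k hk => ?_) ?_, hst⟩
  · have hk' := Finset.mem_Icc.1 hk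
    refine ⟨k * r, ?_, by push_cast; exact le_rfl⟩
    have := h.div (n - k) (by omega)
    rwa [show n - (n - k) = k by omega] at this
  · obtain ⟨k, hk, j, hj, hm, -⟩ := hst
    exact ⟨k, hk, j, hj, hm⟩

theorem center_eventuallyEq (h : IsGerm n S) (hn : 0 < n)
    (hnext : ∀ᶠ t in 𝓝 (0 : ℝ), (S t).coeff (n - 1) = 0) : center S =ᶠ[𝓝 0] S := by
  filter_upwards [h.monic, hnext] with t h1 h2
  rw [center_eq, shift, nextCoeff_of_natDegree_pos (by omega), h1.2, h2]
  simp

theorem not_splits_of_eq_X_pow (h0 : S 0 = X ^ n) : ¬ Splits S := by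
  rw [Splits, h0, roots_X_pow, not_lt]
  refine (Finset.card_le_card (t := {0}) fun x hx => ?_).trans (Finset.card_singleton _).le
  have := Multiset.mem_of_mem_nsmul (Multiset.mem_toFinset.1 hx)
  simpa using this

/-- If the tree of a germ with integral slope `r` is good of height `1`, the roots of `divide n r S 0`
are simple. -/
theorem HasSlope.simple_of_good (h : HasSlope n r S) (h0 : S 0 = X ^ n) (hn : 2 ≤ n)
    (hG : (germTree S).Good) (hh : (germTree S).height = 1) {ρ : ℂ} (hρ : ρ ∈ (divide n r S 0).roots) :
    (divide n r S 0).rootMultiplicity ρ = 1 := by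
  have hc := center_eventuallyEq h.germ (by omega) h.next
  have hs := not_splits_of_eq_X_pow h0
  have hN := (h.congr hc).newton (h.germ.center_zero hs (by omega))
  have hT := germTree_of_int h.germ hs hn hN (by simp)
  have hnum : ((r : ℚ).num.toNat) = r := by simp
  rw [hnum] at hT
  have hR := h.congr hc
  have hdc : divide n r (center S) 0 = divide n r S 0 := (divide_congr hc).self_of_nhds
  rw [← hdc] at hρ ⊢
  rw [hT, Tree.good_node] at hG
  rw [hT, Tree.height_node] at hh
  have h1 := Finset.le_sup (f := fun i : {ρ : ℂ // ρ ∈ (divide n r (center S) 0).roots.toFinset} =>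
    (germTree (factor (divide n r (center S)) i)).height + 1)
    (Finset.mem_univ ⟨ρ, Multiset.mem_toFinset.2 hρ⟩)
  rw [hh] at h1
  dsimp only at h1
  exact eq_one_of_height_zero (hR.germ_divide.factor hρ) (hG.2 ⟨ρ, Multiset.mem_toFinset.2 hρ⟩)
    (by omega)

theorem Newton.ramify_zero (h : Newton n Q m) (ε : ℝ) : ramify ε m.den Q 0 = X ^ n := by
  rw [ramify, zero_pow m.den_nz, mul_zero, h.zero]

theorem Newton.simple_of_fair (h : Newton n Q m) (hn : 2 ≤ n) {ε : ℝ} (hε : ε ≠ 0)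
    (hG : (germTree (ramify ε m.den Q)).Good) (hh : (germTree (ramify ε m.den Q)).height = 1) {ρ : ℂ}
    (hρ : ρ ∈ (divide n m.num.toNat (ramify ε m.den Q) 0).roots) :
    (divide n m.num.toNat (ramify ε m.den Q) 0).rootMultiplicity ρ = 1 :=
  (h.hasSlope_ramify hε).simple_of_good (h.ramify_zero ε) hn hG hh hρ

/-- The coefficients of `(Q^{±,N})_(r)`; the loss of weight is `⌈n m⌉` only, not `n r`. -/
theorem Newton.coefReg_divide_ramify (h : Newton n Q m) (hC : CoefReg D e Q) {ε : ℝ} (hε : ε ≠ 0)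
    (hD : e + ⌈(n : ℚ) * m⌉₊ ≤ D) : CoefReg D D (divide n m.num.toNat (ramify ε m.den Q)) := by
  refine .of_lt (n := n) (Eventually.of_forall fun t => ⟨monic_divide t, natDegree_divide_eq t⟩)
    fun i hi => ?_
  obtain ⟨u, hu, hQ, -, hS⟩ := h.ramify_div (ε := ε) hi
  have hur : WGerm D (e + ⌈((n - i : ℕ) : ℚ) * m⌉₊) u :=
    WGerm.of_pow_mul hu ((hC i).congr (hQ.mono fun t ht => ht.symm))
  have hle : ⌈((n - i : ℕ) : ℚ) * m⌉₊ ≤ ⌈(n : ℚ) * m⌉₊ := by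
    refine Nat.ceil_le_ceil (mul_le_mul_of_nonneg_right ?_ h.nonneg)
    exact_mod_cast Nat.sub_le _ _
  have hv := (((hur.mono_weight (show _ ≤ D by omega)).comp_power le_rfl m.den_nz hε).pow_mul
    (r := m.den * ⌈((n - i : ℕ) : ℚ) * m⌉₊ - (n - i) * m.num.toNat) (Nat.le_add_right _ _)).const_mul
    le_rfl ((ε : ℂ) ^ ⌈((n - i : ℕ) : ℚ) * m⌉₊)
  refine hv.congr ?_
  filter_upwards [divPow_eventuallyEq hv.continuousAt hS] with t ht
  simp only [coeff_divide, if_pos hi]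
  exact ht

/-- The recursions for `Γ` and `γ` at a vertex whose subtree is not good, in terms of `g = min γ(W)`. -/
theorem Tree.not_good_bounds {d : ℕ} {q : ℚ} {P : ℝ → ℂ[X]} {ι : Type} [Fintype ι] {child : ι → Tree}
    (h : ¬ (Tree.node d q P ι child).Good) : ∃ g : ℕ,
      (Tree.node d q P ι child).gamma = ⌊q⌋₊ + g ∧
      ∀ i, g ≤ (child i).gamma ∧ ⌈(d : ℚ) * q⌉₊ + (child i).Gamma ≤ (Tree.node d q P ι child).Gamma ∧
        ((Tree.node d q P ι child).Fair → (child i).Fair) := by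
  refine ⟨_, Tree.gamma_node_of_not_good h, fun i => ⟨ciInf_le (OrderBot.bddBelow _) i, ?_, fun hF => ?_⟩⟩
  · rw [Tree.Gamma_node]
    exact Nat.add_le_add_left (Finset.le_sup (f := fun i => (child i).Gamma) (Finset.mem_univ i)) _
  · exact ⟨(Tree.admissible_node.1 hF.1).2 i, (Tree.badLeavesFair_node.1 hF.2).2 i⟩

/-- Roots of weight `D - γ`, that is, of class `C^γ`.  The two alternatives in the hypothesis ensure that the
ramified germs at a leaf with fractional slope have roots of weight `D`: these roots are simple for a
fair leaf, and are provided by `rootsIn_of_gammaHat` in the other case. -/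
theorem rootsIn_of_fair (hP : IsGerm n P) (hC : CoefReg D e P) (hS : Sep P)
    (hH : (germTree P).Fair ∨ e + germGammaHat P + 1 ≤ D) (hD : e + (germTree P).Gamma ≤ D) :
    RootsIn D (D - (germTree P).gamma) P := by
  induction n using Nat.strong_induction_on generalizing P e with
  | _ n ih =>
  have he : (e : ℕ∞) ≤ D := by norm_cast; omega
  have hγ := gamma_le_Gamma_germTree hP
  by_cases hG : (germTree P).Good
  · exact (rootsIn_of_good hP hC hG hS (by exact_mod_cast hD)).mono_weight (by omega)
  rcases hP.cases with hs | ⟨hs, hn | ⟨hn, ht | ⟨m, hm, hst | hN⟩⟩⟩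
  · have hT := germTree_of_splits hP hs
    obtain ⟨g, hg, hch⟩ := Tree.not_good_bounds (hT ▸ hG)
    rw [← hT] at hg hch
    rw [Nat.floor_zero, zero_add] at hg
    refine .of_factors hP fun ρ hρ => ?_
    obtain ⟨h1, h2, h3⟩ := hch ⟨ρ, Multiset.mem_toFinset.2 hρ⟩
    dsimp only at h1 h2 h3
    refine (ih _ (hP.rootMultiplicity_lt hs hρ) (hP.factor hρ) (hP.coefReg_factor hρ he hC)
      (hS.factor ρ) ?_ (by omega)).mono_weight (by omega)
    refine hH.imp h3 fun hF => ?_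
    rw [germGammaHat_of_splits hs] at hF
    have h1 := Finset.le_sup (f := fun ρ => germGammaHat (factor P ρ)) (Multiset.mem_toFinset.2 hρ)
    omega
  · refine (RootsIn.of_le_one hP hn hC he).mono_weight ?_
    omega
  · exact .of_center hP hC he (by omega) (.of_eventually_eq (n := n) (hP.center_top hs hn ht hS))
  · refine absurd ?_ hst
    rcases hH with hF | hF
    · have := hF.1
      rw [germTree_of_not_strict hP hs hn hm hst, Tree.admissible_leaf] at this
      have := this rfl
      omega
    · rw [germGammaHat_of_not_strict hP hs hn hm hst] at hF
      exact strict_of_coefReg (by omega) hP.center (hP.coefReg_center he hC) hm hF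
  · by_cases hd : m.den = 1
    · have hQ := hN.hasSlope hd
      have hT := germTree_of_int hP hs hn hN hd
      obtain ⟨g, hg, hch⟩ := Tree.not_good_bounds (hT ▸ hG)
      rw [← hT] at hg hch
      rw [(hN.ceil_mul hd).2] at hg
      rw [(hN.ceil_mul hd).1] at hch
      refine .of_center hP hC he (by omega) (.of_divide hQ (E := D - g)
        (.of_factors hQ.germ_divide fun ρ hρ => ?_) (by omega))
      obtain ⟨h1, h2, h3⟩ := hch ⟨ρ, Multiset.mem_toFinset.2 hρ⟩
      dsimp only at h1 h2 h3
      refine (ih _ (hQ.germ_divide.rootMultiplicity_lt hQ.splits_divide hρ) (hQ.germ_divide.factor hρ)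
        (hQ.germ_divide.coefReg_factor hρ (by norm_cast; omega)
          (hQ.coefReg_divide (hP.coefReg_center he hC)))
        (((hS.center hP).divide hQ).factor ρ) ?_ (by omega)).mono_weight (by omega)
      refine hH.imp h3 fun hF => ?_
      rw [germGammaHat_of_int hP hs hn hN hd] at hF
      have h3 := Finset.le_sup (f := fun ρ => germGammaHat (factor (divide n m.num.toNat (center P)) ρ))
        (Multiset.mem_toFinset.2 hρ)
      omega
    · have hT := germTree_of_frac hP hs hn hN hd
      have hΓ : (germTree P).Gamma = ⌈(n : ℚ) * m⌉₊ := by rw [hT, Tree.Gamma_leaf]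
      have hγ' : (germTree P).gamma = ⌊m⌋₊ := by rw [hT, Tree.gamma_leaf]
      have hQC := hP.coefReg_center he hC
      rw [hγ']
      refine .of_center hP hC he (by omega) (hN.rootsIn hd (by omega) fun ε hε => ?_)
      have hε0 : ε ≠ 0 := by rcases hε with rfl | rfl <;> norm_num
      have hε1 : |ε| = 1 := by rcases hε with rfl | rfl <;> norm_num
      have hR := hN.hasSlope_ramify hε0
      rcases hH with hF | hF
      · rw [hT] at hF
        have h1 := (Tree.badLeavesFair_node.1 hF.2).1 inferInstance (by omega) ε hε
        refine .of_factors hR.germ_divide fun ρ hρ => ?_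
        exact .of_le_one (hR.germ_divide.factor hρ) (hN.simple_of_fair hn hε0 h1.1 h1.2 hρ).le
          (hR.germ_divide.coefReg_factor hρ le_rfl
            (hN.coefReg_divide_ramify hQC hε0 (by omega))) le_rfl
      · have h1 := le_germGammaHat_of_frac hP hs hn hN hd hε
        exact rootsIn_divide_of_factors hR (Newton.coefReg_ramify hQC he m.den_nz hε0)
          ((hS.center hP).ramify m.den_nz hε1)
          (fun ρ hρ h1 h2 h3 => rootsIn_of_gammaHat (hR.germ_divide.factor hρ) h1 h2 h3) (by omega)

end fair

/-! ### Counting roots at a resolution -/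

/-- For every `K`, along `l`, no more than `ν` roots of `P t` are pairwise more than `|t|^K` apart. -/
def Upper (l : Filter ℝ) (P : ℝ → ℂ[X]) (ν : ℕ) : Prop :=
  ∀ K : ℕ, ∀ᶠ t in l, ∀ S : Finset ℂ, (∀ z ∈ S, z ∈ (P t).roots) →
    (∀ z ∈ S, ∀ w ∈ S, z ≠ w → |t| ^ K < dist z w) → S.card ≤ ν

/-- For some `K`, along `l`, at least `ν` roots of `P t` are pairwise at least `|t|^K` apart. -/
def Lower (l : Filter ℝ) (P : ℝ → ℂ[X]) (ν : ℕ) : Prop :=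
  ∃ K : ℕ, ∀ᶠ t in l, ∃ S : Finset ℂ, (∀ z ∈ S, z ∈ (P t).roots) ∧
    (∀ z ∈ S, ∀ w ∈ S, z ≠ w → |t| ^ K ≤ dist z w) ∧ ν ≤ S.card

section counts
variable {l : Filter ℝ} {P R : ℝ → ℂ[X]} {ν n r : ℕ}

theorem eventually_pos_lt (hl : l ≤ 𝓝[≠] 0) {c : ℝ} (hc : 0 < c) : ∀ᶠ t in l, 0 < |t| ∧ |t| < c := by
  filter_upwards [hl (eventually_abs_lt hc), hl self_mem_nhdsWithin] with t h1 h2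
  exact ⟨abs_pos.2 h2, h1⟩

theorem Upper.of_degree (h : ∀ᶠ t in l, (P t).natDegree ≤ n) : Upper l P n := by
  intro K
  filter_upwards [h] with t ht S hS _
  refine le_trans ?_ ((card_roots' (P t)).trans ht)
  classical
  calc S.card ≤ (P t).roots.toFinset.card :=
        Finset.card_le_card fun z hz => Multiset.mem_toFinset.2 (hS z hz)
    _ ≤ _ := Multiset.toFinset_card_le _

theorem Lower.one (h : ∀ᶠ t in l, 0 < (P t).natDegree) : Lower l P 1 := by
  refine ⟨0, h.mono fun t ht => ?_⟩
  rw [← card_roots_eq] at ht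
  obtain ⟨z, hz⟩ := Multiset.card_pos_iff_exists_mem.1 ht
  refine ⟨{z}, by simpa using hz, ?_, by simp⟩
  intro a ha b hb hab
  simp only [Finset.mem_singleton] at ha hb
  exact absurd (ha.trans hb.symm) hab

theorem Lower.zero : Lower l P 0 :=
  ⟨0, Eventually.of_forall fun t => ⟨∅, by simp, by simp, le_rfl⟩⟩

theorem Lower.le_of_upper {ν' : ℕ} [l.NeBot] (hl : l ≤ 𝓝[≠] 0) (h : Lower l P ν) (h' : Upper l P ν') :
    ν ≤ ν' := by
  obtain ⟨K, hK⟩ := h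
  obtain ⟨t, ⟨S, h1, h2, h3⟩, h4, h5⟩ := (hK.and ((h' (K + 1)).and (eventually_pos_lt hl one_pos))).exists
  refine h3.trans (h4 S h1 fun z hz w hw hzw => lt_of_lt_of_le ?_ (h2 z hz w hw hzw))
  exact pow_lt_pow_right_of_lt_one₀ h5.1 h5.2 (Nat.lt_succ_self K)

theorem Upper.sup {l' : Filter ℝ} (h : Upper l P ν) (h' : Upper l' P ν) : Upper (l ⊔ l') P ν :=
  fun K => eventually_sup.2 ⟨h K, h' K⟩

/-- The exponent in `Lower` may be enlarged. -/
theorem Lower.exists_ge (hl : l ≤ 𝓝[≠] 0) (h : Lower l P ν) : ∃ K₀ : ℕ, ∀ K ≥ K₀, ∀ᶠ t in l,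
    ∃ S : Finset ℂ, (∀ z ∈ S, z ∈ (P t).roots) ∧
    (∀ z ∈ S, ∀ w ∈ S, z ≠ w → |t| ^ K ≤ dist z w) ∧ ν ≤ S.card := by
  obtain ⟨K₀, h⟩ := h
  refine ⟨K₀, fun K hK => ?_⟩
  filter_upwards [h, eventually_pos_lt hl one_pos] with t ⟨S, h1, h2, h3⟩ h4
  exact ⟨S, h1, fun z hz w hw hzw =>
    (pow_le_pow_of_le_one h4.1.le h4.2.le hK).trans (h2 z hz w hw hzw), h3⟩

theorem Lower.sup {l' : Filter ℝ} (hl : l ≤ 𝓝[≠] 0) (hl' : l' ≤ 𝓝[≠] 0) (h : Lower l P ν)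
    (h' : Lower l' P ν) : Lower (l ⊔ l') P ν := by
  obtain ⟨K, hK⟩ := h.exists_ge hl
  obtain ⟨K', hK'⟩ := h'.exists_ge hl'
  exact ⟨max K K', eventually_sup.2 ⟨hK _ (le_max_left _ _), hK' _ (le_max_right _ _)⟩⟩

theorem Upper.of_affine (a b : ℝ → ℂ) (h : Upper l R ν)
    (hab : ∀ᶠ t in l, ‖a t‖ ≤ 1 ∧ (P t).roots = (R t).roots.map fun z => a t * z + b t) :
    Upper l P ν := by
  classical
  intro K
  filter_upwards [h K, hab] with t h1 ⟨h2, h3⟩ S hS hsep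
  choose! g hg using fun z (hz : z ∈ S) => Multiset.mem_map.1 (h3 ▸ hS z hz)
  have hinj : Set.InjOn g S := fun z hz w hw h => by
    rw [← (hg z hz).2, h, (hg w hw).2]
  rw [← Finset.card_image_of_injOn hinj]
  refine h1 _ (fun z hz => ?_) fun z hz w hw hzw => ?_
  · obtain ⟨x, hx, rfl⟩ := Finset.mem_image.1 hz
    exact (hg x hx).1
  · obtain ⟨x, hx, rfl⟩ := Finset.mem_image.1 hz
    obtain ⟨y, hy, rfl⟩ := Finset.mem_image.1 hw
    have h4 := hsep x hx y hy fun h => hzw (by rw [h])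
    rw [← (hg x hx).2, ← (hg y hy).2, dist_add_right, dist_eq_norm, ← mul_sub, norm_mul,
      ← dist_eq_norm] at h4
    exact h4.trans_le (mul_le_of_le_one_left dist_nonneg h2)

theorem Lower.of_affine (a b : ℝ → ℂ) (r : ℕ) (hl : l ≤ 𝓝[≠] 0) (h : Lower l R ν)
    (hab : ∀ᶠ t in l, |t| ^ r ≤ ‖a t‖ ∧ (P t).roots = (R t).roots.map fun z => a t * z + b t) :
    Lower l P ν := by
  classical
  obtain ⟨K, hK⟩ := h
  refine ⟨r + K, ?_⟩
  filter_upwards [hK, hab, eventually_pos_lt hl one_pos] with t ⟨S, h1, h2, h3⟩ ⟨h4, h5⟩ h6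
  have ha : a t ≠ 0 := by
    have := (pow_pos h6.1 r).trans_le h4
    exact norm_pos_iff.1 this
  have hinj : Function.Injective fun z => a t * z + b t := fun z w h =>
    mul_left_cancel₀ ha (add_right_cancel h)
  refine ⟨S.image fun z => a t * z + b t, fun z hz => ?_, fun z hz w hw hzw => ?_, ?_⟩
  · obtain ⟨x, hx, rfl⟩ := Finset.mem_image.1 hz
    rw [h5]
    exact Multiset.mem_map_of_mem _ (h1 x hx)
  · obtain ⟨x, hx, rfl⟩ := Finset.mem_image.1 hz
    obtain ⟨y, hy, rfl⟩ := Finset.mem_image.1 hw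
    rw [dist_add_right, dist_eq_norm, ← mul_sub, norm_mul, ← dist_eq_norm, pow_add]
    exact mul_le_mul h4 (h2 x hx y hy fun h => hzw (by rw [h])) (by positivity) (norm_nonneg _)
  · rwa [Finset.card_image_of_injective _ hinj]

theorem mem_near_roots {p₀ p : ℂ[X]} {ρ z : ℂ} (hz : z ∈ (near p₀ ρ p).roots) : z ∈ p.roots :=
  Multiset.mem_of_le (roots_near_le _ _ _) hz

/-- Roots near `p₀` are roots of one of the factors `near p₀ ρ`, and are close to `ρ`. -/
theorem eventually_near_roots {p₀ : ℂ[X]} (h₀ : p₀.Monic) (hn : p₀.natDegree = n) {ε : ℝ} (hε : 0 < ε) :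
    ∀ᶠ c in 𝓝 (coeffs n p₀), (∀ z ∈ (ofCoeffs n c).roots, ∃ ρ ∈ p₀.roots.toFinset,
      z ∈ (near p₀ ρ (ofCoeffs n c)).roots) ∧
      ∀ ρ, ∀ z ∈ (near p₀ ρ (ofCoeffs n c)).roots, ρ ∈ p₀.roots → dist z ρ < ε := by
  filter_upwards [eventually_prod_near h₀ hn, eventually_roots_near h₀ hn hε] with c h1 h2
  refine ⟨fun z hz => ?_, fun ρ z hz hρ => ?_⟩
  · rw [← h1, roots_prod _ _ (Finset.prod_ne_zero_iff.2 fun ρ _ => (monic_near p₀ ρ _).ne_zero),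
      Multiset.mem_bind] at hz
    obtain ⟨ρ, hρ, hz⟩ := hz
    exact ⟨ρ, hρ, hz⟩
  · obtain ⟨σ, hσ, hd⟩ := h2 z (mem_near_roots hz)
    rw [roots_near, Multiset.mem_filter] at hz
    exact (hz.2 σ hσ).trans_lt hd

/-- The roots that stay apart are counted factor by factor. -/
theorem Upper.of_near {p₀ : ℂ[X]} (h₀ : p₀.Monic) (hn : p₀.natDegree = n)
    (hP : ∀ᶠ t in l, (P t).Monic ∧ (P t).natDegree = n)
    (hc : Tendsto (fun t => coeffs n (P t)) l (𝓝 (coeffs n p₀)))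
    (ν : ℂ → ℕ) (h : ∀ ρ ∈ p₀.roots.toFinset, Upper l (fun t => near p₀ ρ (P t)) (ν ρ)) :
    Upper l P (∑ ρ ∈ p₀.roots.toFinset, ν ρ) := by
  classical
  intro K
  have h1 : ∀ᶠ t in l, ∀ ρ ∈ p₀.roots.toFinset, _ := (Finset.eventually_all _).2 fun ρ hρ => h ρ hρ K
  filter_upwards [h1, hP, hc.eventually (eventually_near_roots h₀ hn one_pos)] with t h1 h2 h3 S hS hsep
  rw [ofCoeffs_coeffs h2.1 h2.2] at h3
  calc S.card ≤ (p₀.roots.toFinset.biUnion fun ρ =>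
        S.filter fun z => z ∈ (near p₀ ρ (P t)).roots).card := by
        refine Finset.card_le_card fun z hz => ?_
        obtain ⟨ρ, hρ, hz'⟩ := h3.1 z (hS z hz)
        exact Finset.mem_biUnion.2 ⟨ρ, hρ, Finset.mem_filter.2 ⟨hz, hz'⟩⟩
    _ ≤ ∑ ρ ∈ p₀.roots.toFinset, (S.filter fun z => z ∈ (near p₀ ρ (P t)).roots).card :=
        Finset.card_biUnion_le
    _ ≤ _ := Finset.sum_le_sum fun ρ hρ => h1 ρ hρ _ (fun z hz => (Finset.mem_filter.1 hz).2)
        fun z hz w hw => hsep z (Finset.mem_filter.1 hz).1 w (Finset.mem_filter.1 hw).1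

/-- Separated roots of the factors are separated, as the roots of different factors have positive distance. -/
theorem Lower.of_near {p₀ : ℂ[X]} (h₀ : p₀.Monic) (hn : p₀.natDegree = n)
    (hP : ∀ᶠ t in l, (P t).Monic ∧ (P t).natDegree = n)
    (hc : Tendsto (fun t => coeffs n (P t)) l (𝓝 (coeffs n p₀)))
    (hl : l ≤ 𝓝[≠] 0) (ν : ℂ → ℕ)
    (h : ∀ ρ ∈ p₀.roots.toFinset, Lower l (fun t => near p₀ ρ (P t)) (ν ρ)) :
    Lower l P (∑ ρ ∈ p₀.roots.toFinset, ν ρ) := by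
  classical
  choose! K₀ hK₀ using fun ρ (hρ : ρ ∈ p₀.roots.toFinset) => (h ρ hρ).exists_ge hl
  set K := 1 + p₀.roots.toFinset.sup K₀ with hK
  have h1 : ∀ᶠ t in l, ∀ ρ ∈ p₀.roots.toFinset, _ := (Finset.eventually_all _).2 fun ρ hρ =>
    hK₀ ρ hρ K ((Finset.le_sup (f := K₀) hρ).trans (Nat.le_add_left _ _))
  obtain ⟨ε, hε, hgap⟩ := exists_gap p₀
  refine ⟨K, ?_⟩
  filter_upwards [h1, hP, hc.eventually (eventually_near_roots h₀ hn (half_pos hε)),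
    eventually_pos_lt hl (lt_min one_pos hε)] with t h1 h2 h3 h4
  rw [ofCoeffs_coeffs h2.1 h2.2] at h3
  choose! S hS hsep hcard using h1
  have hKt : |t| ^ K ≤ ε := by
    rw [hK, pow_add, pow_one]
    refine (mul_le_of_le_one_right h4.1.le ?_).trans (h4.2.le.trans (min_le_right _ _))
    exact pow_le_one₀ h4.1.le (h4.2.le.trans (min_le_left _ _))
  have hfar : ∀ ρ ∈ p₀.roots.toFinset, ∀ σ ∈ p₀.roots.toFinset, ρ ≠ σ → ∀ z ∈ S ρ, ∀ w ∈ S σ,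
      ε ≤ dist z w := by
    intro ρ hρ σ hσ hne z hz w hw
    have h5 := hgap ρ (Multiset.mem_toFinset.1 hρ) σ (Multiset.mem_toFinset.1 hσ) hne
    have h6 := h3.2 ρ z (hS ρ hρ z hz) (Multiset.mem_toFinset.1 hρ)
    have h7 := h3.2 σ w (hS σ hσ w hw) (Multiset.mem_toFinset.1 hσ)
    have h8 := dist_triangle4 ρ z w σ
    rw [dist_comm ρ z] at h8
    linarith
  refine ⟨p₀.roots.toFinset.biUnion S, fun z hz => ?_, fun z hz w hw hzw => ?_, ?_⟩
  · obtain ⟨ρ, hρ, hz⟩ := Finset.mem_biUnion.1 hz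
    exact mem_near_roots (hS ρ hρ z hz)
  · obtain ⟨ρ, hρ, hz⟩ := Finset.mem_biUnion.1 hz
    obtain ⟨σ, hσ, hw⟩ := Finset.mem_biUnion.1 hw
    by_cases hne : ρ = σ
    · subst hne
      exact hsep ρ hρ z hz w hw hzw
    · exact hKt.trans (hfar ρ hρ σ hσ hne z hz w hw)
  · rw [Finset.card_biUnion]
    · exact Finset.sum_le_sum fun ρ hρ => hcard ρ hρ
    · intro ρ hρ σ hσ hne
      rw [Function.onFun, Finset.disjoint_left]
      intro z hz hz'
      have := hfar ρ hρ σ hσ hne z hz z hz'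
      rw [dist_self] at this
      linarith

end counts

/-- The filter of the points `σ s`, `s → 0+`. -/
def side (σ : ℝ) : Filter ℝ := (𝓝[>] (0 : ℝ)).map fun s => σ * s

section side
variable {σ : ℝ} {P R : ℝ → ℂ[X]} {ν n N : ℕ}

theorem side_one : side 1 = 𝓝[>] 0 := by
  rw [side]; simp

theorem side_le (hσ : σ ≠ 0) : side σ ≤ 𝓝[≠] 0 := by
  have h := Sep.tendsto_power_ne (N := 1) one_ne_zero hσ
  simp only [pow_one] at h
  exact h.mono_left (nhdsWithin_mono _ fun x hx => ne_of_gt hx)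

theorem punctured_le : 𝓝[≠] (0 : ℝ) ≤ side 1 ⊔ side (-1) := by
  intro s hs
  rw [Filter.mem_sup, side_one, side, Filter.mem_map] at hs
  rw [← Set.Iio_union_Ioi, nhdsWithin_union, Filter.mem_sup]
  refine ⟨?_, hs.1⟩
  have h : Tendsto (fun x : ℝ => -x) (𝓝[<] 0) (𝓝[>] 0) := by
    have := tendsto_neg_nhdsLT (a := (0 : ℝ))
    simpa using this
  exact mem_of_superset (h hs.2) fun x hx => by simpa using hx

instance : (side σ).NeBot := by unfold side; infer_instance

theorem tendsto_root (hN : N ≠ 0) : Tendsto (fun s : ℝ => s ^ (N : ℝ)⁻¹) (𝓝[>] 0) (𝓝[>] 0) := by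
  have hN' : (0 : ℝ) < (N : ℝ)⁻¹ := by
    have : (0 : ℝ) < N := by exact_mod_cast Nat.pos_of_ne_zero hN
    positivity
  refine tendsto_nhdsWithin_of_tendsto_nhds_of_eventually_within _ ?_ ?_
  · have : Continuous fun s : ℝ => s ^ (N : ℝ)⁻¹ := Real.continuous_rpow_const hN'.le
    have h := this.tendsto 0
    rw [Real.zero_rpow hN'.ne'] at h
    exact h.mono_left nhdsWithin_le_nhds
  · filter_upwards [self_mem_nhdsWithin] with s hs
    exact Real.rpow_pos_of_pos hs _

theorem Upper.of_ramify (hN : N ≠ 0) (hσ : |σ| = 1) (h : Upper (𝓝[>] 0) (ramify σ N P) ν) :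
    Upper (side σ) P ν := by
  intro K
  rw [side, eventually_map]
  filter_upwards [(tendsto_root hN).eventually (h (N * K)), self_mem_nhdsWithin] with s h1 h2
  have h3 : (s ^ (N : ℝ)⁻¹) ^ N = s := Real.rpow_inv_natCast_pow (le_of_lt h2) hN
  rw [ramify, pow_mul, ← abs_pow, h3] at h1
  rwa [abs_mul, hσ, one_mul]

theorem Lower.of_ramify (hN : N ≠ 0) (hσ : |σ| = 1) (h : Lower (𝓝[>] 0) (ramify σ N P) ν) :
    Lower (side σ) P ν := by
  obtain ⟨K, h⟩ := h
  refine ⟨K, ?_⟩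
  rw [side, eventually_map]
  have h0 : 𝓝[>] (0 : ℝ) ≤ 𝓝[≠] 0 := nhdsWithin_mono _ fun x hx => ne_of_gt hx
  filter_upwards [(tendsto_root hN).eventually (h.and (eventually_pos_lt h0 one_pos)),
    self_mem_nhdsWithin] with s ⟨⟨S, h1, h2, h3⟩, h4⟩ h5
  have h6 : (s ^ (N : ℝ)⁻¹) ^ N = s := Real.rpow_inv_natCast_pow (le_of_lt h5) hN
  rw [ramify, h6] at h1
  refine ⟨S, h1, fun z hz w hw hzw => le_trans ?_ (h2 z hz w hw hzw), h3⟩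
  rw [abs_mul, hσ, one_mul]
  refine pow_le_pow_left₀ (abs_nonneg _) ?_ _
  conv_lhs => rw [← h6, abs_pow]
  exact pow_le_of_le_one h4.1.le h4.2.le hN

end side

/-! ### Counting the roots of fair germs -/

section fairCounts
variable {l : Filter ℝ} {P Q S : ℝ → ℂ[X]} {ν n r : ℕ} {m : ℚ}

theorem Upper.mono {l' : Filter ℝ} (h : Upper l P ν) (hl : l' ≤ l) : Upper l' P ν := fun K => hl (h K)

theorem Lower.mono {l' : Filter ℝ} (h : Lower l P ν) (hl : l' ≤ l) : Lower l' P ν :=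
  h.imp fun _ hK => hl hK

theorem roots_eq_center {t : ℝ} (h : (P t).Monic) :
    (P t).roots = (center P t).roots.map fun z => 1 * z + -shift P t := by
  rw [center_eq, roots_comp_X_sub_C h, Multiset.map_map]
  simp

theorem Upper.of_center (h : Upper l (center P) ν) (hP : ∀ᶠ t in l, (P t).Monic) : Upper l P ν :=
  h.of_affine (fun _ => 1) (fun t => -shift P t) (hP.mono fun t ht => ⟨by simp, roots_eq_center ht⟩)

theorem Lower.of_center (hl : l ≤ 𝓝[≠] 0) (h : Lower l (center P) ν) (hP : ∀ᶠ t in l, (P t).Monic) :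
    Lower l P ν :=
  h.of_affine (fun _ => 1) (fun t => -shift P t) 0 hl
    (hP.mono fun t ht => ⟨by simp, roots_eq_center ht⟩)

theorem Upper.of_divide (hl : l ≤ 𝓝[≠] 0) (hS : HasSlope n r S) (h : Upper l (divide n r S) ν) :
    Upper l S ν := by
  refine h.of_affine (fun t => (t : ℂ) ^ r) (fun _ => 0) ?_
  filter_upwards [(hl.trans nhdsWithin_le_nhds) hS.roots, eventually_pos_lt hl one_pos] with t h1 h2
  refine ⟨?_, by simpa using h1⟩
  rw [norm_pow, Complex.norm_real, Real.norm_eq_abs]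
  exact pow_le_one₀ h2.1.le h2.2.le

theorem Lower.of_divide (hl : l ≤ 𝓝[≠] 0) (hS : HasSlope n r S) (h : Lower l (divide n r S) ν) :
    Lower l S ν := by
  refine h.of_affine (fun t => (t : ℂ) ^ r) (fun _ => 0) r hl ?_
  filter_upwards [(hl.trans nhdsWithin_le_nhds) hS.roots] with t h1
  refine ⟨?_, by simpa using h1⟩
  rw [norm_pow, Complex.norm_real, Real.norm_eq_abs]

/-- If all coefficients vanish to infinite order, no two roots stay apart. -/
theorem Upper.of_flat (hQ : IsGerm n Q) (ht : slope n Q = ⊤) : Upper (𝓝[≠] 0) Q 1 := by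
  intro K
  filter_upwards [flat_roots hQ ht (K + 1), eventually_pos_lt le_rfl (show (0 : ℝ) < 1 / 4 by norm_num)]
    with t h1 h2 S hS hsep
  refine Finset.card_le_one.2 fun z hz w hw => ?_
  by_contra hzw
  have h3 := hsep z hz w hw hzw
  have h4 := h1 z (hS z hz)
  have h5 := h1 w (hS w hw)
  have h6 := dist_le_norm_add_norm z w
  have h7 := pow_pos h2.1 K
  rw [pow_succ] at h4 h5
  nlinarith

theorem IsGerm.upper_of_factors (hP : IsGerm n P) (hl : l ≤ 𝓝 0) (ν : ℂ → ℕ)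
    (h : ∀ ρ ∈ (P 0).roots.toFinset, Upper l (RootCurve.factor P ρ) (ν ρ)) :
    Upper l P (∑ ρ ∈ (P 0).roots.toFinset, ν ρ) :=
  Upper.of_near hP.monic_zero hP.natDegree_zero (hl hP.monic) (hP.tendsto.mono_left hl) ν h

theorem IsGerm.lower_of_factors (hP : IsGerm n P) (hl : l ≤ 𝓝[≠] 0) (ν : ℂ → ℕ)
    (h : ∀ ρ ∈ (P 0).roots.toFinset, Lower l (RootCurve.factor P ρ) (ν ρ)) :
    Lower l P (∑ ρ ∈ (P 0).roots.toFinset, ν ρ) :=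
  Lower.of_near hP.monic_zero hP.natDegree_zero ((hl.trans nhdsWithin_le_nhds) hP.monic)
    (hP.tendsto.mono_left (hl.trans nhdsWithin_le_nhds)) hl ν h

/-- Simple roots of `P 0` stay apart. -/
theorem lower_of_simple (hP : IsGerm n P) (hl : l ≤ 𝓝[≠] 0)
    (h : ∀ ρ ∈ (P 0).roots, (P 0).rootMultiplicity ρ = 1) : Lower l P n := by
  have h1 := hP.lower_of_factors hl (fun _ => 1) fun ρ hρ => by
    have hρ' := Multiset.mem_toFinset.1 hρ
    refine Lower.one ((hl.trans nhdsWithin_le_nhds) ((hP.factor hρ').monic.mono fun t ht => ?_))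
    rw [ht.2, h ρ hρ']
    exact one_pos
  rw [Finset.sum_const, smul_eq_mul, mul_one] at h1
  have h2 : (P 0).roots.Nodup := by
    classical
    rw [Multiset.nodup_iff_count_le_one]
    intro ρ
    by_cases hρ : ρ ∈ (P 0).roots
    · rw [count_roots, h ρ hρ]
    · rw [Multiset.count_eq_zero_of_notMem hρ]; exact Nat.zero_le _
  rwa [Multiset.toFinset_card_of_nodup h2, card_roots_eq, hP.natDegree_zero] at h1

/-- For fair germs the number of roots that stay apart is determined by the tree: at a vertex of infinite
slope only one root does, at a fair leaf all of them do. -/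
theorem counts_of_fair (hP : IsGerm n P) (hF : (germTree P).Fair) :
    ∃ ν, Upper (𝓝[≠] 0) P ν ∧ Lower (𝓝[≠] 0) P ν := by
  induction n using Nat.strong_induction_on generalizing P with
  | _ n ih =>
  have hmon : ∀ᶠ t in 𝓝[≠] (0 : ℝ), (P t).Monic := nhdsWithin_le_nhds (hP.monic.mono fun t h => h.1)
  have hfac : ∀ {k : ℕ} {R : ℝ → ℂ[X]}, IsGerm k R →
      (∀ ρ ∈ (R 0).roots, ∃ ν, Upper (𝓝[≠] 0) (factor R ρ) ν ∧ Lower (𝓝[≠] 0) (factor R ρ) ν) →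
      ∃ ν, Upper (𝓝[≠] 0) R ν ∧ Lower (𝓝[≠] 0) R ν := by
    intro k R hR h
    choose! ν h1 h2 using h
    exact ⟨_, hR.upper_of_factors nhdsWithin_le_nhds ν fun ρ hρ => h1 ρ (Multiset.mem_toFinset.1 hρ),
      hR.lower_of_factors le_rfl ν fun ρ hρ => h2 ρ (Multiset.mem_toFinset.1 hρ)⟩
  rcases hP.cases with hs | ⟨hs, hn | ⟨hn, hcase⟩⟩
  · refine hfac hP fun ρ hρ => ih _ (hP.rootMultiplicity_lt hs hρ) (hP.factor hρ) ?_
    rw [germTree_of_splits hP hs] at hF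
    exact ⟨(Tree.admissible_node.1 hF.1).2 ⟨ρ, Multiset.mem_toFinset.2 hρ⟩,
        (Tree.badLeavesFair_node.1 hF.2).2 ⟨ρ, Multiset.mem_toFinset.2 hρ⟩⟩
  · refine ⟨n, .of_degree (nhdsWithin_le_nhds (hP.monic.mono fun t h => h.2.le)), ?_⟩
    interval_cases n
    · exact .zero
    · exact .one (nhdsWithin_le_nhds (hP.monic.mono fun t h => by omega))
  · suffices h : ∃ ν, Upper (𝓝[≠] 0) (center P) ν ∧ Lower (𝓝[≠] 0) (center P) ν by
      obtain ⟨ν, h1, h2⟩ := h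
      exact ⟨ν, h1.of_center hmon, h2.of_center le_rfl hmon⟩
    rcases hcase with ht | ⟨m, hm, hst | hN⟩
    · exact ⟨1, .of_flat hP.center ht, .one (nhdsWithin_le_nhds (hP.center.monic.mono fun t h => by omega))⟩
    · have := hF.1
      rw [germTree_of_not_strict hP hs hn hm hst, Tree.admissible_leaf] at this
      have := this rfl
      omega
    by_cases hd : m.den = 1
    · have hQ := hN.hasSlope hd
      rw [germTree_of_int hP hs hn hN hd] at hF
      obtain ⟨ν, h1, h2⟩ := hfac hQ.germ_divide fun ρ hρ =>
        ih _ (hQ.germ_divide.rootMultiplicity_lt hQ.splits_divide hρ) (hQ.germ_divide.factor hρ)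
        ⟨(Tree.admissible_node.1 hF.1).2 ⟨ρ, Multiset.mem_toFinset.2 hρ⟩,
        (Tree.badLeavesFair_node.1 hF.2).2 ⟨ρ, Multiset.mem_toFinset.2 hρ⟩⟩
      exact ⟨ν, h1.of_divide le_rfl hQ, h2.of_divide le_rfl hQ⟩
    · rw [germTree_of_frac hP hs hn hN hd] at hF
      refine ⟨n, .of_degree (nhdsWithin_le_nhds (hP.center.monic.mono fun t h => h.2.le)), ?_⟩
      have hside : ∀ ε : ℝ, ε = 1 ∨ ε = -1 → Lower (side ε) (center P) n := by
        intro ε hε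
        have hε0 : ε ≠ 0 := by rcases hε with rfl | rfl <;> norm_num
        have hε1 : |ε| = 1 := by rcases hε with rfl | rfl <;> norm_num
        have hR := hN.hasSlope_ramify hε0
        have h1 := (Tree.badLeavesFair_node.1 hF.2).1 inferInstance (by omega) ε hε
        have hle : 𝓝[>] (0 : ℝ) ≤ 𝓝[≠] 0 := nhdsWithin_mono _ fun x hx => ne_of_gt hx
        exact ((lower_of_simple hR.germ_divide hle fun ρ hρ =>
          hN.simple_of_fair hn hε0 h1.1 h1.2 hρ).of_divide hle hR).of_ramify m.den_nz hε1
      exact ((hside 1 (Or.inl rfl)).sup (side_le one_ne_zero) (side_le (by norm_num))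
        (hside (-1) (Or.inr rfl))).mono punctured_le

end fairCounts

/-! ### Bezoutians -/

section bezout
variable {n k : ℕ} {P : ℝ → ℂ[X]}

/-- The `i`-th power sum of the roots of `p`. -/
def powerSum (i : ℕ) (p : ℂ[X]) : ℂ := (p.roots.map fun z => z ^ i).sum

theorem exists_roots_eq_map {p : ℂ[X]} (hp : p.natDegree = n) :
    ∃ v : Fin n → ℂ, p.roots = Finset.univ.val.map v := by
  have hcard : Multiset.card p.roots = n := (card_roots_eq _).trans hp
  revert hcard
  generalize p.roots = s
  intro hcard
  obtain ⟨L, rfl⟩ : ∃ L : List ℂ, (L : Multiset ℂ) = s := ⟨s.toList, Multiset.coe_toList s⟩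
  rw [Multiset.coe_card] at hcard
  subst hcard
  refine ⟨L.get, ?_⟩
  rw [Fin.univ_val_map, List.ofFn_get]

theorem powerSum_eq {p : ℂ[X]} {v : Fin n → ℂ} (hv : p.roots = Finset.univ.val.map v) (i : ℕ) :
    powerSum i p = ∑ a, v a ^ i := by
  rw [powerSum, hv, Multiset.map_map]
  rfl

theorem continuous_powerSum (n i : ℕ) : Continuous fun c : Fin n → ℂ => powerSum i (ofCoeffs n c) := by
  choose v hv using fun c : Fin n → ℂ => exists_roots_eq_map (natDegree_ofCoeffs (n := n) (c := c))
  -- the elementary symmetric functions of the roots are, up to sign, the coefficients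
  have hesymm : ∀ a : ℕ, Continuous fun c => MvPolynomial.aeval (v c) (MvPolynomial.esymm (Fin n) ℂ a) := by
    intro a
    simp only [MvPolynomial.aeval_esymm_eq_multiset_esymm, ← hv]
    by_cases ha : a ≤ n
    · have : (fun c : Fin n → ℂ => (ofCoeffs n c).roots.esymm a) =
          fun c => (-1) ^ a * (ofCoeffs n c).coeff (n - a) := by
        funext c
        have h1 := coeff_eq_esymm_roots_of_splits (IsAlgClosed.splits (ofCoeffs n c)) (k := n - a)
          (by rw [natDegree_ofCoeffs]; omega)
        rw [natDegree_ofCoeffs, monic_ofCoeffs.leadingCoeff, one_mul, Nat.sub_sub_self ha] at h1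
        rw [h1, ← mul_assoc, ← mul_pow]
        simp
      rw [this]
      exact continuous_const.mul (contDiff_coeff_ofCoeffs n (n - a) (m := 0)).continuous
    · have : (fun c : Fin n → ℂ => (ofCoeffs n c).roots.esymm a) = fun c => 0 := by
        funext c
        rw [Multiset.esymm, Multiset.powersetCard_eq_empty]
        · simp
        · rw [card_roots_eq, natDegree_ofCoeffs]; omega
      rw [this]
      exact continuous_const
  -- Newton's identities express the power sums by these
  induction i using Nat.strong_induction_on with
  | _ i ih =>
  rcases Nat.eq_zero_or_pos i with rfl | hi
  · have : (fun c : Fin n → ℂ => powerSum 0 (ofCoeffs n c)) = fun _ => (n : ℂ) := by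
      funext c
      simp [powerSum, card_roots_eq, natDegree_ofCoeffs]
    rw [this]
    exact continuous_const
  have hp : ∀ c j, powerSum j (ofCoeffs n c) = MvPolynomial.aeval (v c) (MvPolynomial.psum (Fin n) ℂ j) := by
    intro c j
    rw [powerSum_eq (hv c), MvPolynomial.psum]
    simp
  have h1 := fun c => congrArg (MvPolynomial.aeval (v c))
    (MvPolynomial.psum_eq_mul_esymm_sub_sum (Fin n) ℂ i hi)
  simp only [map_sub, map_mul, map_pow, map_neg, map_one, map_natCast, map_sum, ← hp] at h1
  simp only [h1]
  refine (continuous_const.mul (hesymm i)).sub (continuous_finsetSum _ fun a ha => ?_)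
  rw [Finset.mem_filter, Finset.HasAntidiagonal.mem_antidiagonal] at ha
  refine (continuous_const.mul (hesymm _)).mul (ih a.2 ?_)
  have := ha.2.1
  omega

theorem bezoutMinor_eq (k : ℕ) (p : ℂ[X]) :
    bezoutMinor k p = (Matrix.of fun i j : Fin k => powerSum ((i : ℕ) + (j : ℕ)) p).det := rfl

theorem continuous_bezoutMinor (n k : ℕ) :
    Continuous fun c : Fin n → ℂ => bezoutMinor k (ofCoeffs n c) := by
  simp only [bezoutMinor_eq]
  exact Continuous.matrix_det (continuous_pi fun i => continuous_pi fun j => continuous_powerSum _ _)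

theorem IsGerm.continuousAt_bezoutMinor (hP : IsGerm n P) (k : ℕ) :
    ∀ᶠ t in 𝓝 (0 : ℝ), ContinuousAt (fun t => bezoutMinor k (P t)) t := by
  have h1 : ∀ᶠ t in 𝓝 (0 : ℝ), ∀ i : Fin n, ContinuousAt (fun t => (P t).coeff i) t :=
    eventually_all.2 fun i => hP.eventually_continuousAt i
  filter_upwards [h1, hP.eventually_ofCoeffs.eventually_nhds] with t h2 h3
  have h4 : ContinuousAt (fun t => coeffs n (P t)) t := continuousAt_pi.2 h2
  exact ((continuous_bezoutMinor n k).continuousAt.comp h4).congr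
    (h3.mono fun s hs => by simp only [Function.comp_apply, hs])

/-- `Δ_k` as a sum of multiples of Vandermonde determinants. -/
theorem bezoutMinor_eq_sum {p : ℂ[X]} {v : Fin n → ℂ} (hv : p.roots = Finset.univ.val.map v) (k : ℕ) :
    bezoutMinor k p = ∑ l : Fin k → Fin n, (∏ i : Fin k, v (l i) ^ (i : ℕ)) *
      ∏ i : Fin k, ∏ j ∈ Finset.Ioi i, (v (l j) - v (l i)) := by
  have h1 : (Matrix.of fun i j : Fin k => powerSum ((i : ℕ) + (j : ℕ)) p) =
      Matrix.of fun i : Fin k => ∑ a : Fin n, v a ^ (i : ℕ) • fun j : Fin k => v a ^ (j : ℕ) := by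
    ext i j
    rw [Matrix.of_apply, Matrix.of_apply, powerSum_eq hv, Finset.sum_apply]
    exact Finset.sum_congr rfl fun a _ => by rw [pow_add]; rfl
  rw [bezoutMinor_eq, h1]
  have h2 := (Matrix.detRowAlternating (n := Fin k) (R := ℂ)).toMultilinearMap.map_sum
    (fun (i : Fin k) (a : Fin n) => v a ^ (i : ℕ) • fun j : Fin k => v a ^ (j : ℕ))
  refine h2.trans (Finset.sum_congr rfl fun l _ => ?_)
  rw [MultilinearMap.map_smul_univ, smul_eq_mul, ← Matrix.det_vandermonde]
  rfl

theorem bezoutMinor_eq_zero {p : ℂ[X]} (hp : p.natDegree = n) (hk : n < k) : bezoutMinor k p = 0 := by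
  obtain ⟨v, hv⟩ := exists_roots_eq_map hp
  rw [bezoutMinor_eq_sum hv]
  refine Finset.sum_eq_zero fun l _ => ?_
  obtain ⟨i, j, hij, h⟩ := Fintype.exists_ne_map_eq_of_card_lt l (by simpa using hk)
  have hz : ∀ a b : Fin k, a < b → l a = l b →
      ∏ i : Fin k, ∏ j ∈ Finset.Ioi i, (v (l j) - v (l i)) = 0 := fun a b hab h =>
    Finset.prod_eq_zero (Finset.mem_univ a) (Finset.prod_eq_zero (Finset.mem_Ioi.2 hab) (by rw [h, sub_self]))
  rw [mul_eq_zero]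
  right
  rcases lt_or_gt_of_ne hij with h' | h'
  · exact hz i j h' h
  · exact hz j i h' h.symm

/-- If `p` has exactly `k` distinct roots, then `Δ_k` is the square of their Vandermonde determinant, times
the product of their multiplicities. -/
theorem bezoutMinor_ne_zero (p : ℂ[X]) : bezoutMinor p.roots.toFinset.card p ≠ 0 := by
  classical
  set k := p.roots.toFinset.card with hk
  let e : Fin k ≃ {z // z ∈ p.roots.toFinset} := p.roots.toFinset.equivFin.symm
  have h1 : (Matrix.of fun i j : Fin k => powerSum ((i : ℕ) + (j : ℕ)) p) =
      (Matrix.vandermonde fun a => ((e a : _) : ℂ)).transpose *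
        (Matrix.diagonal fun a => (p.roots.count ((e a : _) : ℂ) : ℂ)) *
        (Matrix.vandermonde fun a => ((e a : _) : ℂ)) := by
    ext i j
    rw [Matrix.of_apply, powerSum, Finset.sum_multiset_map_count, Matrix.mul_apply,
      ← Finset.sum_coe_sort, ← e.sum_comp]
    refine Finset.sum_congr rfl fun a _ => ?_
    rw [Matrix.mul_diagonal, Matrix.transpose_apply, Matrix.vandermonde_apply, Matrix.vandermonde_apply,
      nsmul_eq_mul, pow_add]
    ring
  have h2 : (Matrix.vandermonde fun a => ((e a : _) : ℂ)).det ≠ 0 :=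
    Matrix.det_vandermonde_ne_zero_iff.2 fun a b h => e.injective (Subtype.ext h)
  rw [bezoutMinor_eq, h1, Matrix.det_mul, Matrix.det_mul, Matrix.det_transpose, Matrix.det_diagonal]
  refine mul_ne_zero (mul_ne_zero h2 (Finset.prod_ne_zero_iff.2 fun a _ => ?_)) h2
  have h3 := Multiset.mem_toFinset.1 (e a).2
  exact_mod_cast (Multiset.count_pos.2 h3).ne'

theorem divisibleBy_of_isLittleO {f : ℝ → ℂ} (hf : ∀ᶠ t in 𝓝 (0 : ℝ), ContinuousAt f t) {K : ℕ}
    (h : f =o[𝓝[≠] 0] fun t : ℝ => t ^ K) : DivisibleBy f K := by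
  have h0 : f 0 = 0 := by
    have h1 : Continuous fun t : ℝ => t ^ K := by fun_prop
    exact tendsto_nhds_unique (hf.self_of_nhds.tendsto.mono_left nhdsWithin_le_nhds)
      ((Asymptotics.isLittleO_one_iff ℝ).1
        (h.trans_isBigO (((h1.tendsto 0).mono_left nhdsWithin_le_nhds).isBigO_one ℝ)))
  refine ⟨fun t => if t = 0 then 0 else f t / (t : ℂ) ^ K, ?_, Eventually.of_forall fun t => ?_⟩
  · filter_upwards [hf] with t ht
    by_cases ht0 : t = 0
    · subst ht0
      rw [continuousAt_iff_punctured_nhds, if_pos rfl]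
      have h1 : (fun t : ℝ => if t = 0 then 0 else f t / (t : ℂ) ^ K) =o[𝓝[≠] 0]
          fun _ : ℝ => (1 : ℝ) := by
        rw [Asymptotics.isLittleO_iff] at h ⊢
        intro c hc
        filter_upwards [h hc, self_mem_nhdsWithin] with t h1 h2
        have h3 : 0 < |t| := abs_pos.2 h2
        rw [norm_pow, Real.norm_eq_abs] at h1
        rw [if_neg (show t ≠ 0 from h2), norm_div, norm_pow, Complex.norm_real, Real.norm_eq_abs,
          div_le_iff₀ (pow_pos h3 K)]
        simpa using h1
      exact (Asymptotics.isLittleO_one_iff ℝ).1 h1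
    · have h1 : ContinuousAt (fun s : ℝ => f s / (s : ℂ) ^ K) t :=
        ht.div (by fun_prop) (pow_ne_zero _ (by exact_mod_cast ht0))
      refine h1.congr ?_
      filter_upwards [isOpen_ne.mem_nhds ht0] with s hs
      rw [if_neg hs]
  · by_cases ht0 : t = 0
    · simp only [if_pos ht0, mul_zero]
      rw [ht0, h0]
    · simp only [if_neg ht0]
      rw [mul_div_cancel₀]
      exact pow_ne_zero _ (by exact_mod_cast ht0)

theorem divisibleBy_of_bound {f : ℝ → ℂ} (hf : ∀ᶠ t in 𝓝 (0 : ℝ), ContinuousAt f t) {C : ℝ} {K : ℕ}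
    (h : ∀ᶠ t in 𝓝[≠] (0 : ℝ), ‖f t‖ ≤ C * |t| ^ (K + 1)) : DivisibleBy f K := by
  refine divisibleBy_of_isLittleO hf ?_
  have h1 : f =O[𝓝[≠] 0] fun t : ℝ => t ^ (K + 1) :=
    Asymptotics.IsBigO.of_bound C (by simpa using h)
  refine h1.trans_isLittleO ((Asymptotics.isLittleO_pow_pow (Nat.lt_succ_self K)).mono ?_)
  exact nhdsWithin_le_nhds

/-- If `k` exceeds the number of roots that stay apart, `Δ_k` vanishes to infinite order. -/
theorem divisibleBy_bezoutMinor (hP : IsGerm n P) {ν : ℕ} (hU : Upper (𝓝[≠] 0) P ν) (hk : ν < k)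
    (K : ℕ) : DivisibleBy (fun t => bezoutMinor k (P t)) K := by
  classical
  -- `R` bounds the roots near `0`
  set R : ℝ := 1 + ∑ ρ ∈ (P 0).roots.toFinset, ‖ρ‖ with hR
  have hR1 : 1 ≤ R := by
    rw [hR]; linarith [Finset.sum_nonneg (s := (P 0).roots.toFinset) fun ρ _ => norm_nonneg ρ]
  have hroots : ∀ᶠ t in 𝓝 (0 : ℝ), ∀ z ∈ (P t).roots, ‖z‖ ≤ R := by
    refine hP.eventually (p := fun p => ∀ z ∈ p.roots, ‖z‖ ≤ R) ?_
    filter_upwards [eventually_roots_near hP.monic_zero hP.natDegree_zero one_pos] with c hc z hz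
    obtain ⟨ρ, hρ, hd⟩ := hc z hz
    have h1 : ‖ρ‖ ≤ ∑ ρ ∈ (P 0).roots.toFinset, ‖ρ‖ :=
      Finset.single_le_sum (f := fun ρ => ‖ρ‖) (fun ρ _ => norm_nonneg ρ) (Multiset.mem_toFinset.2 hρ)
    have h2 := norm_le_norm_add_norm_sub' z ρ
    rw [dist_eq_norm] at hd
    linarith
  set T : Finset (Σ _ : Fin k, Fin k) := Finset.univ.sigma fun i => Finset.Ioi i
  set B : ℝ := (∏ i : Fin k, R ^ (i : ℕ)) * (2 * R) ^ T.card with hB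
  refine divisibleBy_of_bound (hP.continuousAt_bezoutMinor k)
    (C := ∑ _ : Fin k → Fin n, B) ?_
  filter_upwards [hU (K + 1), nhdsWithin_le_nhds hroots, nhdsWithin_le_nhds hP.monic] with t h1 h2 h3
  obtain ⟨v, hv⟩ := exists_roots_eq_map h3.2
  have hmem : ∀ a, v a ∈ (P t).roots := fun a => by
    rw [hv]; exact Multiset.mem_map_of_mem _ (Finset.mem_univ a)
  rw [bezoutMinor_eq_sum hv, Finset.sum_mul]
  refine (norm_sum_le _ _).trans (Finset.sum_le_sum fun l _ => ?_)
  rw [norm_mul, hB, mul_assoc]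
  refine mul_le_mul ?_ ?_ (norm_nonneg _) (Finset.prod_nonneg fun i _ => by positivity)
  · rw [norm_prod]
    refine Finset.prod_le_prod (fun i _ => norm_nonneg _) fun i _ => ?_
    rw [norm_pow]
    exact pow_le_pow_left₀ (norm_nonneg _) (h2 _ (hmem _)) _
  -- two of the chosen roots are close to each other
  · obtain ⟨i, j, hij, hclose⟩ : ∃ i j : Fin k, i < j ∧ ‖v (l j) - v (l i)‖ ≤ |t| ^ (K + 1) := by
      by_contra hcon
      push Not at hcon
      have hpos : (0 : ℝ) ≤ |t| ^ (K + 1) := by positivity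
      have hfar : ∀ i j : Fin k, i ≠ j → |t| ^ (K + 1) < dist (v (l i)) (v (l j)) := by
        intro i j hij
        rcases lt_or_gt_of_ne hij with h | h
        · rw [dist_comm, dist_eq_norm]; exact hcon i j h
        · rw [dist_eq_norm]; exact hcon j i h
      have hinj : Function.Injective fun i => v (l i) := by
        intro i j h
        by_contra hij
        have h4 := hfar i j hij
        rw [show v (l i) = v (l j) from h, dist_self] at h4
        linarith
      have h5 := h1 (Finset.univ.image fun i => v (l i)) (fun z hz => by
        obtain ⟨i, -, rfl⟩ := Finset.mem_image.1 hz
        exact hmem _) (fun z hz w hw hzw => by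
        obtain ⟨i, -, rfl⟩ := Finset.mem_image.1 hz
        obtain ⟨j, -, rfl⟩ := Finset.mem_image.1 hw
        exact hfar i j fun h => hzw (by rw [h]))
      rw [Finset.card_image_of_injective _ hinj, Finset.card_univ, Fintype.card_fin] at h5
      omega
    rw [Finset.prod_sigma', norm_prod]
    have hx : (⟨i, j⟩ : Σ _ : Fin k, Fin k) ∈ T :=
      Finset.mem_sigma.2 ⟨Finset.mem_univ _, Finset.mem_Ioi.2 hij⟩
    rw [← Finset.mul_prod_erase T _ hx, mul_comm]
    refine mul_le_mul ?_ hclose (norm_nonneg _) (by positivity)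
    refine (Finset.prod_le_prod (g := fun _ => 2 * R) (fun x _ => norm_nonneg _) fun x _ => ?_).trans
      (by rw [Finset.prod_const]; exact pow_le_pow_right₀ (by linarith) Finset.card_erase_le)
    have h6 := norm_sub_le (v (l x.2)) (v (l x.1))
    have h7 := h2 _ (hmem (l x.2))
    have h8 := h2 _ (hmem (l x.1))
    linarith

/-- If exactly `ν` roots stay apart, and there is no infinite contact, then there are at most `ν` distinct
roots near `0`, and these are separated. -/
theorem sep_of_counts (hP : IsGerm n P) {ν : ℕ} (hU : Upper (𝓝[≠] 0) P ν) (hL : Lower (𝓝[≠] 0) P ν)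
    (hE : ¬ ∃ s : ℕ, IsGreatest {k : ℕ | ¬ ∀ᶠ x in 𝓝 (0 : ℝ), bezoutMinor k (P x) = 0} s ∧
      mult (fun x => bezoutMinor s (P x)) = ⊤) : Sep P := by
  classical
  -- the maximal `s` for which the germ of `Δ_s` is not zero
  set A := {k : ℕ | ¬ ∀ᶠ x in 𝓝 (0 : ℝ), bezoutMinor k (P x) = 0} with hA
  have hA0 : A.Nonempty := by
    refine ⟨0, fun h => ?_⟩
    have := h.self_of_nhds
    simp [bezoutMinor] at this
  have hAn : ∀ k ∈ A, k ≤ n := by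
    intro k hk
    by_contra hkn
    exact hk (hP.monic.mono fun t ht => bezoutMinor_eq_zero ht.2 (by omega))
  have hs : IsGreatest A (sSup A) := ⟨Nat.sSup_mem hA0 ⟨n, hAn⟩, fun k hk => le_csSup ⟨n, hAn⟩ hk⟩
  set s := sSup A
  have hsν : s ≤ ν := by
    by_contra hcon
    refine hE ⟨s, hs, ?_⟩
    rw [ENat.eq_top_iff_forall_ge]
    exact fun K => le_mult (divisibleBy_bezoutMinor hP hU (by omega) K)
  -- near `0` there are at most `s` distinct roots
  have hcard : ∀ᶠ t in 𝓝 (0 : ℝ), (P t).roots.toFinset.card ≤ s := by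
    have h1 : ∀ᶠ t in 𝓝 (0 : ℝ), ∀ k ∈ Finset.Ioc s n, bezoutMinor k (P t) = 0 := by
      rw [Finset.eventually_all]
      intro k hk
      by_contra hcon
      have := hs.2 (show k ∈ A from hcon)
      have := (Finset.mem_Ioc.1 hk).1
      omega
    filter_upwards [h1, hP.monic] with t h2 h3
    by_contra hcon
    refine bezoutMinor_ne_zero (P t) (h2 _ (Finset.mem_Ioc.2 ⟨by omega, ?_⟩))
    exact (Multiset.toFinset_card_le _).trans ((card_roots' _).trans h3.2.le)
  obtain ⟨K, hK⟩ := hL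
  refine ⟨K, ?_⟩
  filter_upwards [hK, nhdsWithin_le_nhds hcard] with t ⟨S, h1, h2, h3⟩ h4 z hz w hw hzw
  have hS : S = (P t).roots.toFinset :=
    Finset.eq_of_subset_of_card_le (fun z hz => Multiset.mem_toFinset.2 (h1 z hz)) (by omega)
  exact h2 z (hS ▸ Multiset.mem_toFinset.2 hz) w (hS ▸ Multiset.mem_toFinset.2 hw) hzw

end bezout

/-! ### Transfer of counts along holomorphic families -/

/-- The coefficients of `P` and `B` agree up to `o(t^q)` along `l`. -/
def Close (l : Filter ℝ) (q : ℕ) (P B : ℝ → ℂ[X]) : Prop :=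
  ∀ k : ℕ, (fun t => (P t).coeff k - (B t).coeff k) =o[l] fun t : ℝ => t ^ q

/-- A family of monic polynomials of degree `n` with coefficients holomorphic at `0 ∈ ℂ`. -/
structure HolFamily (n : ℕ) (A : ℂ → ℂ[X]) : Prop where
  monic : ∀ᶠ z in 𝓝 (0 : ℂ), (A z).Monic ∧ (A z).natDegree = n
  analytic : ∀ k : ℕ, AnalyticAt ℂ (fun z => (A z).coeff k) 0

/-- `F` acts analytically, near `p₀`, on the coefficients of monic polynomials of degree `n`, with
monic values of degree `m`. -/
def AnalyticOp (n m : ℕ) (p₀ : ℂ[X]) (F : ℂ[X] → ℂ[X]) : Prop :=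
  ∃ Ψ : (Fin n → ℂ) → Fin m → ℂ, AnalyticAt ℂ Ψ (coeffs n p₀) ∧
    ∀ᶠ c in 𝓝 (coeffs n p₀), F (ofCoeffs n c) = ofCoeffs m (Ψ c)

section close
variable {l : Filter ℝ} {n m q q' j : ℕ} {P B : ℝ → ℂ[X]} {A : ℂ → ℂ[X]} {p₀ : ℂ[X]} {F : ℂ[X] → ℂ[X]}

theorem isLittleO_of_mul (hl : l ≤ 𝓝[≠] 0) {f : ℝ → ℂ} {ζ : ℂ} (hζ : ζ ≠ 0) (hq : q' + j ≤ q)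
    (h : (fun t : ℝ => (ζ * t) ^ j * f t) =o[l] fun t : ℝ => t ^ q) : f =o[l] fun t : ℝ => t ^ q' := by
  rw [Asymptotics.isLittleO_iff] at h ⊢
  intro c hc
  have hζ' : 0 < ‖ζ‖ ^ j := pow_pos (norm_pos_iff.2 hζ) j
  filter_upwards [h (mul_pos hc hζ'), eventually_pos_lt hl one_pos] with t h1 h2
  rw [norm_mul, norm_pow, norm_mul, Complex.norm_real, mul_pow, norm_pow, Real.norm_eq_abs] at h1
  rw [norm_pow, Real.norm_eq_abs]
  have h3 : |t| ^ q ≤ |t| ^ j * |t| ^ q' := by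
    rw [← pow_add]
    exact pow_le_pow_of_le_one h2.1.le h2.2.le (by omega)
  have h4 : 0 < |t| ^ j := pow_pos h2.1 j
  have h5 : ‖ζ‖ ^ j * |t| ^ j * ‖f t‖ ≤ ‖ζ‖ ^ j * |t| ^ j * (c * |t| ^ q') := by
    refine h1.trans ?_
    calc c * ‖ζ‖ ^ j * |t| ^ q ≤ c * ‖ζ‖ ^ j * (|t| ^ j * |t| ^ q') := by gcongr
      _ = _ := by ring
  exact le_of_mul_le_mul_left h5 (mul_pos hζ' h4)

theorem isLittleO_tendsto (hl : l ≤ 𝓝 0) {f : ℝ → ℂ} (h : f =o[l] fun t : ℝ => t ^ q) :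
    Tendsto f l (𝓝 0) := by
  have h1 : Continuous fun t : ℝ => t ^ q := by fun_prop
  exact (Asymptotics.isLittleO_one_iff ℝ).1
    (h.trans_isBigO (((h1.tendsto 0).mono_left hl).isBigO_one ℝ))

theorem coeffs_isLittleO (hc : Close l q P B) :
    (fun t => coeffs n (P t) - coeffs n (B t)) =o[l] fun t : ℝ => t ^ q :=
  Asymptotics.isLittleO_pi.2 fun i => hc i

theorem Close.of_lt (hP : ∀ᶠ t in l, (P t).Monic ∧ (P t).natDegree = n)
    (hB : ∀ᶠ t in l, (B t).Monic ∧ (B t).natDegree = n)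
    (h : ∀ i < n, (fun t => (P t).coeff i - (B t).coeff i) =o[l] fun t : ℝ => t ^ q) : Close l q P B := by
  intro k
  rcases lt_or_ge k n with hk | hk
  · exact h k hk
  · refine (Asymptotics.isLittleO_zero _ _).congr' ?_ EventuallyEq.rfl
    filter_upwards [hP, hB] with t h1 h2
    rcases hk.eq_or_lt with hk | hk
    · have h3 := h1.1.coeff_natDegree
      have h4 := h2.1.coeff_natDegree
      rw [h1.2] at h3
      rw [h2.2] at h4
      rw [← hk, h3, h4, sub_self]
    · rw [coeff_eq_zero_of_natDegree_lt (by omega), coeff_eq_zero_of_natDegree_lt (by omega), sub_self]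

theorem Close.mono (hc : Close l q P B) (hl : l ≤ 𝓝[≠] 0) (hq : q' ≤ q) : Close l q' P B := by
  intro k
  refine isLittleO_of_mul (j := 0) hl one_ne_zero hq ?_
  simpa using hc k

/-- Closeness transfers the limit of the coefficients. -/
theorem Close.tendsto (hl : l ≤ 𝓝 0) (hc : Close l q P B)
    (hB : Tendsto (fun t => coeffs n (B t)) l (𝓝 (coeffs n p₀))) :
    Tendsto (fun t => coeffs n (P t)) l (𝓝 (coeffs n p₀)) := by
  refine tendsto_pi_nhds.2 fun i => ?_
  have h1 := isLittleO_tendsto hl (hc i)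
  have h2 := h1.add (tendsto_pi_nhds.1 hB i)
  rw [zero_add] at h2
  refine h2.congr fun t => ?_
  simp [coeffs]

theorem HolFamily.tendsto (hA : HolFamily n A) :
    Tendsto (fun z => coeffs n (A z)) (𝓝 0) (𝓝 (coeffs n (A 0))) :=
  tendsto_pi_nhds.2 fun i => (hA.analytic i).continuousAt

theorem HolFamily.monic_zero (hA : HolFamily n A) : (A 0).Monic := hA.monic.self_of_nhds.1

theorem HolFamily.natDegree_zero (hA : HolFamily n A) : (A 0).natDegree = n := hA.monic.self_of_nhds.2

theorem tendsto_line (ζ : ℂ) (hl : l ≤ 𝓝 0) : Tendsto (fun t : ℝ => ζ * (t : ℂ)) l (𝓝 0) := by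
  have : Continuous fun t : ℝ => ζ * (t : ℂ) := by fun_prop
  simpa using (this.tendsto 0).mono_left hl

theorem AnalyticOp.hol (hF : AnalyticOp n m (A 0) F) (hA : HolFamily n A) :
    HolFamily m fun z => F (A z) := by
  obtain ⟨Ψ, hΨ, hev⟩ := hF
  have heq : ∀ᶠ z in 𝓝 (0 : ℂ), F (A z) = ofCoeffs m (Ψ (coeffs n (A z))) := by
    filter_upwards [hA.tendsto.eventually hev, hA.monic] with z h1 h2
    rwa [ofCoeffs_coeffs h2.1 h2.2] at h1
  refine ⟨heq.mono fun z hz => hz ▸ ⟨monic_ofCoeffs, natDegree_ofCoeffs⟩, fun k => ?_⟩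
  have h1 : AnalyticAt ℂ (fun z => Ψ (coeffs n (A z))) 0 :=
    AnalyticAt.comp (f := fun z => coeffs n (A z)) hΨ (AnalyticAt.pi fun i => hA.analytic i)
  have h2 : AnalyticAt ℂ (fun z => (ofCoeffs m (Ψ (coeffs n (A z)))).coeff k) 0 := by
    simp only [coeff_ofCoeffs]
    split_ifs with hk
    · exact ((ContinuousLinearMap.proj (R := ℂ) (φ := fun _ => ℂ) (⟨k, hk⟩ : Fin m)).analyticAt _).comp h1
    · exact analyticAt_const
    · exact analyticAt_const
  exact h2.congr (heq.mono fun z hz => by simp only [hz])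

theorem AnalyticOp.eventually_monic (hF : AnalyticOp n m p₀ F)
    (hP : ∀ᶠ t in l, (P t).Monic ∧ (P t).natDegree = n)
    (hPt : Tendsto (fun t => coeffs n (P t)) l (𝓝 (coeffs n p₀))) :
    ∀ᶠ t in l, (F (P t)).Monic ∧ (F (P t)).natDegree = m := by
  obtain ⟨Ψ, hΨ, hev⟩ := hF
  filter_upwards [hPt.eventually hev, hP] with t h1 h2
  rw [ofCoeffs_coeffs h2.1 h2.2] at h1
  exact h1 ▸ ⟨monic_ofCoeffs, natDegree_ofCoeffs⟩

theorem AnalyticOp.close (hF : AnalyticOp n m p₀ F)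
    (hP : ∀ᶠ t in l, (P t).Monic ∧ (P t).natDegree = n)
    (hB : ∀ᶠ t in l, (B t).Monic ∧ (B t).natDegree = n)
    (hPt : Tendsto (fun t => coeffs n (P t)) l (𝓝 (coeffs n p₀)))
    (hBt : Tendsto (fun t => coeffs n (B t)) l (𝓝 (coeffs n p₀)))
    (hc : Close l q P B) : Close l q (fun t => F (P t)) fun t => F (B t) := by
  refine .of_lt (hF.eventually_monic hP hPt) (hF.eventually_monic hB hBt) fun i hi => ?_
  obtain ⟨Ψ, hΨ, hev⟩ := hF
  have h1 := (hΨ.hasStrictFDerivAt.isBigO_sub.comp_tendsto (hPt.prodMk_nhds hBt)).trans_isLittleO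
    (coeffs_isLittleO hc)
  refine ((Asymptotics.isLittleO_pi.1 h1) ⟨i, hi⟩).congr' ?_ EventuallyEq.rfl
  filter_upwards [hPt.eventually hev, hBt.eventually hev, hP, hB] with t h2 h3 h4 h5
  rw [ofCoeffs_coeffs h4.1 h4.2] at h2
  rw [ofCoeffs_coeffs h5.1 h5.2] at h3
  rw [h2, h3, coeff_ofCoeffs, coeff_ofCoeffs, dif_pos hi, dif_pos hi]
  rfl

theorem analyticOp_near {ρ : ℂ} (h₀ : p₀.Monic) (hn : p₀.natDegree = n) (hρ : ρ ∈ p₀.roots) :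
    AnalyticOp n (p₀.rootMultiplicity ρ) p₀ (near p₀ ρ) :=
  exists_near_eq h₀ hn hρ

/-- Centering of a single polynomial. -/
def centerPoly (p : ℂ[X]) : ℂ[X] := p.comp (X - C (p.nextCoeff / (p.natDegree : ℂ)))

theorem analyticOp_center (hn : 0 < n) : AnalyticOp n n p₀ centerPoly := by
  refine ⟨fun c => coeffs n (centerPoly (ofCoeffs n c)), ?_, Eventually.of_forall fun c => ?_⟩
  · have hcoef : ∀ k, AnalyticAt ℂ (fun c : Fin n → ℂ => (ofCoeffs n c).coeff k) (coeffs n p₀) :=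
      fun k => (contDiff_coeff_ofCoeffs n k (m := ⊤)).contDiffAt.analyticAt
    refine AnalyticAt.pi fun i => ?_
    have hs : ∀ c : Fin n → ℂ, (ofCoeffs n c).nextCoeff / ((ofCoeffs n c).natDegree : ℂ) =
        (ofCoeffs n c).coeff (n - 1) * (n : ℂ)⁻¹ := by
      intro c
      rw [nextCoeff_of_natDegree_pos (by rw [natDegree_ofCoeffs]; exact hn), natDegree_ofCoeffs,
        div_eq_mul_inv]
    simp only [coeffs, centerPoly, hs, coeff_comp_X_sub_C _ _ n natDegree_ofCoeffs.le]
    refine Finset.analyticAt_fun_sum _ fun k _ => (hcoef k).mul ?_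
    exact ((((hcoef (n - 1)).mul analyticAt_const).neg).pow _).mul analyticAt_const
  · refine (ofCoeffs_coeffs (monic_comp_X_sub_C monic_ofCoeffs _)
      ((natDegree_comp_X_sub_C _ _).trans natDegree_ofCoeffs)).symm

end close

section analytic
variable {l : Filter ℝ} {n q j : ℕ}

/-- An analytic function which is `o(t^j)` along the real line is divisible by `z^(j+1)`. -/
theorem exists_analytic_of_isLittleO {f : ℂ → ℂ} (hf : AnalyticAt ℂ f 0)
    (h : (fun t : ℝ => f t) =o[𝓝[≠] 0] fun t : ℝ => t ^ j) :
    ∃ g : ℂ → ℂ, AnalyticAt ℂ g 0 ∧ ∀ᶠ z in 𝓝 (0 : ℂ), f z = z ^ (j + 1) * g z := by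
  have key : ((j + 1 : ℕ) : ℕ∞) ≤ analyticOrderAt f 0 := by
    by_contra hcon
    push Not at hcon
    obtain ⟨k, hk⟩ := ENat.ne_top_iff_exists.1 (ne_top_of_lt hcon)
    rw [← hk] at hcon
    have hkj : k ≤ j := by
      have : k < j + 1 := by exact_mod_cast hcon
      omega
    obtain ⟨g, hg, hg0, hfg⟩ := (hf.analyticOrderAt_eq_natCast).1 hk.symm
    have h1 : (fun t : ℝ => g t) =o[𝓝[≠] 0] fun t : ℝ => t ^ 0 := by
      refine isLittleO_of_mul (q := j) (j := k) le_rfl one_ne_zero (by omega) (h.congr' ?_ EventuallyEq.rfl)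
      have h2 : Tendsto (fun t : ℝ => (t : ℂ)) (𝓝[≠] 0) (𝓝 0) := by
        simpa using tendsto_line (l := 𝓝[≠] 0) 1 nhdsWithin_le_nhds
      filter_upwards [h2.eventually hfg] with t ht
      rw [ht, sub_zero, one_mul, smul_eq_mul]
    have h2 := isLittleO_tendsto nhdsWithin_le_nhds h1
    have h3 : Tendsto (fun t : ℝ => g t) (𝓝[≠] 0) (𝓝 (g 0)) := by
      refine hg.continuousAt.tendsto.comp ?_
      simpa using tendsto_line (l := 𝓝[≠] 0) 1 nhdsWithin_le_nhds
    exact hg0 (tendsto_nhds_unique h3 h2)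
  obtain ⟨g, hg, hfg⟩ := (natCast_le_analyticOrderAt hf).1 key
  exact ⟨g, hg, by simpa using hfg⟩

end analytic

/-- The roots of `P` along `l` are bounded in number by `ν`, in the sense of `Upper`, and every curve which is
close to a line `s ↦ A (ζ s)`, `s → 0+`, in the holomorphic family `A` has at least `ν` roots that stay
apart.  As `ζ` is arbitrary, this relates the two sides of `0`. -/
def Twin (l : Filter ℝ) (n q : ℕ) (A : ℂ → ℂ[X]) (P : ℝ → ℂ[X]) : Prop :=
  ∃ ν, Upper l P ν ∧ ∀ ζ : ℂ, ζ ≠ 0 → ∀ R : ℝ → ℂ[X],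
    (∀ᶠ s in 𝓝[>] (0 : ℝ), (R s).Monic ∧ (R s).natDegree = n) →
    Close (𝓝[>] 0) q R (fun s => A (ζ * s)) → Lower (𝓝[>] 0) R ν

section twin
variable {l : Filter ℝ} {n q q' r : ℕ} {P Q S : ℝ → ℂ[X]} {A : ℂ → ℂ[X]} {m : ℚ}

theorem nhdsGT_le : 𝓝[>] (0 : ℝ) ≤ 𝓝[≠] 0 := nhdsWithin_mono _ fun _ hx => ne_of_gt hx

theorem Close.zero_eq (hP : IsGerm n P) (hA : HolFamily n A)
    (hc : Close (𝓝[≠] 0) q P fun t => A t) : P 0 = A 0 := by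
  have hline : Tendsto (fun t : ℝ => (t : ℂ)) (𝓝[≠] 0) (𝓝 0) := by
    simpa using tendsto_line (l := 𝓝[≠] 0) 1 nhdsWithin_le_nhds
  have h1 := Close.tendsto (p₀ := A 0) nhdsWithin_le_nhds hc (hA.tendsto.comp hline)
  have h2 := tendsto_nhds_unique h1 (hP.tendsto.mono_left nhdsWithin_le_nhds)
  rw [← ofCoeffs_coeffs hP.monic_zero hP.natDegree_zero, ← h2,
    ofCoeffs_coeffs hA.monic_zero hA.natDegree_zero]

theorem HolFamily.tendsto_line (hA : HolFamily n A) (ζ : ℂ) (hl : l ≤ 𝓝 0) :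
    Tendsto (fun s : ℝ => coeffs n (A (ζ * s))) l (𝓝 (coeffs n (A 0))) :=
  hA.tendsto.comp (RootCurve.tendsto_line ζ hl)

theorem HolFamily.monic_line (hA : HolFamily n A) (ζ : ℂ) (hl : l ≤ 𝓝 0) :
    ∀ᶠ s : ℝ in l, (A (ζ * s)).Monic ∧ (A (ζ * s)).natDegree = n :=
  (RootCurve.tendsto_line ζ hl).eventually hA.monic

/-- Closeness to the family is inherited under analytic operations. -/
theorem AnalyticOp.close_line {k : ℕ} {F : ℂ[X] → ℂ[X]} (hF : AnalyticOp n k (A 0) F) (hA : HolFamily n A)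
    (hl : l ≤ 𝓝 0) (hP : ∀ᶠ t in l, (P t).Monic ∧ (P t).natDegree = n) (ζ : ℂ)
    (hc : Close l q P fun s => A (ζ * s)) :
    (∀ᶠ t in l, (F (P t)).Monic ∧ (F (P t)).natDegree = k) ∧
      Close l q (fun t => F (P t)) fun s => F (A (ζ * s)) := by
  have h1 := hA.tendsto_line ζ hl
  have h2 := hc.tendsto hl h1
  exact ⟨hF.eventually_monic hP h2, hF.close hP (hA.monic_line ζ hl) h2 h1 hc⟩

theorem AnalyticOp.close_real {k : ℕ} {F : ℂ[X] → ℂ[X]} (hF : AnalyticOp n k (A 0) F)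
    (hA : HolFamily n A) (hP : IsGerm n P) (hc : Close (𝓝[≠] 0) q P fun t => A t) :
    Close (𝓝[≠] 0) q (fun t => F (P t)) fun t => F (A t) := by
  have := (hF.close_line hA nhdsWithin_le_nhds (nhdsWithin_le_nhds hP.monic) 1 (by simpa using hc)).2
  simpa using this

theorem Twin.of_factors (hl : l ≤ 𝓝[≠] 0) (hP : IsGerm n P) (hA : HolFamily n A)
    (hc : Close (𝓝[≠] 0) q P fun t => A t)
    (h : ∀ ρ ∈ (P 0).roots, Twin l ((P 0).rootMultiplicity ρ) q (fun z => near (P 0) ρ (A z)) (factor P ρ)) :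
    Twin l n q A P := by
  have h0 := hc.zero_eq hP hA
  choose! ν hν hL using h
  refine ⟨_, hP.upper_of_factors (hl.trans nhdsWithin_le_nhds) ν fun ρ hρ =>
    hν ρ (Multiset.mem_toFinset.1 hρ), fun ζ hζ R hR hRc => ?_⟩
  have hlim := hRc.tendsto (p₀ := A 0) nhdsWithin_le_nhds (hA.tendsto_line ζ nhdsWithin_le_nhds)
  rw [← h0] at hlim
  refine Lower.of_near hP.monic_zero hP.natDegree_zero hR hlim nhdsGT_le ν fun ρ hρ => ?_
  have hρ' := Multiset.mem_toFinset.1 hρ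
  have hop : AnalyticOp n ((P 0).rootMultiplicity ρ) (A 0) (near (P 0) ρ) :=
    h0 ▸ analyticOp_near hP.monic_zero hP.natDegree_zero hρ'
  have := hop.close_line hA nhdsWithin_le_nhds hR ζ hRc
  exact hL ρ hρ' ζ hζ _ this.1 this.2

theorem Twin.of_center (hn : 0 < n) (hl : l ≤ 𝓝[≠] 0) (hP : IsGerm n P) (hA : HolFamily n A)
    (h : Twin l n q (fun z => centerPoly (A z)) (center P)) : Twin l n q A P := by
  obtain ⟨ν, h1, h2⟩ := h
  refine ⟨ν, h1.of_center ((hl.trans nhdsWithin_le_nhds) (hP.monic.mono fun t h => h.1)),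
    fun ζ hζ R hR hRc => ?_⟩
  have := (analyticOp_center (p₀ := A 0) hn).close_line hA nhdsWithin_le_nhds hR ζ hRc
  exact (h2 ζ hζ (center R) this.1 this.2).of_center nhdsGT_le (hR.mono fun t h => h.1)

/-- A curve close to the line through `ζ` is, after ramification, close to the line through an `N`-th root
of `ζ / σ` in the ramified family. -/
theorem Twin.of_ramify {σ : ℝ} {N : ℕ} (hσ : |σ| = 1) (hN : N ≠ 0)
    (h : Twin (𝓝[>] 0) n q (fun z => A (σ * z ^ N)) (ramify σ N Q)) : Twin (side σ) n q A Q := by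
  have hσ0 : σ ≠ 0 := by rintro rfl; simp at hσ
  obtain ⟨ν, h1, h2⟩ := h
  refine ⟨ν, h1.of_ramify hN hσ, fun ζ hζ R hR hRc => ?_⟩
  obtain ⟨ξ, hξ⟩ := IsAlgClosed.exists_pow_nat_eq (ζ / σ) (Nat.pos_of_ne_zero hN)
  have hξ0 : ξ ≠ 0 := by
    rintro rfl
    rw [zero_pow hN] at hξ
    exact div_ne_zero hζ (by exact_mod_cast hσ0) hξ.symm
  have ht : Tendsto (fun s : ℝ => 1 * s ^ N) (𝓝[>] 0) (𝓝[>] 0) := by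
    refine tendsto_nhdsWithin_of_tendsto_nhds_of_eventually_within _
      ((WGerm.tendsto_power 1 hN).mono_left nhdsWithin_le_nhds) ?_
    filter_upwards [self_mem_nhdsWithin] with s hs
    rw [one_mul]
    exact pow_pos (Set.mem_Ioi.1 hs) N
  have := h2 ξ hξ0 (ramify 1 N R) (ht.eventually hR) fun k => ?_
  · have h3 := this.of_ramify hN abs_one
    rwa [side_one] at h3
  · refine (((hRc k).comp_tendsto ht).congr_left fun s => ?_).trans_isBigO ?_
    · simp only [Function.comp_apply, ramify]
      congr 3
      rw [mul_pow, hξ]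
      push_cast
      have : (σ : ℂ) ≠ 0 := by exact_mod_cast hσ0
      field_simp
    · refine Asymptotics.IsBigO.of_bound 1 ?_
      filter_upwards [eventually_pos_lt nhdsGT_le one_pos] with s hs
      simp only [Function.comp_apply, one_mul, norm_pow, Real.norm_eq_abs]
      rw [← pow_mul]
      exact pow_le_pow_of_le_one hs.1.le hs.2.le (Nat.le_mul_of_pos_left _ (Nat.pos_of_ne_zero hN))

theorem tendsto_ofReal_punctured : Tendsto (fun t : ℝ => (t : ℂ)) (𝓝[≠] 0) (𝓝 0) := by
  simpa using tendsto_line (l := 𝓝[≠] 0) 1 nhdsWithin_le_nhds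

/-- The quotients `z^{-kr} a_k` of the family, if a close curve has slope `r`. -/
theorem HasSlope.exists_hol (hS : HasSlope n r S) (hA : HolFamily n A)
    (hc : Close (𝓝[≠] 0) q S fun t => A t) (hq : q' + n * r ≤ q) (hr : 0 < n * r) :
    ∃ B, HolFamily n B ∧ (∀ᶠ z in 𝓝 (0 : ℂ), ∀ i < n,
      (A z).coeff i = (z ^ r) ^ (n - i) * (B z).coeff i) ∧
      Close (𝓝[≠] 0) q' (divide n r S) fun t => B t := by
  have hex : ∀ i : Fin n, ∃ g : ℂ → ℂ, AnalyticAt ℂ g 0 ∧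
      ∀ᶠ z in 𝓝 (0 : ℂ), (A z).coeff i = z ^ ((n - i) * r) * g z := by
    intro i
    have hj : 0 < (n - i) * r := Nat.mul_pos (Nat.sub_pos_of_lt i.2) (Nat.pos_of_mul_pos_left hr)
    have hjn : (n - i) * r ≤ n * r := Nat.mul_le_mul_right _ (Nat.sub_le _ _)
    -- on the real line, the coefficient of the family is `O(t^{(n-i)r})`, like that of `S`
    have h1 : (fun t : ℝ => (A t).coeff i) =o[𝓝[≠] 0] fun t : ℝ => t ^ ((n - i) * r - 1) := by
      have h2 : (fun t : ℝ => (S t).coeff i) =o[𝓝[≠] 0] fun t : ℝ => t ^ ((n - i) * r - 1) := by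
        obtain ⟨u, hu, hSu⟩ := hS.div i i.2
        have h3 : (fun t : ℝ => (S t).coeff i) =O[𝓝[≠] 0] fun t : ℝ => t ^ ((n - i) * r) := by
          have h4 : u =O[𝓝[≠] 0] fun _ => (1 : ℝ) :=
            (hu.self_of_nhds.tendsto.mono_left nhdsWithin_le_nhds).isBigO_one ℝ
          have h5 : (fun t : ℝ => (t : ℂ) ^ ((n - i) * r)) =O[𝓝[≠] 0] fun t : ℝ => t ^ ((n - i) * r) :=
            Asymptotics.IsBigO.of_bound 1 (Eventually.of_forall fun t => by simp)
          refine ((h5.mul h4).congr' ?_ (Eventually.of_forall fun t => by simp))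
          exact nhdsWithin_le_nhds (hSu.mono fun t ht => ht.symm)
        exact h3.trans_isLittleO ((Asymptotics.isLittleO_pow_pow (by omega)).mono nhdsWithin_le_nhds)
      have h6 := h2.sub (hc.mono le_rfl (show (n - i) * r - 1 ≤ q by omega) i)
      simpa using h6
    obtain ⟨g, hg, h2⟩ := exists_analytic_of_isLittleO (hA.analytic i) h1
    rw [Nat.sub_add_cancel hj] at h2
    exact ⟨g, hg, h2⟩
  choose g hg hAg using hex
  have hB : HolFamily n fun z => ofCoeffs n fun i => g i z := by
    refine ⟨Eventually.of_forall fun z => ⟨monic_ofCoeffs, natDegree_ofCoeffs⟩, fun k => ?_⟩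
    simp only [coeff_ofCoeffs]
    split_ifs with hk
    · exact hg _
    · exact analyticAt_const
    · exact analyticAt_const
  refine ⟨_, hB, ?_, ?_⟩
  · filter_upwards [eventually_all.2 hAg] with z hz i hi
    rw [hz ⟨i, hi⟩, coeff_ofCoeffs, dif_pos hi, ← pow_mul, mul_comm r]
  · refine .of_lt (n := n) (nhdsWithin_le_nhds hS.germ_divide.monic)
      (Eventually.of_forall fun t => ⟨monic_ofCoeffs, natDegree_ofCoeffs⟩) fun i hi => ?_
    have hjn : (n - i) * r ≤ n * r := Nat.mul_le_mul_right _ (Nat.sub_le _ _)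
    refine isLittleO_of_mul (q := q) (j := (n - i) * r) le_rfl one_ne_zero (by omega)
      ((hc i).congr' ?_ EventuallyEq.rfl)
    filter_upwards [nhdsWithin_le_nhds hS.spec, tendsto_ofReal_punctured.eventually (hAg ⟨i, hi⟩)]
      with t h1 h2
    rw [h1 i hi, h2, one_mul, coeff_ofCoeffs, dif_pos hi, ← pow_mul, mul_comm r]
    ring

/-- Along the line through `ζ`, the coefficients are divided by powers of `(ζ s)^r`. -/
theorem Twin.of_divide (hl : l ≤ 𝓝[≠] 0) (hS : HasSlope n r S) {B : ℂ → ℂ[X]}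
    (hB : HolFamily n B) (hAB : ∀ᶠ z in 𝓝 (0 : ℂ), ∀ i < n,
      (A z).coeff i = (z ^ r) ^ (n - i) * (B z).coeff i)
    (hq : q' + n * r ≤ q) (h : Twin l n q' B (divide n r S)) : Twin l n q A S := by
  obtain ⟨ν, h1, h2⟩ := h
  refine ⟨ν, h1.of_divide hl hS, fun ζ hζ R hR hRc => ?_⟩
  set T : ℝ → ℂ[X] := fun s => ofCoeffs n fun i => (R s).coeff i / ((ζ * s) ^ r) ^ (n - (i : ℕ)) with hT
  have hline := tendsto_line (l := 𝓝[>] 0) ζ nhdsWithin_le_nhds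
  have hne : ∀ᶠ s : ℝ in 𝓝[>] 0, (ζ * (s : ℂ)) ≠ 0 := by
    filter_upwards [self_mem_nhdsWithin] with s hs
    exact mul_ne_zero hζ (by exact_mod_cast ne_of_gt hs)
  have hTm : ∀ᶠ s in 𝓝[>] (0 : ℝ), (T s).Monic ∧ (T s).natDegree = n :=
    Eventually.of_forall fun s => ⟨monic_ofCoeffs, natDegree_ofCoeffs⟩
  have hTR : ∀ᶠ s : ℝ in 𝓝[>] 0, ∀ i < n, (R s).coeff i = ((ζ * s) ^ r) ^ (n - i) * (T s).coeff i := by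
    filter_upwards [hne] with s hs i hi
    rw [hT]
    simp only [coeff_ofCoeffs, dif_pos hi]
    rw [mul_div_cancel₀ _ (pow_ne_zero _ (pow_ne_zero _ hs))]
  have hlow : Lower (𝓝[>] 0) T ν := by
    refine h2 ζ hζ T hTm (.of_lt hTm (hB.monic_line ζ nhdsWithin_le_nhds) fun i hi => ?_)
    have hjn : (n - i) * r ≤ n * r := Nat.mul_le_mul_right _ (Nat.sub_le _ _)
    refine isLittleO_of_mul (q := q) (j := (n - i) * r) nhdsGT_le hζ (by omega)
      ((hRc i).congr' ?_ EventuallyEq.rfl)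
    filter_upwards [hTR, hline.eventually hAB] with s h3 h4
    rw [h3 i hi, h4 i hi, mul_comm (n - i) r, pow_mul]
    ring
  refine hlow.of_affine (fun s => (ζ * s) ^ r) (fun _ => 0) (r + 1) nhdsGT_le ?_
  filter_upwards [hTR, hR, eventually_pos_lt nhdsGT_le (pow_pos (norm_pos_iff.2 hζ) r)] with s h3 h4 h5
  refine ⟨?_, ?_⟩
  · rw [norm_pow, norm_mul, Complex.norm_real, mul_pow, pow_succ', Real.norm_eq_abs]
    have := h5.2.le
    gcongr
  · simpa using roots_of_coeff_scale (n := n) monic_ofCoeffs h4.1 natDegree_ofCoeffs h4.2 h3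

/-- Closeness to a holomorphic family excludes that the slope is attained without a nonvanishing
quotient. -/
theorem strict_of_close (hn : 0 < n) (hQ : IsGerm n Q) (hA : HolFamily n A)
    (hc : Close (𝓝[≠] 0) q Q fun t => A t)
    (hm : slope n Q = (m : WithTop ℚ)) (hq : ⌈(n : ℚ) * m⌉₊ + 1 ≤ q) : Strict n Q m := by
  obtain ⟨k, hk, j, hj, hmult⟩ := exists_mult_of_slope hn hm
  refine ⟨k, hk, j, hj, hmult, fun h0 => ?_⟩
  have hdiv : DivisibleBy (fun t => (Q t).coeff (n - k)) j :=
    divisibleBy_of_le_mult (hQ.eventually_continuousAt _) hmult.ge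
  obtain ⟨hu, hspec⟩ := hdiv.divPow_spec
  set u := divPow (fun t => (Q t).coeff (n - k)) j with hudef
  have hjn : j ≤ ⌈(n : ℚ) * m⌉₊ := by
    have h1 : (j : ℚ) ≤ n * m := by
      rw [hj]
      have h2 : (k : ℚ) ≤ n := by exact_mod_cast (Finset.mem_Icc.1 hk).2
      have h3 := slope_nonneg hn hm
      nlinarith
    have h2 := h1.trans (Nat.le_ceil _)
    exact_mod_cast h2
  have h1 : (fun t : ℝ => (Q t).coeff (n - k)) =o[𝓝[≠] 0] fun t : ℝ => t ^ j := by
    have h4 : u =o[𝓝[≠] 0] fun _ => (1 : ℝ) := by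
      rw [Asymptotics.isLittleO_one_iff, ← h0]
      exact hu.self_of_nhds.tendsto.mono_left nhdsWithin_le_nhds
    have h5 : (fun t : ℝ => (t : ℂ) ^ j) =O[𝓝[≠] 0] fun t : ℝ => t ^ j :=
      Asymptotics.IsBigO.of_bound 1 (Eventually.of_forall fun t => by simp)
    refine (h5.mul_isLittleO h4).congr' ?_ (Eventually.of_forall fun t => by simp)
    exact nhdsWithin_le_nhds (hspec.mono fun t ht => ht.symm)
  have h2 : (fun t : ℝ => (A t).coeff (n - k)) =o[𝓝[≠] 0] fun t : ℝ => t ^ j := by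
    have h6 := h1.sub (hc.mono le_rfl (show j ≤ q by omega) (n - k))
    simpa using h6
  obtain ⟨g, hg, hAg⟩ := exists_analytic_of_isLittleO (hA.analytic (n - k)) h2
  -- `a_k = t^(j+1) g(t) + o(t^(j+1))`, so `a_k / t^j` is divisible by `t`
  have hdiv' : DivisibleBy (fun t => (Q t).coeff (n - k)) (j + 1) := by
    have hg' : ∀ᶠ t : ℝ in 𝓝 0, ContinuousAt (fun t : ℝ => g t) t := by
      have h7 : Tendsto (fun t : ℝ => (t : ℂ)) (𝓝 0) (𝓝 0) := by
        simpa using tendsto_line (l := 𝓝 0) 1 le_rfl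
      filter_upwards [h7.eventually hg.eventually_analyticAt] with t ht
      exact ht.continuousAt.comp (f := fun t : ℝ => (t : ℂ)) Complex.continuous_ofReal.continuousAt
    have h8 : DivisibleBy (fun t : ℝ => (Q t).coeff (n - k) - (t : ℂ) ^ (j + 1) * g t) (j + 1) := by
      refine divisibleBy_of_isLittleO ?_ ?_
      · filter_upwards [hQ.eventually_continuousAt (n - k), hg'] with t h9 h10
        exact h9.sub (ContinuousAt.mul (by fun_prop) h10)
      · refine (hc.mono le_rfl (show j + 1 ≤ q by omega) (n - k)).congr' ?_ EventuallyEq.rfl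
        filter_upwards [tendsto_ofReal_punctured.eventually hAg] with t ht
        rw [ht]
    obtain ⟨v, hv, hvs⟩ := h8
    refine ⟨fun t => g t + v t, ?_, hvs.mono fun t ht => ?_⟩
    · filter_upwards [hv, hg'] with t h9 h10 using h10.add h9
    · rw [mul_add, ← ht]
      ring
  have h4 := le_mult hdiv'
  rw [hmult] at h4
  norm_cast at h4
  omega

/-- The step of the induction for an integral slope. -/
theorem HasSlope.twin (hl : l ≤ 𝓝[≠] 0) (hS : HasSlope n r S) (hr : 0 < r) (hA : HolFamily n A)
    (hc : Close (𝓝[≠] 0) q S fun t => A t)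
    (hq : (n * r + (divide n r S 0).roots.toFinset.sup fun ρ =>
      germGammaHat (factor (divide n r S) ρ)) + 1 ≤ q)
    (ih : ∀ ρ ∈ (divide n r S 0).roots, ∀ (q' : ℕ) (B : ℂ → ℂ[X]),
      HolFamily ((divide n r S 0).rootMultiplicity ρ) B →
      Close (𝓝[≠] 0) q' (factor (divide n r S) ρ) (fun t => B t) →
      germGammaHat (factor (divide n r S) ρ) + 1 ≤ q' →
      Twin l ((divide n r S 0).rootMultiplicity ρ) q' B (factor (divide n r S) ρ)) :
    Twin l n q A S := by
  obtain ⟨q', rfl⟩ : ∃ q', q = q' + n * r := ⟨q - n * r, by omega⟩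
  obtain ⟨B, hB, hAB, hcB⟩ := hS.exists_hol hA hc le_rfl (Nat.mul_pos hS.pos hr)
  refine .of_divide hl hS hB hAB le_rfl (.of_factors hl hS.germ_divide hB hcB fun ρ hρ => ?_)
  have h0 := hcB.zero_eq hS.germ_divide hB
  have hop : AnalyticOp n ((divide n r S 0).rootMultiplicity ρ) (B 0) (near (divide n r S 0) ρ) :=
    h0 ▸ analyticOp_near hS.germ_divide.monic_zero hS.germ_divide.natDegree_zero hρ
  refine ih ρ hρ q' _ (hop.hol hB) (hop.close_real hB hS.germ_divide hcB) ?_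
  have h1 := Finset.le_sup (f := fun ρ => germGammaHat (factor (divide n r S) ρ))
    (Multiset.mem_toFinset.2 hρ)
  omega

/-- A curve which is sufficiently close to a holomorphic family has well-determined counts of roots. -/
theorem twin_of_close (hP : IsGerm n P) (hA : HolFamily n A) (hc : Close (𝓝[≠] 0) q P fun t => A t)
    (hq : germGammaHat P + 1 ≤ q) {σ : ℝ} (hσ : σ = 1 ∨ σ = -1) : Twin (side σ) n q A P := by
  induction n using Nat.strong_induction_on generalizing P A q σ with
  | _ n ih =>
  have hσ0 : σ ≠ 0 := by rcases hσ with rfl | rfl <;> norm_num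
  have hσ1 : |σ| = 1 := by rcases hσ with rfl | rfl <;> norm_num
  have hl := side_le hσ0
  have hl0 := hl.trans nhdsWithin_le_nhds
  rcases hP.cases with hs | ⟨hs, hn | ⟨hn, hcase⟩⟩
  · refine .of_factors hl hP hA hc fun ρ hρ => ?_
    have h0 := hc.zero_eq hP hA
    have hop : AnalyticOp n ((P 0).rootMultiplicity ρ) (A 0) (near (P 0) ρ) :=
      h0 ▸ analyticOp_near hP.monic_zero hP.natDegree_zero hρ
    refine ih _ (hP.rootMultiplicity_lt hs hρ) (hP.factor hρ) (hop.hol hA) (hop.close_real hA hP hc) ?_ hσ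
    rw [germGammaHat_of_splits hs] at hq
    have h1 := Finset.le_sup (f := fun ρ => germGammaHat (factor P ρ)) (Multiset.mem_toFinset.2 hρ)
    omega
  · refine ⟨n, .of_degree (hl0 (hP.monic.mono fun t h => h.2.le)), fun ζ _ R hR _ => ?_⟩
    interval_cases n
    · exact .zero
    · exact .one (hR.mono fun t h => by omega)
  · have hop : AnalyticOp n n (A 0) centerPoly := analyticOp_center (by omega)
    have hcA := hop.hol hA
    have hcc : Close (𝓝[≠] 0) q (center P) fun t => centerPoly (A t) := hop.close_real hA hP hc
    refine .of_center (by omega) hl hP hA ?_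
    rcases hcase with ht | ⟨m, hm, hst | hN⟩
    · exact ⟨1, (Upper.of_flat hP.center ht).mono hl, fun ζ _ R hR _ =>
        .one (hR.mono fun t h => by omega)⟩
    · rw [germGammaHat_of_not_strict hP hs hn hm hst] at hq
      exact absurd (strict_of_close (by omega) hP.center hcA hcc hm hq) hst
    by_cases hd : m.den = 1
    · have hQ := hN.hasSlope hd
      rw [germGammaHat_of_int hP hs hn hN hd] at hq
      exact hQ.twin hl hN.num_pos hcA hcc hq fun ρ hρ q' B h1 h2 h3 =>
        ih _ (hQ.germ_divide.rootMultiplicity_lt hQ.splits_divide hρ) (hQ.germ_divide.factor hρ) h1 h2 h3 hσ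
    · have hQ := hN.hasSlope_ramify hσ0
      have hq' := le_germGammaHat_of_frac hP hs hn hN hd hσ
      refine .of_ramify hσ1 m.den_nz ?_
      have h0 : HolFamily n fun z => centerPoly (A ((σ : ℂ) * z ^ m.den)) := by
        have hcont : AnalyticAt ℂ (fun z : ℂ => (σ : ℂ) * z ^ m.den) 0 := by fun_prop
        have hz : (σ : ℂ) * (0 : ℂ) ^ m.den = 0 := by rw [zero_pow m.den_nz, mul_zero]
        have htend : Tendsto (fun z : ℂ => (σ : ℂ) * z ^ m.den) (𝓝 0) (𝓝 0) := by
          simpa [hz] using hcont.continuousAt.tendsto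
        refine ⟨htend.eventually hcA.monic, fun k => ?_⟩
        exact AnalyticAt.fun_comp (f := fun z : ℂ => (σ : ℂ) * z ^ m.den) (by rw [hz]; exact hcA.analytic k)
          hcont
      have h1 : Close (𝓝[≠] 0) q (ramify σ m.den (center P))
          fun t => centerPoly (A ((σ : ℂ) * (t : ℂ) ^ m.den)) := by
        intro k
        refine (((hcc k).comp_tendsto (Sep.tendsto_power_ne m.den_nz hσ0)).congr_left fun s => ?_).trans_isBigO ?_
        · simp only [Function.comp_apply, ramify]
          push_cast
          rfl
        · refine Asymptotics.IsBigO.of_bound 1 ?_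
          filter_upwards [eventually_pos_lt le_rfl one_pos] with s hs
          simp only [Function.comp_apply, one_mul, norm_pow, Real.norm_eq_abs, abs_mul, hσ1, abs_pow]
          rw [← pow_mul]
          exact pow_le_pow_of_le_one hs.1.le hs.2.le (Nat.le_mul_of_pos_left _ m.den_pos)
      have := hQ.twin nhdsGT_le hN.num_pos h0 h1 (by omega) fun ρ hρ q' B h1 h2 h3 => by
        have := ih _ (hQ.germ_divide.rootMultiplicity_lt hQ.splits_divide hρ) (hQ.germ_divide.factor hρ)
          h1 h2 h3 (σ := 1) (Or.inl rfl)
        rwa [side_one] at this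
      exact this

/-- A germ which is sufficiently close to a holomorphic family has the same count `ν` on both sides: the
upper bound on one side is a lower bound on the other one, by comparison with the lines through `1` and
`-1`. -/
theorem counts_of_close (hP : IsGerm n P) (hA : HolFamily n A) (hc : Close (𝓝[≠] 0) q P fun t => A t)
    (hq : germGammaHat P + 1 ≤ q) : ∃ ν, Upper (𝓝[≠] 0) P ν ∧ Lower (𝓝[≠] 0) P ν := by
  obtain ⟨ν, hU, hL⟩ := twin_of_close hP hA hc hq (σ := 1) (Or.inl rfl)
  obtain ⟨ν', hU', hL'⟩ := twin_of_close hP hA hc hq (σ := -1) (Or.inr rfl)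
  have hm := hP.monic
  have hpos : ∀ ν, (∀ ζ : ℂ, ζ ≠ 0 → ∀ R : ℝ → ℂ[X],
      (∀ᶠ s in 𝓝[>] (0 : ℝ), (R s).Monic ∧ (R s).natDegree = n) →
      Close (𝓝[>] 0) q R (fun s => A (ζ * s)) → Lower (𝓝[>] 0) R ν) →
      Lower (side 1) P ν ∧ Lower (side (-1)) P ν := by
    intro ν h
    refine ⟨?_, ?_⟩
    · rw [side_one]
      refine h 1 one_ne_zero P ((nhdsGT_le.trans nhdsWithin_le_nhds) hm) fun k => ?_
      simpa using (hc k).mono nhdsGT_le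
    · have ht := Sep.tendsto_power_ne (N := 1) (ε := -1) one_ne_zero (by norm_num)
      have h1 := h (-1) (by norm_num) (ramify (-1) 1 P)
        ((nhdsGT_le.trans nhdsWithin_le_nhds) ((WGerm.tendsto_power (-1) one_ne_zero).eventually hm))
        fun k => by
          refine ((((hc k).comp_tendsto ht).mono nhdsGT_le).congr_left fun s => ?_).trans_isBigO ?_
          · simp [ramify]
          · exact Asymptotics.IsBigO.of_bound 1 (Eventually.of_forall fun s => by simp)
      exact h1.of_ramify one_ne_zero (by norm_num)
  have h1 := hpos ν hL
  have h2 := hpos ν' hL'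
  have h3 := h1.2.le_of_upper (side_le (by norm_num)) hU'
  have h4 := h2.1.le_of_upper (side_le one_ne_zero) hU
  have h5 : ν = ν' := le_antisymm h3 h4
  subst h5
  exact ⟨ν, (hU.sup hU').mono punctured_le,
    (h1.1.sup (side_le one_ne_zero) (side_le (by norm_num)) h1.2).mono punctured_le⟩

end twin

/-! ### Separation of roots in the absence of infinite contact -/

section separation
variable {n q : ℕ} {P : ℝ → ℂ[X]}

/-- The Taylor polynomial, as a function of a complex variable. -/
theorem exists_taylor {f : ℝ → ℂ} (hf : WGerm (q : ℕ∞) 0 f) :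
    ∃ g : ℂ → ℂ, AnalyticAt ℂ g 0 ∧ (fun t : ℝ => f t - g t) =o[𝓝[≠] 0] fun t : ℝ => t ^ q := by
  obtain ⟨δ, hδ, -, h⟩ := hf
  have h0 : (0 : ℝ) ∈ Set.Ioo (-δ) δ := ⟨by linarith, hδ⟩
  simp only [pow_zero, one_smul] at h
  have h1 := taylor_isLittleO (convex_Ioo (-δ) δ) h0 (n := q) (by exact_mod_cast h)
  rw [isOpen_Ioo.nhdsWithin_eq h0] at h1
  refine ⟨fun z => ∑ k ∈ Finset.range (q + 1), ((k.factorial : ℂ)⁻¹ * z ^ k) *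
    iteratedDerivWithin k f (Set.Ioo (-δ) δ) 0, ?_, ?_⟩
  · refine Finset.analyticAt_fun_sum _ fun k _ => ?_
    exact (analyticAt_const.mul (analyticAt_id.pow k)).mul analyticAt_const
  · refine ((h1.mono nhdsWithin_le_nhds).congr (fun t => ?_) fun t => by rw [sub_zero])
    rw [taylor_within_apply]
    congr 1
    refine Finset.sum_congr rfl fun k _ => ?_
    rw [sub_zero, Complex.real_smul]
    push_cast
    rfl

theorem exists_holFamily (hP : IsGerm n P) (hC : CoefReg (q : ℕ∞) 0 P) :
    ∃ A, HolFamily n A ∧ Close (𝓝[≠] 0) q P fun t => A t := by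
  choose g hg hgo using fun k => exists_taylor (hC k)
  refine ⟨fun z => ofCoeffs n fun i => g i z,
    ⟨Eventually.of_forall fun z => ⟨monic_ofCoeffs, natDegree_ofCoeffs⟩, fun k => ?_⟩, ?_⟩
  · simp only [coeff_ofCoeffs]
    split_ifs with hk
    · exact hg _
    · exact analyticAt_const
    · exact analyticAt_const
  · refine .of_lt (nhdsWithin_le_nhds hP.monic)
      (Eventually.of_forall fun t => ⟨monic_ofCoeffs, natDegree_ofCoeffs⟩) fun i hi => ?_
    simp only [coeff_ofCoeffs, dif_pos hi]
    exact hgo i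

/-- The germ at `0` of `P` has no infinite contact. -/
def FiniteContact (P : ℝ → ℂ[X]) : Prop :=
  ¬ ∃ s : ℕ, IsGreatest {k : ℕ | ¬ ∀ᶠ x in 𝓝 (0 : ℝ), bezoutMinor k (P x) = 0} s ∧
      mult (fun x => bezoutMinor s (P x)) = ⊤

theorem sep_of_fair (hP : IsGerm n P) (hF : (germTree P).Fair) (hE : FiniteContact P) : Sep P := by
  obtain ⟨ν, h1, h2⟩ := counts_of_fair hP hF
  exact sep_of_counts hP h1 h2 hE

theorem sep_of_gammaHat (hP : IsGerm n P) (hC : CoefReg (q : ℕ∞) 0 P) (hq : germGammaHat P + 1 ≤ q)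
    (hE : FiniteContact P) : Sep P := by
  obtain ⟨A, hA, hc⟩ := exists_holFamily hP hC
  obtain ⟨ν, h1, h2⟩ := counts_of_close hP hA hc hq
  exact sep_of_counts hP h1 h2 hE

end separation

/-! ### Gluing local solutions -/

/-- Families with the same multiset of values differ by a permutation. -/
theorem exists_perm_of_map_eq {n : ℕ} {α : Type*} {f g : Fin n → α}
    (h : Finset.univ.val.map f = Finset.univ.val.map g) :
    ∃ π : Equiv.Perm (Fin n), ∀ j, f j = g (π j) := by
  classical
  have hcard : ∀ v, Fintype.card {j // f j = v} = Fintype.card {j // g j = v} := fun v => by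
    have h1 := congrArg (Multiset.count v) h
    rw [Multiset.count_map, Multiset.count_map] at h1
    rw [Fintype.card_subtype, Fintype.card_subtype, Finset.card, Finset.card, Finset.filter_val,
      Finset.filter_val]
    simpa only [eq_comm] using h1
  let e := fun v => Fintype.equivOfCardEq (hcard v)
  refine ⟨(Equiv.sigmaFiberEquiv f).symm.trans
    ((Equiv.sigmaCongrRight e).trans (Equiv.sigmaFiberEquiv g)), fun j => ?_⟩
  exact (e (f j) ⟨j, rfl⟩).2.symm

/-- `lam` is a `C^q`-parameterization of the roots of `P` on the interval `(a, b)`. -/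
def SolOn (n : ℕ) (q : ℕ∞) (P : ℝ → ℂ[X]) (a b : ℝ) (lam : Fin n → ℝ → ℂ) : Prop :=
  (∀ j, ContDiffOn ℝ (q : WithTop ℕ∞) (lam j) (Set.Ioo a b)) ∧
    ∀ t ∈ Set.Ioo a b, P t = ∏ j, (X - C (lam j t))

section glue
variable {n : ℕ} {q : ℕ∞} {P : ℝ → ℂ[X]} {a b c d : ℝ} {lam mu : Fin n → ℝ → ℂ}

theorem SolOn.mono (h : SolOn n q P a b lam) (hac : a ≤ c) (hdb : d ≤ b) : SolOn n q P c d lam :=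
  ⟨fun j => (h.1 j).mono (Set.Ioo_subset_Ioo hac hdb), fun t ht => h.2 t (Set.Ioo_subset_Ioo hac hdb ht)⟩

theorem SolOn.perm (h : SolOn n q P a b lam) (π : Equiv.Perm (Fin n)) :
    SolOn n q P a b fun j => lam (π j) :=
  ⟨fun _ => h.1 _, fun t ht => (h.2 t ht).trans (Equiv.prod_comp π fun j => X - C (lam j t)).symm⟩

/-- Somewhere in an interval, two parameterizations agree locally up to a permutation: this holds
wherever the number of distinct roots is maximal. -/
theorem SolOn.exists_perm (hl : SolOn n q P a b lam) (hm : SolOn n q P a b mu) (hab : a < b) :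
    ∃ t ∈ Set.Ioo a b, ∃ π : Equiv.Perm (Fin n), ∀ j, ∀ᶠ s in 𝓝 t, lam j s = mu (π j) s := by
  classical
  set N : ℝ → ℕ := fun t => (Finset.univ.image fun j => lam j t).card with hN
  have hbdd : ∀ t, N t ≤ n := fun t => Finset.card_image_le.trans (by simp)
  obtain ⟨t, ht, hmax⟩ : ∃ t ∈ Set.Ioo a b, ∀ s ∈ Set.Ioo a b, N s ≤ N t := by
    have hne : (N '' Set.Ioo a b).Nonempty := (Set.nonempty_Ioo.2 hab).image N
    have hb : BddAbove (N '' Set.Ioo a b) := ⟨n, by rintro _ ⟨t, -, rfl⟩; exact hbdd t⟩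
    obtain ⟨t, ht, h⟩ := Nat.sSup_mem hne hb
    exact ⟨t, ht, fun s hs => h ▸ le_csSup hb ⟨s, hs, rfl⟩⟩
  have hnhds := isOpen_Ioo.mem_nhds ht
  have hcl : ∀ j, ContinuousAt (lam j) t := fun j => (hl.1 j).continuousOn.continuousAt hnhds
  have hcm : ∀ j, ContinuousAt (mu j) t := fun j => (hm.1 j).continuousOn.continuousAt hnhds
  have hroots : ∀ s ∈ Set.Ioo a b, (Finset.univ.val.map fun j => lam j s) =
      Finset.univ.val.map fun j => mu j s := fun s hs => by
    rw [← roots_prod_family, ← roots_prod_family, ← hl.2 s hs, ← hm.2 s hs]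
  obtain ⟨π, hπ⟩ : ∃ π : Equiv.Perm (Fin n), ∀ j, lam j t = mu (π j) t := by
    exact exists_perm_of_map_eq (hroots t ht)
  -- near `t`, distinct roots stay apart, and coinciding roots stay together
  have hdist : ∀ᶠ s in 𝓝 t, ∀ i j, lam i t ≠ lam j t → lam i s ≠ lam j s ∧ lam i s ≠ mu (π j) s := by
    refine eventually_all.2 fun i => eventually_all.2 fun j => ?_
    by_cases h : lam i t = lam j t
    · exact Eventually.of_forall fun s h' => absurd h h'
    · have h2 : lam i t ≠ mu (π j) t := fun h' => h (h'.trans (hπ j).symm)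
      filter_upwards [((hcl i).ne_iff_eventually_ne (hcl j)).1 h,
        ((hcl i).ne_iff_eventually_ne (hcm (π j))).1 h2] with s h3 h4 _
      exact ⟨h3, h4⟩
  refine ⟨t, ht, π, fun j => ?_⟩
  filter_upwards [hdist, hnhds] with s hs hsI
  have htog : ∀ i j, lam i t = lam j t → lam i s = lam j s := by
    have hrep : ∀ v ∈ Finset.univ.image fun j => lam j t, ∃ i, lam i t = v := fun v hv => by
      obtain ⟨i, -, h⟩ := Finset.mem_image.1 hv
      exact ⟨i, h⟩
    have : Nonempty (Fin n) := ⟨j⟩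
    choose! rep hrep using hrep
    -- by maximality, the roots at `s` are represented by the distinct roots at `t`
    have himg : ((Finset.univ.image fun j => lam j t).image fun v => lam (rep v) s) =
        Finset.univ.image fun j => lam j s := by
      refine Finset.eq_of_subset_of_card_le (fun z hz => ?_) ?_
      · obtain ⟨v, -, rfl⟩ := Finset.mem_image.1 hz
        exact Finset.mem_image_of_mem (fun j => lam j s) (Finset.mem_univ (rep v))
      · rw [Finset.card_image_of_injOn (s := Finset.univ.image fun j => lam j t)
          (f := fun v => lam (rep v) s)]
        · exact hmax s hsI
        · intro v hv w hw hvw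
          by_contra hne
          rw [← hrep v hv, ← hrep w hw] at hne
          exact (hs _ _ hne).1 hvw
    have hall : ∀ i, lam i s = lam (rep (lam i t)) s := by
      intro i
      have h1 : lam i s ∈ Finset.univ.image fun j => lam j s :=
        Finset.mem_image_of_mem (fun j => lam j s) (Finset.mem_univ i)
      rw [← himg] at h1
      obtain ⟨v, hv, h2⟩ := Finset.mem_image.1 h1
      have h3 : v = lam i t := by
        by_contra hne
        rw [← hrep v hv] at hne
        exact (hs _ _ hne).1 h2
      rw [← h3]
      exact h2.symm
    intro i j hij
    rw [hall i, hall j, hij]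
  have hmem : mu (π j) s ∈ Finset.univ.val.map fun j => lam j s := by
    rw [hroots s hsI]
    exact Multiset.mem_map_of_mem (fun j => mu j s) (Finset.mem_univ (π j))
  obtain ⟨i, -, hi⟩ := Multiset.mem_map.1 hmem
  rw [← hi]
  by_contra hne
  have : lam i t ≠ lam j t := fun h => hne (htog i j h).symm
  exact (hs i j this).2 hi

/-- Parameterizations which agree near a point may be exchanged there. -/
theorem SolOn.glue {t : ℝ} (hl : SolOn n q P a b lam) (hm : SolOn n q P c d mu) (hct : c < t)
    (htb : t < b) (h : ∀ j, ∀ᶠ s in 𝓝 t, lam j s = mu j s) :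
    SolOn n q P a d fun j s => if s ≤ t then lam j s else mu j s := by
  refine ⟨fun j s hs => ?_, fun s hs => ?_⟩
  · refine ContDiffAt.contDiffWithinAt ?_
    rcases lt_trichotomy s t with hst | hst | hst
    · refine (((hl.1 j).contDiffAt (isOpen_Ioo.mem_nhds ⟨hs.1, hst.trans htb⟩))).congr_of_eventuallyEq ?_
      filter_upwards [eventually_lt_nhds hst] with x hx
      rw [if_pos hx.le]
    · subst hst
      refine (((hl.1 j).contDiffAt (isOpen_Ioo.mem_nhds ⟨hs.1, htb⟩))).congr_of_eventuallyEq ?_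
      filter_upwards [h j] with x hx
      split_ifs
      · rfl
      · exact hx.symm
    · refine (((hm.1 j).contDiffAt (isOpen_Ioo.mem_nhds ⟨hct.trans hst, hs.2⟩))).congr_of_eventuallyEq ?_
      filter_upwards [eventually_gt_nhds hst] with x hx
      rw [if_neg (not_le.2 hx)]
  · by_cases hst : s ≤ t
    · simp only [if_pos hst]
      exact hl.2 s ⟨hs.1, hst.trans_lt htb⟩
    · simp only [if_neg hst]
      exact hm.2 s ⟨hct.trans (not_le.1 hst), hs.2⟩

/-- A parameterization on `(a, b)` is prolonged to the right, without change up to `c`. -/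
theorem SolOn.extend_right (hl : SolOn n q P a b lam) (hm : SolOn n q P c d mu) (hac : a ≤ c)
    (hcb : c < b) (hbd : b ≤ d) : ∃ nu, SolOn n q P a d nu ∧ ∀ j, ∀ s ≤ c, nu j s = lam j s := by
  obtain ⟨t, ht, π, h⟩ := (hl.mono hac le_rfl).exists_perm (hm.mono le_rfl hbd) hcb
  exact ⟨_, hl.glue (hm.perm π) ht.1 ht.2 h, fun j s hs => if_pos (hs.trans ht.1.le)⟩

theorem SolOn.extend_left (hl : SolOn n q P a b lam) (hm : SolOn n q P c d mu) (hac : a ≤ c)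
    (hcb : c < b) (hbd : b ≤ d) : ∃ nu, SolOn n q P a d nu ∧ ∀ j, ∀ s ≥ b, nu j s = mu j s := by
  obtain ⟨t, ht, π, h⟩ := (hl.mono hac le_rfl).exists_perm (hm.mono le_rfl hbd) hcb
  refine ⟨_, (hl.perm π.symm).glue hm ht.1 ht.2 fun j => ?_, fun j s hs =>
    if_neg (not_le.2 (ht.2.trans_le hs))⟩
  filter_upwards [h (π.symm j)] with s hs
  rw [hs, Equiv.apply_symm_apply]

/-- Overlapping intervals are merged, after a permutation of the second family. -/
theorem SolOn.union (hl : SolOn n q P a b lam) (hm : SolOn n q P c d mu) {y : ℝ}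
    (h1 : y ∈ Set.Ioo a b) (h2 : y ∈ Set.Ioo c d) :
    ∃ nu, SolOn n q P (min a c) (max b d) nu := by
  rcases le_total a c with hac | hac <;> rcases le_total b d with hbd | hbd
  · rw [min_eq_left hac, max_eq_right hbd]
    exact (hl.extend_right hm hac (h2.1.trans h1.2) hbd).imp fun _ h => h.1
  · rw [min_eq_left hac, max_eq_left hbd]
    exact ⟨_, hl⟩
  · rw [min_eq_right hac, max_eq_right hbd]
    exact ⟨_, hm⟩
  · rw [min_eq_right hac, max_eq_left hbd]
    exact (hm.extend_right hl hac (h1.1.trans h2.2) hbd).imp fun _ h => h.1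

/-- A parameterization near `[a, b]` may be replaced by one near the larger interval `[c, d]` which
agrees with it on `[a, b]`. -/
theorem SolOn.extend {a' b' c' d' : ℝ} (hl : SolOn n q P a' b' lam) (hm : SolOn n q P c' d' mu)
    (ha : a' < a) (hb : b < b') (hab : a ≤ b) (hc : c' < c) (hd : d < d') (hca : c ≤ a) (hbd : b ≤ d) :
    ∃ (nu : Fin n → ℝ → ℂ) (x y : ℝ), SolOn n q P x y nu ∧ x < c ∧ d < y ∧
      ∀ j, ∀ s ∈ Set.Icc a b, nu j s = lam j s := by
  obtain ⟨nu, y, h1, hy, h2⟩ : ∃ (nu : Fin n → ℝ → ℂ) (y : ℝ), SolOn n q P a' y nu ∧ d < y ∧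
      ∀ j, ∀ s ≤ b, nu j s = lam j s := by
    by_cases hbd' : b' ≤ d'
    · obtain ⟨nu, h1, h2⟩ := hl.extend_right (hm.mono (show c' ≤ b by linarith) le_rfl)
        (by linarith) hb hbd'
      exact ⟨nu, d', h1, hd, h2⟩
    · exact ⟨lam, b', hl, by linarith, fun j s _ => rfl⟩
  by_cases hac' : c' ≤ a'
  · obtain ⟨nu', h3, h4⟩ := (hm.mono le_rfl (show a ≤ d' by linarith)).extend_left h1 hac' ha
      (by linarith)
    exact ⟨nu', c', y, h3, hc, hy, fun j s hs => (h4 j s hs.1).trans (h2 j s hs.2)⟩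
  · exact ⟨nu, a', y, h1, by linarith, hy, fun j s hs => h2 j s hs.2⟩

/-- Parameterizations near compact subintervals exist if they exist locally. -/
theorem exists_solOn {I : Set ℝ} (hI : IsPreconnected I)
    (h : ∀ t ∈ I, ∃ a b lam, a < t ∧ t < b ∧ SolOn n q P a b lam) {x y : ℝ} (hx : x ∈ I) (hy : y ∈ I) :
    ∃ a b lam, x ∈ Set.Ioo a b ∧ y ∈ Set.Ioo a b ∧ SolOn n q P a b lam := by
  let p : ℝ → ℝ → Prop := fun x y => ∃ a b lam, x ∈ Set.Ioo a b ∧ y ∈ Set.Ioo a b ∧ SolOn n q P a b lam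
  refine hI.induction₂' p (fun t ht => ?_) (fun x y z _ _ _ hxy hyz => ?_) hx hy
  · obtain ⟨a, b, lam, ha, hb, hlam⟩ := h t ht
    filter_upwards [nhdsWithin_le_nhds (isOpen_Ioo.mem_nhds (show t ∈ Set.Ioo a b from ⟨ha, hb⟩))] with s hs
    exact ⟨⟨a, b, lam, ⟨ha, hb⟩, hs, hlam⟩, ⟨a, b, lam, hs, ⟨ha, hb⟩, hlam⟩⟩
  · obtain ⟨a, b, lam, h1, h2, h3⟩ := hxy
    obtain ⟨c, d, mu, h4, h5, h6⟩ := hyz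
    obtain ⟨nu, hnu⟩ := h3.union h6 h2 h4
    exact ⟨_, _, nu, ⟨(min_le_left _ _).trans_lt h1.1, h1.2.trans_le (le_max_left _ _)⟩,
      ⟨(min_le_right _ _).trans_lt h5.1, h5.2.trans_le (le_max_right _ _)⟩, hnu⟩

/-- An open interval is exhausted by compact intervals. -/
theorem exists_exhaustion {I : Set ℝ} (hI : IsOpen I) (hne : I.Nonempty) :
    ∃ a b : ℕ → ℝ, (∀ k, a k ∈ I ∧ b k ∈ I ∧ a k ≤ b k ∧ a (k + 1) ≤ a k ∧ b k ≤ b (k + 1)) ∧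
      ∀ t ∈ I, ∃ k, a k < t ∧ t < b k := by
  obtain ⟨s, hsc, hsd, hsI⟩ := TopologicalSpace.exists_countable_dense ℝ |>.imp fun s hs =>
    (⟨hs.1, hs.2, trivial⟩ : s.Countable ∧ Dense s ∧ True)
  have hne' : (I ∩ s).Nonempty := hsd.inter_open_nonempty I hI hne
  obtain ⟨e, he⟩ := (hsc.mono Set.inter_subset_right).exists_eq_range hne'
  have heI : ∀ k, e k ∈ I := fun k => by
    have : e k ∈ I ∩ s := he ▸ Set.mem_range_self k
    exact this.1
  have hr : ∀ k, (Finset.range (k + 1)).Nonempty := fun k => Finset.nonempty_range_add_one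
  have hsub : ∀ k, Finset.range (k + 1) ⊆ Finset.range (k + 1 + 1) := fun k =>
    Finset.range_subset_range.2 (Nat.le_succ _)
  refine ⟨fun k => (Finset.range (k + 1)).inf' (hr k) e, fun k => (Finset.range (k + 1)).sup' (hr k) e,
    fun k => ⟨?_, ?_, ?_, ?_, ?_⟩, fun t ht => ?_⟩
  · obtain ⟨i, -, h⟩ := Finset.exists_mem_eq_inf' (hr k) e
    show (Finset.range (k + 1)).inf' (hr k) e ∈ I
    rw [h]
    exact heI i
  · obtain ⟨i, -, h⟩ := Finset.exists_mem_eq_sup' (hr k) e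
    show (Finset.range (k + 1)).sup' (hr k) e ∈ I
    rw [h]
    exact heI i
  · exact (Finset.inf'_le e (Finset.mem_range.2 (Nat.succ_pos k))).trans
      (Finset.le_sup' e (Finset.mem_range.2 (Nat.succ_pos k)))
  · exact Finset.inf'_mono e (hsub k) (hr k)
  · exact Finset.sup'_mono e (hsub k) (hr k)
  · obtain ⟨δ, hδ, hball⟩ := Metric.isOpen_iff.1 hI t ht
    rw [Real.ball_eq_Ioo] at hball
    have hget : ∀ x y, x < y → Set.Ioo x y ⊆ I → ∃ i, e i ∈ Set.Ioo x y := by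
      intro x y hxy hsub
      obtain ⟨z, hz, hzs⟩ := hsd.inter_open_nonempty _ isOpen_Ioo (Set.nonempty_Ioo.2 hxy)
      have : z ∈ I ∩ s := ⟨hsub hz, hzs⟩
      rw [he] at this
      obtain ⟨i, rfl⟩ := this
      exact ⟨i, hz⟩
    obtain ⟨i, hi⟩ := hget (t - δ) t (by linarith) ((Set.Ioo_subset_Ioo_right (by linarith)).trans hball)
    obtain ⟨j, hj⟩ := hget t (t + δ) (by linarith) ((Set.Ioo_subset_Ioo_left (by linarith)).trans hball)
    refine ⟨max i j, ?_, ?_⟩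
    · exact (Finset.inf'_le e (Finset.mem_range.2 (by omega))).trans_lt hi.2
    · exact hj.1.trans_le (Finset.le_sup' e (Finset.mem_range.2 (by omega)))

/-- Local solvability implies solvability. -/
theorem solvable_of_local {I : Set ℝ} (hIo : IsOpen I) (hIc : I.OrdConnected)
    (h : ∀ t ∈ I, ∃ a b lam, a < t ∧ t < b ∧ SolOn n q P a b lam) : Solvable n q I P := by
  rcases I.eq_empty_or_nonempty with rfl | hne
  · exact ⟨fun _ _ => 0, fun j => contDiffOn_const, fun t ht => ht.elim⟩
  obtain ⟨a, b, hab, hex⟩ := exists_exhaustion hIo hne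
  -- parameterizations near `[a k, b k]`, each of which prolongs the previous one
  let Z : ℕ → Type := fun k => {lam : Fin n → ℝ → ℂ // ∃ x y, x < a k ∧ b k < y ∧ SolOn n q P x y lam}
  have hstep : ∀ k (z : Z k), ∃ w : Z (k + 1), ∀ j, ∀ s ∈ Set.Icc (a k) (b k), w.1 j s = z.1 j s := by
    rintro k ⟨lam, x, y, hx, hy, hlam⟩
    obtain ⟨c, d, mu, h1, h2, hmu⟩ := exists_solOn hIc.isPreconnected h (hab (k + 1)).1 (hab (k + 1)).2.1
    obtain ⟨nu, x', y', h3, h4, h5, h6⟩ := hlam.extend hmu hx hy (hab k).2.2.1 h1.1 h2.2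
      (hab k).2.2.2.1 (hab k).2.2.2.2
    exact ⟨⟨nu, x', y', h4, h5, h3⟩, h6⟩
  choose f hf using hstep
  have hz0 : Nonempty (Z 0) := by
    obtain ⟨c, d, mu, h1, h2, hmu⟩ := exists_solOn hIc.isPreconnected h (hab 0).1 (hab 0).2.1
    exact ⟨⟨mu, c, d, h1.1, h2.2, hmu⟩⟩
  let z : ∀ k, Z k := fun k => Nat.rec (motive := Z) hz0.some f k
  have hz : ∀ k j, ∀ s ∈ Set.Icc (a k) (b k), (z (k + 1)).1 j s = (z k).1 j s := fun k j s hs =>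
    hf k (z k) j s hs
  have hzle : ∀ k i, ∀ j, ∀ s ∈ Set.Icc (a k) (b k), s ∈ Set.Icc (a (k + i)) (b (k + i)) ∧
      (z (k + i)).1 j s = (z k).1 j s := by
    intro k i j s hs
    induction i with
    | zero => exact ⟨hs, rfl⟩
    | succ i ih =>
      refine ⟨⟨(hab (k + i)).2.2.2.1.trans ih.1.1, ih.1.2.trans (hab (k + i)).2.2.2.2⟩, ?_⟩
      exact (hz (k + i) j s ih.1).trans ih.2
  choose! K hK using hex
  have hcons : ∀ k j, ∀ s ∈ Set.Icc (a k) (b k), s ∈ I → (z (K s)).1 j s = (z k).1 j s := by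
    intro k j s hs hsI
    have hs' : s ∈ Set.Icc (a (K s)) (b (K s)) := ⟨(hK s hsI).1.le, (hK s hsI).2.le⟩
    rcases le_total k (K s) with hle | hle
    · obtain ⟨i, hi⟩ := Nat.exists_eq_add_of_le hle
      rw [hi]
      exact (hzle k i j s hs).2
    · obtain ⟨i, hi⟩ := Nat.exists_eq_add_of_le hle
      have := (hzle (K s) i j s hs').2
      rw [← hi] at this
      exact this.symm
  refine ⟨fun j s => (z (K s)).1 j s, fun j t ht => ContDiffAt.contDiffWithinAt ?_, fun t ht => ?_⟩
  · obtain ⟨x, y, hx, hy, hsol⟩ := (z (K t)).2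
    have htK := hK t ht
    have h1 : t ∈ Set.Ioo x y := ⟨hx.trans htK.1, htK.2.trans hy⟩
    refine ((hsol.1 j).contDiffAt (isOpen_Ioo.mem_nhds h1)).congr_of_eventuallyEq ?_
    filter_upwards [isOpen_Ioo.mem_nhds (show t ∈ Set.Ioo (a (K t)) (b (K t)) from htK),
      hIo.mem_nhds ht] with s hs hsI
    exact hcons (K t) j s ⟨hs.1.le, hs.2.le⟩ hsI
  · obtain ⟨x, y, hx, hy, hsol⟩ := (z (K t)).2
    exact hsol.2 t ⟨hx.trans (hK t ht).1, (hK t ht).2.trans hy⟩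

end glue

/-! ### From germs to curves -/

section global
variable {n : ℕ} {D q : ℕ∞} {E : ℕ} {I : Set ℝ} {P : ℝ → ℂ[X]} {t : ℝ}

theorem eventually_nhds_add {p : ℝ → Prop} : (∀ᶠ x in 𝓝 t, p x) ↔ ∀ᶠ s in 𝓝 (0 : ℝ), p (t + s) := by
  have : 𝓝 t = map (fun s => t + s) (𝓝 0) := by rw [map_add_left_nhds, add_zero]
  rw [this, eventually_map]

theorem IsCurve.coefReg (hIo : IsOpen I) (hP : IsCurve n D I P) (ht : t ∈ I) :
    CoefReg D 0 fun s => P (t + s) := by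
  obtain ⟨δ, hδ, hball⟩ := Metric.isOpen_iff.1 hIo t ht
  rw [Real.ball_eq_Ioo] at hball
  intro k
  have hmaps : Set.MapsTo (fun s => t + s) (Set.Ioo (-δ) δ) I := fun s hs =>
    hball ⟨by linarith [hs.1], by linarith [hs.2]⟩
  have h : ContDiffOn ℝ (D : WithTop ℕ∞) (fun s => (P (t + s)).coeff k) (Set.Ioo (-δ) δ) :=
    (hP.2 k).comp (contDiff_const.add contDiff_id).contDiffOn hmaps
  refine ⟨δ, hδ, h.continuousOn, ?_⟩
  simpa only [pow_zero, one_smul] using h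

theorem IsCurve.isGerm (hIo : IsOpen I) (hP : IsCurve n D I P) (ht : t ∈ I) :
    IsGerm n fun s => P (t + s) := by
  refine ⟨eventually_nhds_add (p := fun x => (P x).Monic ∧ (P x).natDegree = n) |>.1 ?_, ?_⟩
  · filter_upwards [hIo.mem_nhds ht] with s hs
    exact hP.1 s hs
  · exact IsCurve.coefReg hIo (D := 0)
      ⟨hP.1, fun k => (hP.2 k).of_le (by exact_mod_cast (zero_le : 0 ≤ D))⟩ ht

theorem finiteContact_translate (hE : infiniteContact I P = ∅) (ht : t ∈ I) :
    FiniteContact fun s => P (t + s) := by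
  rintro ⟨s, hs, hm⟩
  have : t ∈ infiniteContact I P := by
    refine ⟨ht, s, ?_, hm⟩
    simpa only [eventually_nhds_add (t := t)] using hs
  rw [hE] at this
  exact this

/-- Roots regular at each point give a local parameterization of the corresponding class. -/
theorem RootsIn.exists_solOn (hP : IsGerm n fun s => P (t + s)) (h : RootsIn D E fun s => P (t + s))
    (hq : q + E ≤ D) : ∃ a b lam, a < t ∧ t < b ∧ SolOn n q P a b lam := by
  obtain ⟨lam, hlam, hprod⟩ := h.exists_fin hP
  have h1 : ∀ i, ∀ᶠ s in 𝓝 (0 : ℝ), ContDiffAt ℝ (q : WithTop ℕ∞) (lam i) s := fun i => by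
    obtain ⟨δ, hδ, hw⟩ := hlam i
    filter_upwards [isOpen_Ioo.mem_nhds (show (0 : ℝ) ∈ Set.Ioo (-δ) δ from ⟨by linarith, hδ⟩)]
      with s hs
    exact (hw.contDiffOn hq).contDiffAt (isOpen_Ioo.mem_nhds hs)
  obtain ⟨δ, hδ, h2⟩ := eventually_iff_Ioo.1 ((eventually_all.2 h1).and hprod)
  refine ⟨t - δ, t + δ, fun i x => lam i (x - t), by linarith, by linarith, fun i x hx => ?_,
    fun x hx => ?_⟩
  · have hx' : x - t ∈ Set.Ioo (-δ) δ := ⟨by linarith [hx.1], by linarith [hx.2]⟩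
    exact (((h2 _ hx').1 i).comp x (contDiff_id.sub contDiff_const).contDiffAt).contDiffWithinAt
  · have hx' : x - t ∈ Set.Ioo (-δ) δ := ⟨by linarith [hx.1], by linarith [hx.2]⟩
    simpa using (h2 _ hx').2

theorem le_Gamma (ht : t ∈ I) : ((treeAt P t).Gamma : ℕ∞) ≤ Gamma I P :=
  le_iSup₂_of_le (f := fun t (_ : t ∈ I) => ((treeAt P t).Gamma : ℕ∞)) t ht le_rfl

theorem le_GammaHat (ht : t ∈ I) : (germGammaHat (fun s => P (t + s)) : ℕ∞) ≤ GammaHat I P :=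
  le_iSup₂_of_le (f := fun t (_ : t ∈ I) => (germGammaHat (fun s => P (t + s)) : ℕ∞)) t ht le_rfl

theorem gamma_le_of_good (ht : t ∈ I) (hG : (treeAt P t).Good) :
    gamma I P ≤ Gamma I P - (treeAt P t).Gamma + (treeAt P t).gamma :=
  (min_le_left _ _).trans (iInf₂_le t ⟨ht, hG⟩)

theorem gamma_le_of_bad (ht : t ∈ I) (hB : (treeAt P t).Bad) :
    gamma I P ≤ (treeAt P t).gamma :=
  (min_le_right _ _).trans (iInf₂_le t ⟨ht, hB⟩)

/-- At a point with good tree, the loss of regularity is `Γ_t - γ_t`. -/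
theorem exists_solOn_of_good {p : ℕ∞} (hIo : IsOpen I) (hP : IsCurve n (p + Gamma I P) I P)
    (ht : t ∈ I) (hG : (treeAt P t).Good) (hS : Sep fun s => P (t + s)) :
    ∃ a b lam, a < t ∧ t < b ∧ SolOn n (p + gamma I P) P a b lam := by
  have hgerm := hP.isGerm hIo ht
  have h1 : ((treeAt P t).Gamma : ℕ∞) ≤ Gamma I P := le_Gamma ht
  have h2 : (treeAt P t).gamma ≤ (treeAt P t).Gamma := gamma_le_Gamma_germTree hgerm
  have h3 := gamma_le_of_good ht hG
  have hroots := rootsIn_of_good (e := 0) hgerm (hP.coefReg hIo ht) hG hS (by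
    rw [zero_add]
    exact h1.trans le_add_self)
  refine hroots.exists_solOn hgerm ?_
  rw [zero_add, add_assoc]
  refine add_le_add_right ?_ p
  change gamma I P + (((treeAt P t).Gamma - (treeAt P t).gamma : ℕ) : ℕ∞) ≤ _
  generalize gamma I P = g at *
  generalize Gamma I P = G at *
  induction G with
  | top => exact le_top
  | coe G =>
    refine (add_le_add_left h3 _).trans ?_
    norm_cast at h1 ⊢
    omega

/-- At a point with bad tree, class `C^{γ_t}` is left, and `γ(P) ≤ γ_t`. -/
theorem exists_solOn_of_bad {D : ℕ} (hIo : IsOpen I) (hP : IsCurve n D I P) (ht : t ∈ I)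
    (hB : (treeAt P t).Bad) (hS : Sep fun s => P (t + s))
    (hH : (treeAt P t).Fair ∨ germGammaHat (fun s => P (t + s)) + 1 ≤ D)
    (hD : (treeAt P t).Gamma ≤ D) :
    ∃ a b lam, a < t ∧ t < b ∧ SolOn n (gamma I P) P a b lam := by
  have hgerm := hP.isGerm hIo ht
  have h2 : (treeAt P t).gamma ≤ (treeAt P t).Gamma := gamma_le_Gamma_germTree hgerm
  have hroots := rootsIn_of_fair (e := 0) hgerm (hP.coefReg hIo ht) hS
    (hH.imp id fun h => by rwa [zero_add]) (by rwa [zero_add])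
  refine hroots.exists_solOn hgerm ((add_le_add_left (gamma_le_of_bad ht hB) _).trans ?_)
  change (((treeAt P t).gamma : ℕ) : ℕ∞) + (((D - (treeAt P t).gamma : ℕ)) : ℕ∞) ≤ _
  norm_cast
  omega

theorem IsCurve.of_le {q : ℕ∞} (hP : IsCurve n D I P) (h : q ≤ D) : IsCurve n q I P :=
  ⟨hP.1, fun k => (hP.2 k).of_le (by exact_mod_cast h)⟩

theorem solvable_zero (hP : IsCurve 0 D I P) : Solvable 0 q I P := by
  refine ⟨fun j => j.elim0, fun j => j.elim0, fun t ht => ?_⟩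
  obtain ⟨h1, h2⟩ := hP.1 t ht
  simpa using h1.natDegree_eq_zero.1 h2

variable {p : ℕ∞}

/-- If all trees are good, the loss of regularity is `Γ(P) - γ(P)`. -/
theorem solvable_of_good (hIo : IsOpen I) (hIc : I.OrdConnected)
    (hP : IsCurve n (p + Gamma I P) I P) (hE : infiniteContact I P = ∅)
    (hG : ∀ t ∈ I, (treeAt P t).Good) : Solvable n (p + gamma I P) I P :=
  solvable_of_local hIo hIc fun t ht => exists_solOn_of_good hIo hP ht (hG t ht)
    (sep_of_fair (hP.isGerm hIo ht) (hG t ht).fair (finiteContact_translate hE ht))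

theorem solvable_of_fair (hIo : IsOpen I) (hIc : I.OrdConnected) (hP : IsCurve n (Gamma I P) I P)
    (hE : infiniteContact I P = ∅) (hF : ∀ t ∈ I, (treeAt P t).Fair) :
    Solvable n (gamma I P) I P := by
  refine solvable_of_local hIo hIc fun t ht => ?_
  have hS := sep_of_fair (hP.isGerm hIo ht) (hF t ht) (finiteContact_translate hE ht)
  by_cases hG : (treeAt P t).Good
  · simpa only [zero_add] using
      exists_solOn_of_good (p := 0) hIo (by rwa [zero_add]) ht hG hS
  · exact exists_solOn_of_bad hIo (hP.of_le (le_Gamma ht)) ht ⟨(hF t ht).1, hG⟩ hS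
      (Or.inl (hF t ht)) le_rfl

/-- With more than `Γ̂` derivatives available, all trees are admissible, so that each of them is good or bad.
In degree `0` the tree is not admissible, but there are no roots. -/
theorem solvable_of_gammaHat (hIo : IsOpen I) (hIc : I.OrdConnected)
    (hP : IsCurve n (Gamma I P) I P) (hP' : IsCurve n (1 + GammaHat I P) I P)
    (hE : infiniteContact I P = ∅) : Solvable n (gamma I P) I P := by
  rcases Nat.eq_zero_or_pos n with rfl | hn
  · exact solvable_zero hP
  refine solvable_of_local hIo hIc fun t ht => ?_
  have hgerm := hP.isGerm hIo ht
  have hfc := finiteContact_translate hE ht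
  by_cases hG : (treeAt P t).Good
  · simpa only [zero_add] using exists_solOn_of_good (p := 0) hIo (by rwa [zero_add]) ht hG
      (sep_of_fair hgerm hG.fair hfc)
  · set h := germGammaHat fun s => P (t + s) with hh
    have h1 : IsCurve n ((h + 1 : ℕ) : ℕ∞) I P := hP'.of_le (by
      rw [add_comm]
      push_cast
      exact add_le_add_right (le_GammaHat ht) 1)
    have hC := h1.coefReg hIo ht
    have hA : (treeAt P t).Admissible := admissible_of_gammaHat (e := 0) hgerm hn hC (by omega)
    have hS := sep_of_gammaHat hgerm hC le_rfl hfc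
    have h2 : IsCurve n (max (treeAt P t).Gamma (h + 1) : ℕ) I P := by
      rcases max_choice (treeAt P t).Gamma (h + 1) with h3 | h3 <;> rw [h3]
      · exact hP.of_le (le_Gamma ht)
      · exact h1
    exact exists_solOn_of_bad hIo h2 ht ⟨hA, hG⟩ hS (Or.inr (le_max_right _ _)) (le_max_left _ _)

end global

end RootCurve

end

theorem theorem5p3 (n : ℕ) (I : Set ℝ) (hIo : IsOpen I) (hIc : I.OrdConnected)
    (P : ℝ → Polynomial ℂ) (p : ℕ∞)
    (hP : RootCurve.IsCurve n (p + RootCurve.Gamma I P) I P)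
    (hE : RootCurve.infiniteContact I P = ∅) :
    ((∀ t ∈ I, (RootCurve.treeAt P t).Good) →
        RootCurve.Solvable n (p + RootCurve.gamma I P) I P) ∧
      ((∀ t ∈ I, (RootCurve.treeAt P t).Fair) →
        RootCurve.Solvable n (RootCurve.gamma I P) I P) ∧
      ((∃ t ∈ I, (RootCurve.treeAt P t).Bad) →
        RootCurve.IsCurve n (1 + RootCurve.GammaHat I P) I P →
        RootCurve.Solvable n (RootCurve.gamma I P) I P) := by
  have hP' : RootCurve.IsCurve n (RootCurve.Gamma I P) I P := hP.of_le le_add_self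
  exact ⟨RootCurve.solvable_of_good hIo hIc hP hE, RootCurve.solvable_of_fair hIo hIc hP' hE,
    fun _ h => RootCurve.solvable_of_gammaHat hIo hIc hP' h hE⟩
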